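/- **Conventions.** Let $X$ be a complex Banach space with dual $X'$, let $\mathcal B(X)$ be the bounded linear operators on $X$, and let $R(\lambda,T)=(\lambda-T)^{-1}$ for $T\in\mathcal B(X)$. Let $(r_n)$ be independent Rademacher variables and $(\gamma_n)$ independent standard real Gaussian variables. For $\omega>1$ put $\mathrm{Stolz}_\omega=\{z\in\mathbb C:\ |z|<1,\ |1-z|/(1-|z|)<\omega\}$. * A set $\mathcal T\subseteq\mathcal B(X)$ is *$R$-bounded* if there is $C$ with $\mathbb E\|\sum_{n=1}^N r_nT_nx_n\|\le C\,\mathbb E\|\sum_{n=1}^N r_nx_n\|$ for all $N$, $T_1,\dots,T_N\in\mathcal T$ and $x_1,\dots,x_N\in X$. $T\in\mathcal B(X)$ is *$R$-Ritt* if $\sigma(T)\subseteq\overline{\mathbb D}$ and $\{(\lambda-1)R(\lambda,T):|\lambda|>1\}$ is $R$-bounded. It is *$R$-Ritt of type $\omega$* if moreover $\sigma(T)\subseteq\overline{\mathrm{Stolz}_\omega}$ and, for every $\theta>\omega$, the set $\{(\lambda-1)R(\lambda,T):\lambda\notin\overline{\mathrm{Stolz}_\theta}\}$ is $R$-bounded.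 * $\gamma(\ell_2;X)$ is the space of sequences $(x_k)_{k\ge1}$ in $X$ for which $\sum_k\gamma_kx_k$ converges in $L^2(\Omega;X)$, with norm $(\mathbb E\|\sum_k\gamma_kx_k\|^2)^{1/2}$. For an integer $m\ge1$, $T$ *admits the square function estimate $\Phi_m$* if $x\mapsto(k^{m-1/2}T^{k-1}(I-T)^mx)_{k\ge1}$ is bounded from $X$ to $\gamma(\ell_2;X)$, and *the dual square function estimate $\Phi_m^*$* if $x'\mapsto(k^{m-1/2}(T')^{k-1}(I-T')^mx')_{k\ge1}$ is bounded from $X'$ to $\gamma(\ell_2;X)'$, for the pairing $\langle(x_k'),(x_k)\rangle=\sum_k\langle x_k',x_k\rangle$. * Let $T$ be $R$-Ritt of type $\omega$ and $\nu>\omega$. Let $H^\infty(\mathrm{Stolz}_\nu)$ be the bounded holomorphic functions on $\mathrm{Stolz}_\nu$ with the supremum norm. A function $f\in H^\infty(\mathrm{Stolz}_\nu)$ is *elementary* if $f(z)/(1-z)\in L^1(\partial\,\mathrm{Stolz}_\vartheta)$ for some $\omega<\vartheta<\nu$, and then $f(T)=\frac1{2\pi i}\int_{\partial\,\mathrm{Stolz}_\vartheta}f(z)R(z,T)\,dz$.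 An elementary $e$ *regularises* $f\in H^\infty(\mathrm{Stolz}_\nu)$ if $e(T)$ is injective and $ef$ is elementary, and then $f(T)=e(T)^{-1}(ef)(T)$. * $T$ *has a bounded $H^\infty(\mathrm{Stolz}_\nu)$-calculus* if there is a constant $C$ such that $\|f(T)\|\le C\|f\|_\infty$ for all elementary $f$ and, if $I-T$ is injective, every $f\in H^\infty(\mathrm{Stolz}_\nu)$ has a regulariser and, for every regulariser of $f$, the operator $f(T)$ so obtained is the same everywhere defined bounded operator, with $\|f(T)\|\le C\|f\|_\infty$. (If $I-T$ is not injective, no regulariser exists and only the first condition is meaningful.) **Theorem.** Let $X$ be a complex Banach space, let $\omega>1$, and let $T$ be an $R$-Ritt operator of type $\omega$ on $X$ which admits the square function estimate $\Phi_{m_1}$ and the dual square function estimate $\Phi^*_{m_2}$ for some integers $m_1,m_2\ge1$. Then $T$ has a bounded $H^\infty(\mathrm{Stolz}_\theta)$-calculus for every $\theta>\omega$. -/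

import Mathlib

open MeasureTheory ProbabilityTheory Filter Topology
open scoped ENNReal

noncomputable section

namespace Ritt

/-! ### Stolz domains -/

/-- The Stolz domain of type `ω`. -/
def stolz (ω : ℝ) : Set ℂ :=
  {z | ‖z‖ < 1 ∧ ‖1 - z‖ / (1 - ‖z‖) < ω}

/-- Half of the opening angle of `stolz ϑ`. -/
def stolzAngle (ϑ : ℝ) : ℝ := Real.arccos (1 / ϑ)

/-- Distance from `1` of the boundary point of `stolz ϑ` in direction `-exp (i t)`. -/
def stolzRadius (ϑ t : ℝ) : ℝ := 2 * ϑ / (ϑ ^ 2 - 1) * (ϑ * Real.cos t - 1)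

/-- Polar parametrisation around `1` of the boundary of `stolz ϑ` (for `ϑ > 1`), run through once,
counterclockwise, from `1` to `1`, as `t` runs from `-stolzAngle ϑ` to `stolzAngle ϑ`. -/
def stolzCurve (ϑ t : ℝ) : ℂ := 1 - (stolzRadius ϑ t : ℂ) * Complex.exp (t * Complex.I)

/-! ### Bounded holomorphic functions -/

/-- `f` is a bounded holomorphic function on `Ω`. Values outside `Ω` are irrelevant. -/
def IsHInfty (Ω : Set ℂ) (f : ℂ → ℂ) : Prop :=
  DifferentiableOn ℂ f Ω ∧ ∃ M : ℝ, ∀ z ∈ Ω, ‖f z‖ ≤ M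

/-- The supremum norm on `Ω`. -/
def hInftyNorm (Ω : Set ℂ) (f : ℂ → ℂ) : ℝ := ⨆ z : Ω, ‖f z‖

/-- `f` is an elementary function on `stolz ν` through the path `∂ (stolz ϑ)`: it is bounded
holomorphic on `stolz ν`, `ω < ϑ < ν`, and `f z / (1 - z)` is integrable on `∂ (stolz ϑ)`. -/
def IsElementaryVia (ω ν ϑ : ℝ) (f : ℂ → ℂ) : Prop :=
  IsHInfty (stolz ν) f ∧ ω < ϑ ∧ ϑ < ν ∧
    IntervalIntegrable
      (fun t : ℝ => f (stolzCurve ϑ t) / (1 - stolzCurve ϑ t) * deriv (stolzCurve ϑ) t)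
      volume (-stolzAngle ϑ) (stolzAngle ϑ)

section Space

variable {X : Type*} [NormedAddCommGroup X] [NormedSpace ℂ X]

/-! ### Rademacher averages, R-boundedness and R-Ritt operators -/

/-- `𝔼 ‖∑ₙ rₙ xₙ‖` for independent Rademacher variables `rₙ`, as the average over all signs. -/
def rademacherAverage {N : ℕ} (x : Fin N → X) : ℝ :=
  (∑ ε : Fin N → ℤˣ, ‖∑ n, (ε n : ℤ) • x n‖) / 2 ^ N

/-- R-boundedness of a set of bounded operators. -/
def IsRBounded (𝒯 : Set (X →L[ℂ] X)) : Prop :=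
  ∃ C : ℝ, ∀ (N : ℕ) (S : Fin N → X →L[ℂ] X) (x : Fin N → X), (∀ n, S n ∈ 𝒯) →
    rademacherAverage (fun n => S n (x n)) ≤ C * rademacherAverage x

/-- `T` is R-Ritt: its spectrum lies in the closed unit disc and the set of all
`(λ - 1) R(λ, T)`, `|λ| > 1`, is R-bounded. -/
def IsRRitt (T : X →L[ℂ] X) : Prop :=
  spectrum ℂ T ⊆ Metric.closedBall 0 1 ∧
    IsRBounded {A : X →L[ℂ] X | ∃ l : ℂ, 1 < ‖l‖ ∧ A = (l - 1) • resolvent T l}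

/-- `T` is an R-Ritt operator of type `ω`: it is R-Ritt, its spectrum lies in the closure of
`stolz ω`, and for every `θ > ω` the set of all `(λ - 1) R(λ, T)`, with `λ` outside the closure of
`stolz θ`, is R-bounded. -/
def IsRRittOfType (T : X →L[ℂ] X) (ω : ℝ) : Prop :=
  IsRRitt T ∧ spectrum ℂ T ⊆ closure (stolz ω) ∧
    ∀ θ : ℝ, ω < θ →
      IsRBounded {A : X →L[ℂ] X | ∃ l : ℂ, l ∉ closure (stolz θ) ∧ A = (l - 1) • resolvent T l}

/-! ### Gaussian sums and (dual) square functions -/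

/-- The law of a sequence of independent standard real Gaussian variables; the variables
themselves are the coordinates on `ℕ → ℝ`. -/
def gaussianSeq : Measure (ℕ → ℝ) := Measure.infinitePi (fun _ => gaussianReal 0 1)

/-- The series `∑ₖ γₖ xₖ` converges to `S` in `L²(X)`, that is, `(xₖ)` belongs to `γ(ℓ₂; X)`;
its norm in that space is then `eLpNorm S 2 gaussianSeq = (𝔼 ‖∑ₖ γₖ xₖ‖²)^(1/2)`. -/
def HasGaussianSum (x : ℕ → X) (S : (ℕ → ℝ) → X) : Prop :=
  MemLp S 2 gaussianSeq ∧
    Tendsto (fun n => eLpNorm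
      (fun g : ℕ → ℝ => (∑ k ∈ Finset.range n, ((g k : ℝ) : ℂ) • x k) - S g) 2 gaussianSeq)
      atTop (𝓝 0)

/-- The operators `k^(m - 1/2) T^(k-1) (I - T)^m`, `k ≥ 1`, with the index shifted to start at
`0`. -/
def sqfOp (T : X →L[ℂ] X) (m k : ℕ) : X →L[ℂ] X :=
  (((((k : ℝ) + 1) ^ ((m : ℝ) - 1 / 2) : ℝ)) : ℂ) • (T ^ k * (1 - T) ^ m)

/-- The square function estimate `Φ_m`: the map `x ↦ (k^(m - 1/2) T^(k-1) (I - T)^m x)ₖ` is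
bounded from `X` to `γ(ℓ₂; X)`. -/
def SquareFunctionEstimate (T : X →L[ℂ] X) (m : ℕ) : Prop :=
  ∃ C : ℝ, ∀ x : X, ∃ S : (ℕ → ℝ) → X,
    HasGaussianSum (fun k => sqfOp T m k x) S ∧
      eLpNorm S 2 gaussianSeq ≤ ENNReal.ofReal (C * ‖x‖)

/-- The dual operator `T' : X' → X'`, `x' ↦ x' ∘ T`. -/
def dualOp (T : X →L[ℂ] X) : StrongDual ℂ X →L[ℂ] StrongDual ℂ X :=
  ContinuousLinearMap.precomp ℂ T

/-- The dual square function estimate `Φ*_m`: the map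
`x' ↦ (k^(m - 1/2) (T')^(k-1) (I - T')^m x')ₖ` is bounded from `X'` to the dual of `γ(ℓ₂; X)`,
where a sequence `(x'ₖ)` acts on `γ(ℓ₂; X)` by `(xₖ) ↦ ∑ₖ ⟨x'ₖ, xₖ⟩`. -/
def DualSquareFunctionEstimate (T : X →L[ℂ] X) (m : ℕ) : Prop :=
  ∃ C : ℝ, ∀ (x' : StrongDual ℂ X) (x : ℕ → X) (S : (ℕ → ℝ) → X),
    HasGaussianSum x S → eLpNorm S 2 gaussianSeq ≤ 1 →
      Summable (fun k => (sqfOp (dualOp T) m k x') (x k)) ∧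
        ‖∑' k, (sqfOp (dualOp T) m k x') (x k)‖ ≤ C * ‖x'‖

/-! ### The functional calculus -/

/-- `(2πi)⁻¹ ∫_{∂ (stolz ϑ)} f(z) R(z, T) dz`. -/
def elementaryIntegral (T : X →L[ℂ] X) (ϑ : ℝ) (f : ℂ → ℂ) : X →L[ℂ] X :=
  (2 * Real.pi * Complex.I : ℂ)⁻¹ •
    ∫ t in (-stolzAngle ϑ)..(stolzAngle ϑ),
      (f (stolzCurve ϑ t) * deriv (stolzCurve ϑ) t) • resolvent T (stolzCurve ϑ t)

/-- Elementary functional calculus of an operator of type `ω`: `f` is an elementary function on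
`stolz ν` and `f(T) = A`. -/
def ElementaryCalculus (T : X →L[ℂ] X) (ω ν : ℝ) (f : ℂ → ℂ) (A : X →L[ℂ] X) : Prop :=
  ∃ ϑ : ℝ, IsElementaryVia ω ν ϑ f ∧ A = elementaryIntegral T ϑ f

/-- `e` regularises `f`, with `E = e(T)` injective and `G = (e f)(T)`. -/
def Regularises (T : X →L[ℂ] X) (ω ν : ℝ) (e f : ℂ → ℂ) (E G : X →L[ℂ] X) : Prop :=
  ElementaryCalculus T ω ν e E ∧ Function.Injective E ∧
    ElementaryCalculus T ω ν (fun z => e z * f z) G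

/-- The operator `f(T) = e(T)⁻¹ (e f)(T)`, defined by regularisation, is everywhere defined and
equals `S`. As `e(T)` is injective, `e(T)⁻¹ (e f)(T) = S` means `e(T) S = (e f)(T)`; this is
required of every regulariser `e`, and there has to be one. -/
def ExtendedCalculus (T : X →L[ℂ] X) (ω ν : ℝ) (f : ℂ → ℂ) (S : X →L[ℂ] X) : Prop :=
  (∃ (e : ℂ → ℂ) (E G : X →L[ℂ] X), Regularises T ω ν e f E G) ∧
    ∀ (e : ℂ → ℂ) (E G : X →L[ℂ] X), Regularises T ω ν e f E G → E ∘L S = G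

/-- The operator `T` of type `ω` has a bounded `H^∞(stolz ν)`-calculus: the elementary calculus is
bounded for the supremum norm and, whenever `I - T` is injective (which is necessary for the
existence of a regulariser), `f(T)` is an everywhere defined bounded operator for every
`f ∈ H^∞(stolz ν)`, with norm at most a constant times the supremum norm of `f`. -/
def HasBoundedHInftyCalculus (T : X →L[ℂ] X) (ω ν : ℝ) : Prop :=
  ∃ C : ℝ,
    (∀ (f : ℂ → ℂ) (A : X →L[ℂ] X), ElementaryCalculus T ω ν f A →
      ‖A‖ ≤ C * hInftyNorm (stolz ν) f) ∧
    (Function.Injective (1 - T : X →L[ℂ] X) →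
      ∀ f : ℂ → ℂ, IsHInfty (stolz ν) f →
        ∃ S : X →L[ℂ] X, ExtendedCalculus T ω ν f S ∧ ‖S‖ ≤ C * hInftyNorm (stolz ν) f)

end Space

end Ritt

end

/-! The proof rests on a reproducing formula. With `y = z ^ 3` and `M = m₁ + m₂`, the negative
binomial series gives `∑ₖ binom(k + M, M) y ^ k (1 - y) ^ (M + 1) = 1`, and `1 - y = (1 - z)(1 + z +
z²)`. Insert `T`, and let one factor `1 - T` be absorbed into `F = ((1 - z) f)(T)`, which is always
an elementary integral. The candidate for `f(T)` is then the sum of the blocks `binom(k + M, M) T ^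
(3k) (1 - T) ^ M (1 + T + T²) ^ (M + 1) F`. The cube leaves one power `T ^ k` for each of three
factors: up to a scalar of modulus at most one, a block is `sqfOp T m₂ k` times `(k + 1) T ^ k F`
times `sqfOp T m₁ k (1 + T + T²) ^ (M + 1)`.

The right factor applied to `x` is a convergent Gaussian sum by `Φ_{m₁}`, and the left factor is
estimated in duality by `Φ*_{m₂}`. The middle operators are R-bounded with constant proportional to
`‖f‖_∞` (`IsRRittOfType.exists_isRBoundedBy`): they are integrals of the R-bounded family `(z - 1)
R(z, T)` over a Stolz curve with weights bounded in `L¹` uniformly in `k`. R-boundedness is stated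
with first moments of Rademacher sums; `khintchine_kahane` and the symmetry of Gaussians turn it
into boundedness on Gaussian sums (`IsRBoundedBy.gaussianNorm_le`). Hence the series converges
strongly and is bounded by `C ‖f‖_∞ ‖x‖` (`IsRRittOfType.exists_block_estimate`).

The sum must also be the operator of the calculus. This needs Cauchy's theorem on curves passing
through the vertex `1`, the identity `(1 - z)(T) = 1 - T`, multiplicativity, and independence of the
path after multiplication by `1 - T`. As `M ≥ 1`, every block contains a factor `1 - T`, so equality
after multiplication by `1 - T` suffices, whether or not `1 - T` is injective. Dominated convergence
of the reproducing polynomials on the curve (`IsRittOfType.tendsto_sum_aeval_blockPoly`) then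
identifies the limit, for elementary functions and for every regulariser. -/

noncomputable section

namespace Ritt

/-! ### Functions on the discrete cube -/

/-- The average of a function on the discrete cube. -/
def cubeAvg {N : ℕ} (f : (Fin N → ℤˣ) → ℝ) : ℝ := (∑ ε, f ε) / 2 ^ N

/-- Changing one sign. -/
def flipSign {N : ℕ} (i : Fin N) (ε : Fin N → ℤˣ) : Fin N → ℤˣ := Function.update ε i (-ε i)

/-- The Dirichlet form of the discrete cube. -/
def cubeEnergy {N : ℕ} (f : (Fin N → ℤˣ) → ℝ) : ℝ :=
  ∑ i, cubeAvg (fun ε => (f ε - f (flipSign i ε)) ^ 2) / 4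

/-- The weight of a function on the first Rademacher chaos. -/
def firstChaos {N : ℕ} (f : (Fin N → ℤˣ) → ℝ) : ℝ :=
  ∑ i, (cubeAvg fun ε => f ε * ((ε i : ℤ) : ℝ)) ^ 2

lemma cubeAvg_add {N : ℕ} (f g : (Fin N → ℤˣ) → ℝ) :
    cubeAvg (fun ε => f ε + g ε) = cubeAvg f + cubeAvg g := by
  simp [cubeAvg, Finset.sum_add_distrib, add_div]

lemma cubeAvg_sub {N : ℕ} (f g : (Fin N → ℤˣ) → ℝ) :
    cubeAvg (fun ε => f ε - g ε) = cubeAvg f - cubeAvg g := by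
  simp [cubeAvg, Finset.sum_sub_distrib, sub_div]

lemma cubeAvg_const_mul {N : ℕ} (c : ℝ) (f : (Fin N → ℤˣ) → ℝ) :
    cubeAvg (fun ε => c * f ε) = c * cubeAvg f := by
  simp only [cubeAvg, ← Finset.mul_sum, mul_div_assoc]

lemma cubeAvg_mono {N : ℕ} {f g : (Fin N → ℤˣ) → ℝ} (h : ∀ ε, f ε ≤ g ε) :
    cubeAvg f ≤ cubeAvg g := by
  unfold cubeAvg
  gcongr
  exact h _

lemma cubeAvg_const {N : ℕ} (c : ℝ) : cubeAvg (fun _ : Fin N → ℤˣ => c) = c := by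
  simp [cubeAvg]

lemma cubeAvg_nonneg {N : ℕ} {f : (Fin N → ℤˣ) → ℝ} (h : ∀ ε, 0 ≤ f ε) : 0 ≤ cubeAvg f :=
  (cubeAvg_const (N := N) 0).symm.trans_le (cubeAvg_mono h)

lemma cubeAvg_comp_equiv {N : ℕ} (e : (Fin N → ℤˣ) ≃ (Fin N → ℤˣ)) (f : (Fin N → ℤˣ) → ℝ) :
    cubeAvg (fun ε => f (e ε)) = cubeAvg f := by
  unfold cubeAvg
  rw [Equiv.sum_comp e f]

lemma flipSign_flipSign {N : ℕ} (i : Fin N) (ε : Fin N → ℤˣ) :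
    flipSign i (flipSign i ε) = ε := by
  simp [flipSign]

lemma cubeAvg_flipSign {N : ℕ} (i : Fin N) (f : (Fin N → ℤˣ) → ℝ) :
    cubeAvg (fun ε => f (flipSign i ε)) = cubeAvg f :=
  cubeAvg_comp_equiv
    (Function.Involutive.toPerm (flipSign i) (flipSign_flipSign i)) f

/-- The variance is nonnegative. -/
lemma sq_cubeAvg_le {N : ℕ} (f : (Fin N → ℤˣ) → ℝ) :
    cubeAvg f ^ 2 ≤ cubeAvg (fun ε => f ε ^ 2) := by
  have h := cubeAvg_nonneg (f := fun ε => (f ε - cubeAvg f) ^ 2) fun ε => sq_nonneg _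
  have h2 : cubeAvg (fun ε => (f ε - cubeAvg f) ^ 2) =
      cubeAvg (fun ε => f ε ^ 2) - 2 * cubeAvg f * cubeAvg f + cubeAvg f ^ 2 := by
    rw [← cubeAvg_const_mul, ← cubeAvg_sub]
    conv_rhs => rw [← cubeAvg_const (N := N) (cubeAvg f ^ 2)]
    rw [← cubeAvg_add]
    congr 1; ext ε; ring
  nlinarith

lemma cubeAvg_succ {N : ℕ} (f : (Fin (N + 1) → ℤˣ) → ℝ) :
    cubeAvg f = (cubeAvg (fun ε : Fin N → ℤˣ => f (Fin.cons 1 ε)) +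
      cubeAvg (fun ε : Fin N → ℤˣ => f (Fin.cons (-1) ε))) / 2 := by
  unfold cubeAvg
  rw [← (Fin.consEquiv fun _ => ℤˣ).sum_comp, Fintype.sum_prod_type]
  simp only [Fin.consEquiv, Equiv.coe_fn_mk]
  rw [show (Finset.univ : Finset ℤˣ) = {1, -1} from rfl,
    Finset.sum_pair (by decide)]
  field_simp
  ring

lemma flipSign_zero_cons {N : ℕ} (a : ℤˣ) (ε : Fin N → ℤˣ) :
    flipSign 0 (Fin.cons a ε : Fin (N + 1) → ℤˣ) = Fin.cons (-a) ε := by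
  simp [flipSign, Fin.update_cons_zero]

lemma flipSign_succ_cons {N : ℕ} (a : ℤˣ) (ε : Fin N → ℤˣ) (i : Fin N) :
    flipSign i.succ (Fin.cons a ε : Fin (N + 1) → ℤˣ) = Fin.cons a (flipSign i ε) := by
  simp [flipSign, Fin.cons_update]

lemma cubeEnergy_succ {N : ℕ} (f : (Fin (N + 1) → ℤˣ) → ℝ) :
    cubeEnergy f =
      cubeAvg (fun ε : Fin N → ℤˣ => (f (Fin.cons 1 ε) - f (Fin.cons (-1) ε)) ^ 2) / 4 +
      (cubeEnergy (fun ε : Fin N → ℤˣ => f (Fin.cons 1 ε)) +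
        cubeEnergy (fun ε : Fin N → ℤˣ => f (Fin.cons (-1) ε))) / 2 := by
  have hsq (a b : ℝ) : (a - b) ^ 2 = (b - a) ^ 2 := by ring
  simp only [cubeEnergy, Fin.sum_univ_succ, cubeAvg_succ (N := N), flipSign_zero_cons,
    flipSign_succ_cons, neg_neg, ← Finset.sum_add_distrib, Finset.sum_div]
  simp_rw [hsq (f (Fin.cons (-1) _)) (f (Fin.cons 1 _))]
  congr 1
  · ring
  · exact Finset.sum_congr rfl fun i _ => by ring

lemma firstChaos_succ {N : ℕ} (f : (Fin (N + 1) → ℤˣ) → ℝ) :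
    firstChaos f =
      cubeAvg (fun ε : Fin N → ℤˣ => f (Fin.cons 1 ε) - f (Fin.cons (-1) ε)) ^ 2 / 4 +
      firstChaos (fun ε : Fin N → ℤˣ => f (Fin.cons 1 ε) + f (Fin.cons (-1) ε)) / 4 := by
  simp only [firstChaos, Fin.sum_univ_succ, cubeAvg_succ (N := N), Fin.cons_zero, Fin.cons_succ,
    Finset.sum_div, ← cubeAvg_add]
  congr 1
  · rw [← div_left_inj' (by norm_num : (4 : ℝ) ≠ 0)]
    simp
    ring_nf
  · refine Finset.sum_congr rfl fun i _ => ?_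
    rw [show (fun ε : Fin N → ℤˣ => f (Fin.cons 1 ε) * ((ε i : ℤ) : ℝ) +
      f (Fin.cons (-1) ε) * ((ε i : ℤ) : ℝ)) = fun ε => (f (Fin.cons 1 ε) + f (Fin.cons (-1) ε)) *
        ((ε i : ℤ) : ℝ) from by ext; ring]
    ring

/-- Parallelogram law: the Dirichlet form is a quadratic form. -/
lemma cubeEnergy_add_sub {N : ℕ} (u v : (Fin N → ℤˣ) → ℝ) :
    cubeEnergy (fun ε => u ε + v ε) + cubeEnergy (fun ε => u ε - v ε) =
      2 * (cubeEnergy u + cubeEnergy v) := by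
  simp only [cubeEnergy, ← Finset.sum_add_distrib, Finset.mul_sum]
  refine Finset.sum_congr rfl fun i _ => ?_
  rw [← add_div, ← add_div, ← cubeAvg_add, ← cubeAvg_add, ← mul_div_assoc, ← cubeAvg_const_mul]
  congr 2
  ext ε
  ring

/-- The Poincaré inequality on the discrete cube. -/
lemma variance_le_cubeEnergy {N : ℕ} (f : (Fin N → ℤˣ) → ℝ) :
    cubeAvg (fun ε => f ε ^ 2) - cubeAvg f ^ 2 ≤ cubeEnergy f := by
  induction N with
  | zero => simp [cubeAvg, cubeEnergy]
  | succ N ih =>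
    have hu := ih fun ε => f (Fin.cons 1 ε)
    have hv := ih fun ε => f (Fin.cons (-1) ε)
    have hj := sq_cubeAvg_le fun ε : Fin N → ℤˣ => f (Fin.cons 1 ε) - f (Fin.cons (-1) ε)
    rw [cubeAvg_sub] at hj
    rw [cubeEnergy_succ, cubeAvg_succ, cubeAvg_succ f]
    nlinarith

/-- The Poincaré inequality with the first chaos removed gains a factor two. -/
lemma two_mul_variance_le {N : ℕ} (f : (Fin N → ℤˣ) → ℝ) :
    2 * (cubeAvg (fun ε => f ε ^ 2) - cubeAvg f ^ 2) ≤ cubeEnergy f + firstChaos f := by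
  induction N with
  | zero => simp [cubeAvg, cubeEnergy, firstChaos]
  | succ N ih =>
    -- In Walsh coefficients the claim is `2 ≤ |A| + 1_{|A| = 1}` for nonempty `A`. The sum and the
    -- difference of the two halves are twice the even and odd parts of `f` in the first coordinate.
    -- The odd part is multiplied by the first sign, which raises the degree by one, so the plain
    -- Poincaré inequality is enough for it.
    have hp := ih fun ε => f (Fin.cons 1 ε) + f (Fin.cons (-1) ε)
    have hq := variance_le_cubeEnergy
      fun ε : Fin N → ℤˣ => f (Fin.cons 1 ε) - f (Fin.cons (-1) ε)
    have hpq := cubeEnergy_add_sub (fun ε : Fin N → ℤˣ => f (Fin.cons 1 ε))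
      (fun ε => f (Fin.cons (-1) ε))
    have hsum : cubeAvg (fun ε : Fin N → ℤˣ => (f (Fin.cons 1 ε) + f (Fin.cons (-1) ε)) ^ 2) +
        cubeAvg (fun ε : Fin N → ℤˣ => (f (Fin.cons 1 ε) - f (Fin.cons (-1) ε)) ^ 2) =
        2 * (cubeAvg (fun ε : Fin N → ℤˣ => f (Fin.cons 1 ε) ^ 2) +
          cubeAvg (fun ε : Fin N → ℤˣ => f (Fin.cons (-1) ε) ^ 2)) := by
      rw [← cubeAvg_add, ← cubeAvg_add, ← cubeAvg_const_mul]
      congr 1; ext ε; ring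
    rw [cubeAvg_add] at hp
    rw [cubeEnergy_succ, firstChaos_succ, cubeAvg_succ, cubeAvg_succ f]
    nlinarith

/-! ### Rademacher sums and the Khintchine–Kahane inequality -/

section Space

variable {X : Type*} [NormedAddCommGroup X]

lemma rademacherAverage_eq {N : ℕ} (x : Fin N → X) :
    rademacherAverage x = cubeAvg fun ε => ‖∑ n, (ε n : ℤ) • x n‖ := rfl

lemma sum_flipSign {N : ℕ} (x : Fin N → X) (ε : Fin N → ℤˣ) (i : Fin N) :
    ∑ n, (flipSign i ε n : ℤ) • x n = ∑ n, (ε n : ℤ) • x n - 2 • ((ε i : ℤ) • x i) := by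
  have h : ∀ n, (flipSign i ε n : ℤ) • x n =
      (ε n : ℤ) • x n - if n = i then 2 • ((ε i : ℤ) • x i) else 0 := by
    intro n
    by_cases hn : n = i
    · subst hn; simp [flipSign, two_smul]
    · simp [flipSign, hn]
  simp [h, Finset.sum_sub_distrib]

/-- The sums obtained by flipping one sign at a time add up to `N - 2` times the original one, so by
the triangle inequality the norm `h` satisfies `∑ᵢ h ∘ flipSign i ≥ (N - 2) h`. The energy is the
average of `h (N h - ∑ᵢ h ∘ flipSign i) / 2`, which is at most that of `h²`. -/
lemma cubeEnergy_rademacher_le [NormedSpace ℝ X] {N : ℕ} (x : Fin N → X) :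
    cubeEnergy (fun ε => ‖∑ n, (ε n : ℤ) • x n‖) ≤
      cubeAvg fun ε => ‖∑ n, (ε n : ℤ) • x n‖ ^ 2 := by
  set h : (Fin N → ℤˣ) → ℝ := fun ε => ‖∑ n, (ε n : ℤ) • x n‖ with hh
  have hconv (ε : Fin N → ℤˣ) : ((N : ℝ) - 2) * h ε ≤ ∑ i, h (flipSign i ε) := by
    have hs : ∑ i, ∑ n, (flipSign i ε n : ℤ) • x n =
        ((N : ℝ) - 2) • ∑ n, (ε n : ℤ) • x n := by
      simp only [sum_flipSign, Finset.sum_sub_distrib, Finset.sum_const, Finset.card_univ,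
        Fintype.card_fin, ← Finset.smul_sum]
      rw [sub_smul, Nat.cast_smul_eq_nsmul, two_smul, two_smul]
    -- The absolute value covers `N < 2`.
    calc ((N : ℝ) - 2) * h ε ≤ |(N : ℝ) - 2| * h ε := by
          exact mul_le_mul_of_nonneg_right (le_abs_self _) (norm_nonneg _)
      _ = ‖∑ i, ∑ n, (flipSign i ε n : ℤ) • x n‖ := by rw [hs, norm_smul, Real.norm_eq_abs]
      _ ≤ _ := norm_sum_le _ _
  have he : cubeEnergy h = cubeAvg fun ε => h ε * ((N : ℝ) * h ε - ∑ i, h (flipSign i ε)) / 2 := by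
    have h1 (i : Fin N) : cubeAvg (fun ε => (h ε - h (flipSign i ε)) ^ 2) / 4 =
        cubeAvg fun ε => (h ε * (h ε - h (flipSign i ε))) / 2 := by
      have h2 := cubeAvg_flipSign i fun ε => (h ε * (h ε - h (flipSign i ε))) / 2
      simp only [flipSign_flipSign] at h2
      have h3 : cubeAvg (fun ε => (h ε - h (flipSign i ε)) ^ 2) =
          2 * (cubeAvg (fun ε => (h ε * (h ε - h (flipSign i ε))) / 2) +
            cubeAvg (fun ε => (h (flipSign i ε) * (h (flipSign i ε) - h ε)) / 2)) := by
        rw [← cubeAvg_add, ← cubeAvg_const_mul]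
        congr 1; ext ε; ring
      rw [h3, h2]; ring
    unfold cubeEnergy
    simp only [h1]
    simp only [cubeAvg]
    rw [← Finset.sum_div, Finset.sum_comm]
    congr 1
    refine Finset.sum_congr rfl fun ε _ => ?_
    rw [← Finset.sum_div, ← Finset.mul_sum]
    simp [Finset.sum_sub_distrib]
  rw [he]
  refine cubeAvg_mono fun ε => ?_
  have := hconv ε
  have h0 : 0 ≤ h ε := norm_nonneg _
  change _ ≤ h ε ^ 2
  nlinarith

/-- The norm is even under the simultaneous change of all signs, whereas each `ε i` is odd. -/
lemma firstChaos_rademacher {N : ℕ} (x : Fin N → X) :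
    firstChaos (fun ε => ‖∑ n, (ε n : ℤ) • x n‖) = 0 := by
  refine Finset.sum_eq_zero fun i _ => ?_
  have h := cubeAvg_comp_equiv (Equiv.neg _)
    fun ε => ‖∑ n, (ε n : ℤ) • x n‖ * ((ε i : ℤ) : ℝ)
  have h2 : cubeAvg (fun ε => ‖∑ n, (ε n : ℤ) • x n‖ * ((ε i : ℤ) : ℝ)) = 0 := by
    simp only [Equiv.neg_apply, Pi.neg_apply, Units.val_neg, neg_smul, Finset.sum_neg_distrib,
      norm_neg, Int.cast_neg, mul_neg] at h
    have h3 := cubeAvg_const_mul (-1) fun ε => ‖∑ n, (ε n : ℤ) • x n‖ * ((ε i : ℤ) : ℝ)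
    simp only [neg_one_mul] at h3
    linarith
  rw [h2]; simp

/-- The Khintchine–Kahane inequality, with the constant of Latała and Oleszkiewicz. -/
theorem khintchine_kahane [NormedSpace ℝ X] {N : ℕ} (x : Fin N → X) :
    cubeAvg (fun ε => ‖∑ n, (ε n : ℤ) • x n‖ ^ 2) ≤ 2 * rademacherAverage x ^ 2 := by
  have h1 := two_mul_variance_le fun ε => ‖∑ n, (ε n : ℤ) • x n‖
  have h2 := cubeEnergy_rademacher_le x
  rw [firstChaos_rademacher] at h1
  rw [rademacherAverage_eq]
  linarith

end Space

/-! ### R-bounded sets of operators -/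

section Space

variable {X : Type*} [NormedAddCommGroup X]

lemma rademacherAverage_nonneg {N : ℕ} (x : Fin N → X) : 0 ≤ rademacherAverage x :=
  cubeAvg_nonneg fun _ => norm_nonneg _

lemma rademacherAverage_add_le {N : ℕ} (x y : Fin N → X) :
    rademacherAverage (fun n => x n + y n) ≤ rademacherAverage x + rademacherAverage y := by
  simp only [rademacherAverage_eq]
  rw [← cubeAvg_add]
  refine cubeAvg_mono fun ε => ?_
  simp only [smul_add, Finset.sum_add_distrib]
  exact norm_add_le _ _

lemma rademacherAverage_sign_smul {N : ℕ} (δ : Fin N → ℤˣ) (x : Fin N → X) :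
    rademacherAverage (fun n => (δ n : ℤ) • x n) = rademacherAverage x := by
  simp only [rademacherAverage_eq]
  rw [← cubeAvg_comp_equiv (Equiv.mulRight δ)]
  simp [smul_smul, mul_assoc]

variable [NormedSpace ℂ X]

/-- R-boundedness with a given constant. -/
def IsRBoundedBy (C : ℝ) (𝒯 : Set (X →L[ℂ] X)) : Prop :=
  ∀ (N : ℕ) (S : Fin N → X →L[ℂ] X) (x : Fin N → X), (∀ n, S n ∈ 𝒯) →
    rademacherAverage (fun n => S n (x n)) ≤ C * rademacherAverage x

lemma rademacherAverage_smul {N : ℕ} (c : ℂ) (x : Fin N → X) :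
    rademacherAverage (fun n => c • x n) = ‖c‖ * rademacherAverage x := by
  simp only [rademacherAverage_eq]
  rw [← cubeAvg_const_mul]
  congr 1
  ext ε
  rw [← norm_smul, Finset.smul_sum]
  simp only [smul_comm c]

lemma IsRBounded.exists_isRBoundedBy {𝒯 : Set (X →L[ℂ] X)} (h : IsRBounded 𝒯) :
    ∃ C, 0 ≤ C ∧ IsRBoundedBy C 𝒯 := by
  obtain ⟨C, hC⟩ := h
  refine ⟨max C 0, le_max_right _ _, fun N S x hS => (hC N S x hS).trans ?_⟩
  exact mul_le_mul_of_nonneg_right (le_max_left _ _) (rademacherAverage_nonneg x)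

lemma IsRBoundedBy.norm_le {C : ℝ} (hC : 0 ≤ C) {𝒯 : Set (X →L[ℂ] X)} (h : IsRBoundedBy C 𝒯)
    {A : X →L[ℂ] X} (hA : A ∈ 𝒯) : ‖A‖ ≤ C := by
  refine A.opNorm_le_bound hC fun x => ?_
  have h1 := h 1 (fun _ => A) (fun _ => x) fun _ => hA
  have h2 (y : X) : rademacherAverage (fun _ : Fin 1 => y) = ‖y‖ := by
    rw [rademacherAverage_eq, ← cubeAvg_const (N := 1) ‖y‖]
    congr 1
    ext ε
    rcases Int.units_eq_one_or (ε 0) with h | h <;> simp [h]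
  rwa [h2, h2] at h1

/-- Signs in front of the operators are absorbed by the average over all signs. -/
lemma IsRBoundedBy.union_neg {C : ℝ} {𝒯 : Set (X →L[ℂ] X)} (h : IsRBoundedBy C 𝒯) :
    IsRBoundedBy C (𝒯 ∪ -𝒯) := by
  intro N S x hS
  have hδ (n : Fin N) : ∃ δ : ℤˣ, (δ : ℤ) • S n ∈ 𝒯 := by
    rcases hS n with h | h
    · exact ⟨1, by simpa using h⟩
    · exact ⟨-1, by simpa using h⟩
  choose δ hδ using hδ
  have := h N (fun n => (δ n : ℤ) • S n) x hδ
  rwa [← rademacherAverage_sign_smul δ]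

lemma convexOn_rademacherAverage_update {N : ℕ} (S : Fin N → X →L[ℂ] X) (x : Fin N → X)
    (i : Fin N) :
    ConvexOn ℝ Set.univ fun A : X →L[ℂ] X =>
      rademacherAverage fun n => Function.update S i A n (x n) := by
  refine ⟨convex_univ, fun A _ B _ a b ha hb hab => ?_⟩
  simp only [rademacherAverage_eq, smul_eq_mul]
  rw [← cubeAvg_const_mul, ← cubeAvg_const_mul, ← cubeAvg_add]
  refine cubeAvg_mono fun ε => ?_
  have : ∑ n, (ε n : ℤ) • Function.update S i (a • A + b • B) n (x n) =
      a • ∑ n, (ε n : ℤ) • Function.update S i A n (x n) +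
        b • ∑ n, (ε n : ℤ) • Function.update S i B n (x n) := by
    rw [Finset.smul_sum, Finset.smul_sum, ← Finset.sum_add_distrib]
    refine Finset.sum_congr rfl fun n _ => ?_
    rw [smul_comm a, smul_comm b, ← smul_add]
    congr 1
    by_cases hn : n = i
    · subst hn; simp
    · simp [hn, ← add_smul, hab]
  rw [this]
  refine (norm_add_le _ _).trans (le_of_eq ?_)
  rw [norm_smul, norm_smul, Real.norm_of_nonneg ha, Real.norm_of_nonneg hb]

/-- With all other operators frozen, the Rademacher average is a convex and continuous function of a
single one, so its sublevel set contains the closed convex hull once it contains `𝒯`. The slots are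
released one after another. -/
lemma IsRBoundedBy.closedConvexHull {C : ℝ} {𝒯 : Set (X →L[ℂ] X)} (h : IsRBoundedBy C 𝒯) :
    IsRBoundedBy C (closedConvexHull ℝ 𝒯) := by
  intro N S x hS
  have key : ∀ s : Finset (Fin N), ∀ S : Fin N → X →L[ℂ] X,
      (∀ n ∈ s, S n ∈ _root_.closedConvexHull ℝ 𝒯) → (∀ n ∉ s, S n ∈ 𝒯) →
      rademacherAverage (fun n => S n (x n)) ≤ C * rademacherAverage x := by
    intro s
    induction s using Finset.induction_on with
    | empty => exact fun S _ h2 => h N S x fun n => h2 n (by simp)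
    | insert i s his ih =>
      intro S h1 h2
      set K : Set (X →L[ℂ] X) := {A | rademacherAverage (fun n => Function.update S i A n (x n)) ≤
        C * rademacherAverage x} with hK
      have hconv : Convex ℝ K := by
        simpa using (convexOn_rademacherAverage_update S x i).convex_le (C * rademacherAverage x)
      have hclosed : IsClosed K := by
        refine isClosed_le ?_ continuous_const
        unfold rademacherAverage
        have hc (n : Fin N) : Continuous fun A : X →L[ℂ] X => Function.update S i A n (x n) := by
          by_cases hn : n = i
          · subst hn
            simp only [Function.update_self]
            exact (ContinuousLinearMap.apply ℂ X (x n)).cont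
          · simpa [hn] using continuous_const
        fun_prop
      have hsub : 𝒯 ⊆ K := by
        intro A hA
        refine ih _ (fun n hn => ?_) fun n hn => ?_
        · have : n ≠ i := fun h => his (h ▸ hn)
          simpa [this] using h1 n (by simp [hn])
        · by_cases hni : n = i
          · subst hni; simpa using hA
          · simpa [hni] using h2 n (by simp [hn, hni])
      have := closedConvexHull_min hsub hconv hclosed (h1 i (by simp))
      simpa [hK] using this
  exact key Finset.univ S (fun n _ => hS n) fun n hn => absurd (Finset.mem_univ n) hn

/-- Hahn–Banach: a functional separating the integral from the hull would be at most `u` in modulus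
on `𝒯`, by symmetry of `𝒯 ∪ -𝒯`, hence at most `u ∫ |h| ≤ u` on the integral. -/
lemma integral_smul_mem_closedConvexHull {E : Type*} [NormedAddCommGroup E] [NormedSpace ℝ E]
    [CompleteSpace E] {α : Type*} [MeasurableSpace α] {μ : Measure α} {𝒯 : Set E}
    {A : α → E} (hA : ∀ᵐ t ∂μ, A t ∈ 𝒯) {h : α → ℝ} (hh : Integrable h μ)
    (hhA : Integrable (fun t => h t • A t) μ) (hL : ∫ t, |h t| ∂μ ≤ 1) (hne : 𝒯.Nonempty) :
    ∫ t, h t • A t ∂μ ∈ closedConvexHull ℝ (𝒯 ∪ -𝒯) := by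
  by_contra hmem
  obtain ⟨f, u, hf, hu⟩ := geometric_hahn_banach_closed_point
    (convex_closedConvexHull (𝕜 := ℝ) (s := 𝒯 ∪ -𝒯)) isClosed_closedConvexHull hmem
  have hb (a : E) (ha : a ∈ 𝒯) : |f a| ≤ u := by
    have h1 := hf a (subset_closedConvexHull (Or.inl ha))
    have h2 := hf (-a) (subset_closedConvexHull (Or.inr (by simpa using ha)))
    rw [map_neg] at h2
    exact abs_le.2 ⟨by linarith, h1.le⟩
  have hu0 : 0 ≤ u := by
    obtain ⟨a, ha⟩ := hne
    exact (abs_nonneg _).trans (hb a ha)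
  have h1 : f (∫ t, h t • A t ∂μ) ≤ ∫ t, |h t| * u ∂μ := by
    rw [← f.integral_comp_comm hhA]
    refine integral_mono_ae (f.integrable_comp hhA) (hh.abs.mul_const u) ?_
    filter_upwards [hA] with t ht
    rw [map_smul, smul_eq_mul]
    refine (le_abs_self _).trans ?_
    rw [abs_mul]
    exact mul_le_mul_of_nonneg_left (hb _ ht) (abs_nonneg _)
  rw [integral_mul_const] at h1
  nlinarith

/-- Integral means of an R-bounded family, with uniformly integrable complex weights, are
R-bounded. -/
lemma IsRBoundedBy.integral [CompleteSpace X] {C : ℝ} {𝒯 : Set (X →L[ℂ] X)}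
    (h𝒯 : IsRBoundedBy C 𝒯)
    {α : Type*} [MeasurableSpace α] {μ : Measure α} {A : α → X →L[ℂ] X}
    (hA : ∀ᵐ t ∂μ, A t ∈ 𝒯) (hAm : AEStronglyMeasurable A μ) {K : ℝ} (hK : ∀ᵐ t ∂μ, ‖A t‖ ≤ K)
    (hne : 𝒯.Nonempty) {L : ℝ} (hL : 0 < L) :
    IsRBoundedBy (2 * L * C) {S | ∃ h : α → ℂ, Integrable h μ ∧ ∫ t, ‖h t‖ ∂μ ≤ L ∧
      S = ∫ t, h t • A t ∂μ} := by
  intro N S x hS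
  choose h hint hn hSe using hS
  -- A real weight divided by `L` gives an element of the symmetric closed convex hull. Treating
  -- real and imaginary parts separately produces the factor two in `2 * L * C`.
  have hreal (g : α → ℝ) (hg : Integrable g μ) (hgL : ∫ t, |g t| ∂μ ≤ L) :
      L⁻¹ • ∫ t, g t • A t ∂μ ∈ _root_.closedConvexHull ℝ (𝒯 ∪ -𝒯) := by
    have := integral_smul_mem_closedConvexHull hA (hg.const_mul L⁻¹) (μ := μ)
      ((hg.const_mul L⁻¹).smul_bdd K hAm hK) ?_ hne
    · simpa only [mul_smul, integral_smul] using this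
    · simp only [abs_mul, integral_const_mul]
      rw [abs_of_pos (inv_pos.2 hL), inv_mul_le_iff₀ hL]
      linarith
  have hbd (g : Fin N → α → ℝ) (hg : ∀ n, Integrable (g n) μ) (hgL : ∀ n, ∫ t, |g n t| ∂μ ≤ L) :
      rademacherAverage (fun n => (∫ t, g n t • A t ∂μ) (x n)) ≤ L * (C * rademacherAverage x) := by
    have h1 := h𝒯.union_neg.closedConvexHull N (fun n => L⁻¹ • ∫ t, g n t • A t ∂μ) x
      fun n => hreal _ (hg n) (hgL n)
    have h2 := rademacherAverage_smul ((L⁻¹ : ℝ) : ℂ) fun n => (∫ t, g n t • A t ∂μ) (x n)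
    rw [Complex.norm_real, Real.norm_of_nonneg (inv_pos.2 hL).le] at h2
    rw [← inv_mul_le_iff₀ hL, ← h2]
    exact h1
  have hdecomp (n : Fin N) : S n = (∫ t, (h n t).re • A t ∂μ) +
      Complex.I • ∫ t, (h n t).im • A t ∂μ := by
    rw [hSe n, ← integral_smul, ← integral_add]
    · congr 1
      ext1 t
      nth_rw 1 [← Complex.re_add_im (h n t)]
      rw [add_smul, mul_comm, mul_smul]
      rfl
    · exact (hint n).re.smul_bdd K hAm hK
    · exact ((hint n).im.smul_bdd K hAm hK).smul Complex.I
  have hre := hbd (fun n t => (h n t).re) (fun n => (hint n).re) fun n =>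
    (integral_mono (hint n).re.abs (hint n).norm fun t => Complex.abs_re_le_norm _).trans (hn n)
  have him := hbd (fun n t => (h n t).im) (fun n => (hint n).im) fun n =>
    (integral_mono (hint n).im.abs (hint n).norm fun t => Complex.abs_im_le_norm _).trans (hn n)
  have h3 := rademacherAverage_add_le (fun n => (∫ t, (h n t).re • A t ∂μ) (x n))
    fun n => Complex.I • (∫ t, (h n t).im • A t ∂μ) (x n)
  rw [rademacherAverage_smul, Complex.norm_I, one_mul] at h3
  simp only [hdecomp, add_apply, smul_apply]
  linarith

/-! ### Gaussian sums -/

/-- The `L²`-norm of the Gaussian sum `∑ γₖ xₖ` over `n ≤ k < m`. -/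
def gaussianNorm (n m : ℕ) (x : ℕ → X) : ℝ :=
  (eLpNorm (fun g : ℕ → ℝ => ∑ k ∈ Finset.Ico n m, ((g k : ℝ) : ℂ) • x k) 2 gaussianSeq).toReal

instance : IsProbabilityMeasure gaussianSeq := by
  unfold gaussianSeq; infer_instance

lemma memLp_gaussianSum (s : Finset ℕ) (x : ℕ → X) :
    MemLp (fun g : ℕ → ℝ => ∑ k ∈ s, ((g k : ℝ) : ℂ) • x k) 2 gaussianSeq := by
  refine memLp_finsetSum s fun k _ => ?_
  have h1 : MemLp (fun g : ℕ → ℝ => g k) 2 gaussianSeq :=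
    (memLp_id_gaussianReal (μ := 0) (v := 1) 2).comp_measurePreserving
      (measurePreserving_eval_infinitePi (fun _ : ℕ => gaussianReal 0 1) k)
  refine h1.of_le_mul (c := ‖x k‖) ?_ ?_
  · exact Continuous.aestronglyMeasurable (by fun_prop)
  · filter_upwards with g
    rw [norm_smul, Complex.norm_real, mul_comm]

/-- Standard Gaussians are symmetric and independent; this allows random signs to be inserted into
Gaussian sums. -/
lemma gaussianSeq_map_sign (η : ℕ → ℤˣ) :
    MeasurePreserving (fun (g : ℕ → ℝ) k => ((η k : ℤ) : ℝ) * g k) gaussianSeq gaussianSeq := by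
  refine ⟨by fun_prop, ?_⟩
  unfold gaussianSeq
  rw [Measure.infinitePi_map_pi (μ := fun _ : ℕ => gaussianReal 0 1)
    (f := fun k (r : ℝ) => ((η k : ℤ) : ℝ) * r) (by fun_prop)]
  congr 1
  ext1 k
  rw [gaussianReal_map_const_mul]
  rcases Int.units_eq_one_or (η k) with h | h <;> simp [h]

/-- By symmetry both sides may be averaged over independent signs. For a fixed Gaussian sample the
estimate is then R-boundedness applied to the vectors `g (σ i) • y i`, with Khintchine–Kahane
passing from first to second moments. -/
lemma lintegral_gaussianSum_le {C : ℝ} {𝒯 : Set (X →L[ℂ] X)}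
    (h𝒯 : IsRBoundedBy C 𝒯) {N : ℕ} (σ : Fin N → ℕ) (hσ : Function.Injective σ)
    (S : Fin N → X →L[ℂ] X) (hS : ∀ i, S i ∈ 𝒯) (y : Fin N → X) :
    ∫⁻ g, ENNReal.ofReal (‖∑ i, ((g (σ i) : ℝ) : ℂ) • S i (y i)‖ ^ 2) ∂gaussianSeq ≤
      ENNReal.ofReal ((2 * C) ^ 2) *
        ∫⁻ g, ENNReal.ofReal (‖∑ i, ((g (σ i) : ℝ) : ℂ) • y i‖ ^ 2) ∂gaussianSeq := by
  have hmeas (z : Fin N → X) : Measurable fun g : ℕ → ℝ =>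
      ENNReal.ofReal (‖∑ i, ((g (σ i) : ℝ) : ℂ) • z i‖ ^ 2) :=
    (Continuous.measurable (by fun_prop)).ennreal_ofReal
  have hsym (z : Fin N → X) :
      ∑ ε : Fin N → ℤˣ, ∫⁻ g : ℕ → ℝ, ENNReal.ofReal
        (‖∑ i, (ε i : ℤ) • (((g (σ i) : ℝ) : ℂ) • z i)‖ ^ 2) ∂gaussianSeq =
      2 ^ N * ∫⁻ g : ℕ → ℝ, ENNReal.ofReal (‖∑ i, ((g (σ i) : ℝ) : ℂ) • z i‖ ^ 2) ∂gaussianSeq := by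
    have h1 (ε : Fin N → ℤˣ) : ∫⁻ g : ℕ → ℝ, ENNReal.ofReal
        (‖∑ i, (ε i : ℤ) • (((g (σ i) : ℝ) : ℂ) • z i)‖ ^ 2) ∂gaussianSeq =
        ∫⁻ g : ℕ → ℝ, ENNReal.ofReal (‖∑ i, ((g (σ i) : ℝ) : ℂ) • z i‖ ^ 2) ∂gaussianSeq := by
      rw [← (gaussianSeq_map_sign (Function.extend σ ε 1)).lintegral_comp (hmeas z)]
      simp only [hσ.extend_apply, Complex.ofReal_mul, Complex.ofReal_intCast, mul_smul,
        Int.cast_smul_eq_zsmul]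
    simp only [h1, Finset.sum_const, Finset.card_univ, nsmul_eq_mul]
    simp
  have hpt (g : ℕ → ℝ) : ∑ ε : Fin N → ℤˣ, ENNReal.ofReal
        (‖∑ i, (ε i : ℤ) • (((g (σ i) : ℝ) : ℂ) • S i (y i))‖ ^ 2) ≤
      ENNReal.ofReal ((2 * C) ^ 2) * ∑ ε : Fin N → ℤˣ, ENNReal.ofReal
        (‖∑ i, (ε i : ℤ) • (((g (σ i) : ℝ) : ℂ) • y i)‖ ^ 2) := by
    rw [← ENNReal.ofReal_sum_of_nonneg fun _ _ => by positivity,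
      ← ENNReal.ofReal_sum_of_nonneg fun _ _ => by positivity,
      ← ENNReal.ofReal_mul (by positivity)]
    refine ENNReal.ofReal_le_ofReal ?_
    let _ : NormedSpace ℝ X := NormedSpace.restrictScalars ℝ ℂ X
    have h1 := khintchine_kahane fun i => ((g (σ i) : ℝ) : ℂ) • S i (y i)
    have h2 := h𝒯 N S (fun i => ((g (σ i) : ℝ) : ℂ) • y i) hS
    simp only [map_smul] at h2
    have h3 := sq_cubeAvg_le fun ε => ‖∑ i, (ε i : ℤ) • (((g (σ i) : ℝ) : ℂ) • y i)‖
    rw [← rademacherAverage_eq] at h3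
    have h4 := pow_le_pow_left₀ (rademacherAverage_nonneg _) h2 2
    -- The chain `𝔼‖·‖² ≤ 2 (𝔼‖·‖)² ≤ 2 C² (𝔼‖·‖)² ≤ 2 C² 𝔼‖·‖²` gives the constant `2 C²`, which is
    -- enlarged to `(2 C)²`.
    have h5 : cubeAvg (fun ε => ‖∑ i, (ε i : ℤ) • (((g (σ i) : ℝ) : ℂ) • S i (y i))‖ ^ 2) ≤
        (2 * C) ^ 2 * cubeAvg (fun ε => ‖∑ i, (ε i : ℤ) • (((g (σ i) : ℝ) : ℂ) • y i)‖ ^ 2) := by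
      nlinarith [mul_le_mul_of_nonneg_left h3 (sq_nonneg C), sq_nonneg C, h3,
        sq_nonneg (rademacherAverage fun i => ((g (σ i) : ℝ) : ℂ) • y i)]
    unfold cubeAvg at h5
    rwa [← mul_div_assoc, div_le_div_iff_of_pos_right (by positivity)] at h5
  have h2N : (2 : ℝ≥0∞) ^ N ≠ 0 := by simp
  have h2N' : (2 : ℝ≥0∞) ^ N ≠ ⊤ := by simp
  rw [← ENNReal.mul_le_mul_iff_right h2N h2N', ← hsym, mul_left_comm, ← hsym,
    ← lintegral_finsetSum _ fun ε _ => (Continuous.measurable (by fun_prop)).ennreal_ofReal,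
    ← lintegral_finsetSum _ fun ε _ => (Continuous.measurable (by fun_prop)).ennreal_ofReal,
    ← lintegral_const_mul _ (Finset.measurable_fun_sum _ fun ε _ =>
      (Continuous.measurable (by fun_prop)).ennreal_ofReal)]
  exact lintegral_mono hpt

lemma gaussianNorm_sq (n m : ℕ) (x : ℕ → X) :
    ENNReal.ofReal (gaussianNorm n m x ^ 2) = ∫⁻ g, ENNReal.ofReal
      (‖∑ k ∈ Finset.Ico n m, ((g k : ℝ) : ℂ) • x k‖ ^ 2) ∂gaussianSeq := by
  unfold gaussianNorm
  rw [ENNReal.ofReal_pow ENNReal.toReal_nonneg,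
    ENNReal.ofReal_toReal (memLp_gaussianSum _ x).eLpNorm_ne_top,
    eLpNorm_eq_lintegral_rpow_enorm_toReal (by simp) (by simp)]
  simp only [ENNReal.toReal_ofNat, ENNReal.rpow_ofNat]
  rw [← ENNReal.rpow_natCast, ← ENNReal.rpow_mul]
  norm_num

lemma gaussianNorm_nonneg (n m : ℕ) (x : ℕ → X) : 0 ≤ gaussianNorm n m x :=
  ENNReal.toReal_nonneg

/-- R-bounded families act boundedly on Gaussian sums. -/
lemma IsRBoundedBy.gaussianNorm_le {C : ℝ} (hC : 0 ≤ C) {𝒯 : Set (X →L[ℂ] X)}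
    (h𝒯 : IsRBoundedBy C 𝒯) (S : ℕ → X →L[ℂ] X) (hS : ∀ i, S i ∈ 𝒯) (x : ℕ → X) (n m : ℕ) :
    gaussianNorm n m (fun k => S k (x k)) ≤ 2 * C * gaussianNorm n m x := by
  have h := lintegral_gaussianSum_le h𝒯 (fun i : Fin (m - n) => n + (i : ℕ))
    (fun i j h => Fin.ext (by simpa using h)) (fun i => S (n + i)) (fun i => hS _)
    fun i => x (n + i)
  refine le_of_sq_le_sq ?_ (mul_nonneg (by positivity) (gaussianNorm_nonneg _ _ _))
  rw [mul_pow]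
  rw [← ENNReal.ofReal_le_ofReal_iff
    (mul_nonneg (by positivity) (sq_nonneg _)), ENNReal.ofReal_mul (by positivity),
    gaussianNorm_sq, gaussianNorm_sq]
  simp only [Finset.sum_Ico_eq_sum_range]
  simpa only [Fin.sum_univ_eq_sum_range (fun i => ((_ : ℝ) : ℂ) • S (n + i) (x (n + i))),
    ← Fin.sum_univ_eq_sum_range] using h

lemma ofReal_gaussianNorm (n m : ℕ) (x : ℕ → X) : ENNReal.ofReal (gaussianNorm n m x) =
    eLpNorm (fun g : ℕ → ℝ => ∑ k ∈ Finset.Ico n m, ((g k : ℝ) : ℂ) • x k) 2 gaussianSeq :=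
  ENNReal.ofReal_toReal (memLp_gaussianSum _ x).eLpNorm_ne_top

/-- The Gaussian norms of the partial sums are asymptotically at most the norm of the sum. -/
lemma HasGaussianSum.eventually_gaussianNorm_le {x : ℕ → X} {S : (ℕ → ℝ) → X}
    (h : HasGaussianSum x S) {K : ℝ} (hK : eLpNorm S 2 gaussianSeq ≤ ENNReal.ofReal K)
    (hK0 : 0 ≤ K) {δ : ℝ} (hδ : 0 < δ) : ∀ᶠ n in atTop, gaussianNorm 0 n x ≤ K + δ := by
  filter_upwards [h.2.eventually_lt_const (ENNReal.ofReal_pos.2 hδ)] with n hn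
  rw [← ENNReal.ofReal_le_ofReal_iff (by positivity), ofReal_gaussianNorm,
    ENNReal.ofReal_add hK0 hδ.le]
  simp only [← Finset.range_eq_Ico]
  calc eLpNorm (fun g : ℕ → ℝ => ∑ k ∈ Finset.range n, ((g k : ℝ) : ℂ) • x k) 2 gaussianSeq
      = eLpNorm (S + fun g : ℕ → ℝ => (∑ k ∈ Finset.range n, ((g k : ℝ) : ℂ) • x k) - S g) 2
          gaussianSeq := by
        congr 1; ext g; simp
    _ ≤ _ := eLpNorm_add_le h.1.1 ((memLp_gaussianSum _ x).sub h.1).1 (by norm_num)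
    _ ≤ _ := add_le_add hK hn.le

/-- The Gaussian norms of the blocks of a convergent Gaussian sum tend to zero. -/
lemma HasGaussianSum.exists_gaussianNorm_lt {x : ℕ → X} {S : (ℕ → ℝ) → X}
    (h : HasGaussianSum x S) {δ : ℝ} (hδ : 0 < δ) :
    ∃ n₀, ∀ n m, n₀ ≤ n → n ≤ m → gaussianNorm n m x ≤ δ := by
  obtain ⟨n₀, hn₀⟩ := eventually_atTop.1
    (h.2.eventually_lt_const (ENNReal.ofReal_pos.2 (half_pos hδ)))
  refine ⟨n₀, fun n m hn hnm => ?_⟩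
  rw [← ENNReal.ofReal_le_ofReal_iff hδ.le, ofReal_gaussianNorm]
  have hsub (n : ℕ) := ((memLp_gaussianSum (Finset.range n) x).sub h.1).1
  calc eLpNorm (fun g : ℕ → ℝ => ∑ k ∈ Finset.Ico n m, ((g k : ℝ) : ℂ) • x k) 2 gaussianSeq
      = eLpNorm ((fun g : ℕ → ℝ => (∑ k ∈ Finset.range m, ((g k : ℝ) : ℂ) • x k) - S g) -
          fun g : ℕ → ℝ => (∑ k ∈ Finset.range n, ((g k : ℝ) : ℂ) • x k) - S g) 2
          gaussianSeq := by
        congr 1; ext g; simp [Finset.sum_Ico_eq_sub _ hnm]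
    _ ≤ _ := eLpNorm_sub_le (hsub m) (hsub n) (by norm_num)
    _ ≤ ENNReal.ofReal (δ / 2) + ENNReal.ofReal (δ / 2) :=
        add_le_add (hn₀ m (hn.trans hnm)).le (hn₀ n hn).le
    _ = ENNReal.ofReal δ := by rw [← ENNReal.ofReal_add (by positivity) (by positivity)]; simp

/-! ### Dual square functions on finite sequences -/

lemma dualOp_apply (T : X →L[ℂ] X) (x' : StrongDual ℂ X) (x : X) : dualOp T x' x = x' (T x) := rfl

lemma dualOp_one_sub (T : X →L[ℂ] X) : 1 - dualOp T = dualOp (1 - T) := by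
  ext x' x
  simp [dualOp_apply]

set_option synthInstance.maxHeartbeats 400000 in
lemma dualOp_pow_apply (T : X →L[ℂ] X) (n : ℕ) (x' : StrongDual ℂ X) (x : X) :
    (dualOp T ^ n) x' x = x' ((T ^ n) x) := by
  induction n generalizing x' with
  | zero => simp
  | succ n ih => rw [pow_succ, mul_apply_eq_comp, ih, dualOp_apply, pow_succ',
      mul_apply_eq_comp]

lemma sqfOp_dualOp_apply (T : X →L[ℂ] X) (m k : ℕ) (x' : StrongDual ℂ X) (x : X) :
    (sqfOp (dualOp T) m k x') x = x' (sqfOp T m k x) := by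
  have hc : Commute (T ^ k) ((1 - T) ^ m) :=
    ((Commute.one_right T).sub_right (Commute.refl T)).pow_pow k m
  simp only [sqfOp]
  rw [hc.eq, smul_apply, smul_apply, smul_apply, map_smul, dualOp_one_sub,
    mul_apply_eq_comp, mul_apply_eq_comp, dualOp_pow_apply,
    dualOp_pow_apply]

/-- The dual square function estimate, tested on finite sequences. -/
lemma DualSquareFunctionEstimate.exists_norm_sum_le {T : X →L[ℂ] X} {m : ℕ}
    (h : DualSquareFunctionEstimate T m) :
    ∃ C, 0 ≤ C ∧ ∀ (x' : StrongDual ℂ X) (y : ℕ → X) (n₁ n₂ : ℕ),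
      ‖∑ k ∈ Finset.Ico n₁ n₂, x' (sqfOp T m k (y k))‖ ≤ C * ‖x'‖ * gaussianNorm n₁ n₂ y := by
  obtain ⟨C, hC⟩ := h
  refine ⟨max C 0, le_max_right _ _, fun x' y n₁ n₂ => ?_⟩
  refine le_of_forall_pos_le_add fun δ hδ => ?_
  set K := max C 0 * ‖x'‖ with hKdef
  have hK : 0 ≤ K := by positivity
  -- The truncated sequence is normalised by a number slightly above its Gaussian norm, which stays
  -- positive even when that norm vanishes. The excess costs at most `δ` in the end.
  set b := gaussianNorm n₁ n₂ y + δ / (K + 1) with hb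
  have hb0 : 0 < b := add_pos_of_nonneg_of_pos (gaussianNorm_nonneg _ _ _) (by positivity)
  set z : ℕ → X := fun k => if k ∈ Finset.Ico n₁ n₂ then ((b⁻¹ : ℝ) : ℂ) • y k else 0 with hz
  set S : (ℕ → ℝ) → X := ((b⁻¹ : ℝ) : ℂ) • fun g : ℕ → ℝ =>
    ∑ k ∈ Finset.Ico n₁ n₂, ((g k : ℝ) : ℂ) • y k with hS
  have hpart (n : ℕ) (hn : n₂ ≤ n) (g : ℕ → ℝ) :
      ∑ k ∈ Finset.range n, ((g k : ℝ) : ℂ) • z k = S g := by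
    have hsub : Finset.Ico n₁ n₂ ⊆ Finset.range n := fun k hk =>
      Finset.mem_range.2 ((Finset.mem_Ico.1 hk).2.trans_le hn)
    rw [← Finset.sum_subset hsub fun k _ hk => by simp only [hz, if_neg hk, smul_zero]]
    simp only [hS, Pi.smul_apply, Finset.smul_sum]
    refine Finset.sum_congr rfl fun k hk => ?_
    simp only [hz, if_pos hk]
    rw [smul_comm]
  have hsum : HasGaussianSum z S := by
    refine ⟨(memLp_gaussianSum _ y).const_smul _, ?_⟩
    refine tendsto_const_nhds.congr' ?_
    filter_upwards [eventually_ge_atTop n₂] with n hn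
    simp only [hpart n hn, sub_self, eLpNorm_zero']
  have hnorm : eLpNorm S 2 gaussianSeq ≤ 1 := by
    rw [hS, eLpNorm_const_smul, ← ofReal_gaussianNorm, ← ofReal_norm,
      ← ENNReal.ofReal_mul (norm_nonneg _), ← ENNReal.ofReal_one]
    refine ENNReal.ofReal_le_ofReal ?_
    rw [Complex.norm_real, Real.norm_of_nonneg (by positivity), inv_mul_le_iff₀ hb0, mul_one]
    exact le_add_of_nonneg_right (by positivity)
  have h1 := (hC x' z S hsum hnorm).2
  have h2 : ∑' k, (sqfOp (dualOp T) m k x') (z k) =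
      ((b⁻¹ : ℝ) : ℂ) * ∑ k ∈ Finset.Ico n₁ n₂, x' (sqfOp T m k (y k)) := by
    rw [tsum_eq_sum (s := Finset.Ico n₁ n₂) fun k hk => by simp only [hz, if_neg hk, map_zero],
      Finset.mul_sum]
    refine Finset.sum_congr rfl fun k hk => ?_
    simp only [hz, if_pos hk, sqfOp_dualOp_apply, map_smul, smul_eq_mul]
  rw [h2, norm_mul, Complex.norm_real, Real.norm_of_nonneg (by positivity),
    inv_mul_le_iff₀ hb0] at h1
  have h3 : C * ‖x'‖ ≤ K := mul_le_mul_of_nonneg_right (le_max_left _ _) (norm_nonneg _)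
  calc _ ≤ b * K := h1.trans (mul_le_mul_of_nonneg_left h3 hb0.le)
    _ = K * gaussianNorm n₁ n₂ y + K / (K + 1) * δ := by rw [hb]; ring
    _ ≤ K * gaussianNorm n₁ n₂ y + 1 * δ := by
        gcongr
        rw [div_le_one (by positivity)]
        linarith
    _ = _ := by rw [one_mul]

end Space

/-! ### Geometry of Stolz domains -/

/-- The function whose negativity set is `stolz ϑ`. -/
def stolzGauge (ϑ : ℝ) (z : ℂ) : ℝ := ‖1 - z‖ - ϑ * (1 - ‖z‖)

/-- The condition `‖z‖ < 1` is automatic, since `ϑ (1 - ‖z‖)` has to exceed `‖1 - z‖ ≥ 0`. -/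
lemma mem_stolz_iff {ϑ : ℝ} (hϑ : 1 < ϑ) {z : ℂ} : z ∈ stolz ϑ ↔ stolzGauge ϑ z < 0 := by
  have h0 := norm_nonneg (1 - z)
  constructor
  · rintro ⟨h1, h2⟩
    rw [div_lt_iff₀ (by linarith)] at h2
    simpa [stolzGauge] using h2
  · intro h
    unfold stolzGauge at h
    have h1 : ‖z‖ < 1 := by
      by_contra! h1
      nlinarith
    exact ⟨h1, by rw [div_lt_iff₀ (by linarith)]; linarith⟩

lemma continuous_stolzGauge (ϑ : ℝ) : Continuous (stolzGauge ϑ) := by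
  unfold stolzGauge; fun_prop

lemma isOpen_stolz {ϑ : ℝ} (hϑ : 1 < ϑ) : IsOpen (stolz ϑ) := by
  have : stolz ϑ = stolzGauge ϑ ⁻¹' Set.Iio 0 := Set.ext fun z => mem_stolz_iff hϑ
  rw [this]
  exact isOpen_Iio.preimage (continuous_stolzGauge ϑ)

lemma stolzGauge_nonpos_of_mem_closure {ϑ : ℝ} (hϑ : 1 < ϑ) {z : ℂ} (hz : z ∈ closure (stolz ϑ)) :
    stolzGauge ϑ z ≤ 0 := by
  have : closure (stolz ϑ) ⊆ stolzGauge ϑ ⁻¹' Set.Iic 0 :=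
    closure_minimal (fun w hw => ((mem_stolz_iff hϑ).1 hw).le)
      (isClosed_Iic.preimage (continuous_stolzGauge ϑ))
  exact this hz

lemma stolzGauge_anti {ϑ ϑ' : ℝ} (h : ϑ ≤ ϑ') {z : ℂ} (hz : ‖z‖ ≤ 1) :
    stolzGauge ϑ' z ≤ stolzGauge ϑ z := by
  unfold stolzGauge
  nlinarith

lemma stolz_mono {ϑ ϑ' : ℝ} (hϑ : 1 < ϑ) (h : ϑ ≤ ϑ') : stolz ϑ ⊆ stolz ϑ' := fun _ hz =>
  (mem_stolz_iff (hϑ.trans_le h)).2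
    ((stolzGauge_anti h hz.1.le).trans_lt ((mem_stolz_iff hϑ).1 hz))

/-- The gauge is convex and equals `1 - ϑ < 0` at the origin, so shrinking towards `0` moves
boundary points strictly inside. This is the star-shapedness behind every contour argument below. -/
lemma smul_mem_stolz {ϑ : ℝ} (hϑ : 1 < ϑ) {z : ℂ} (hz : stolzGauge ϑ z ≤ 0) {s : ℝ} (hs : 0 ≤ s)
    (hs1 : s < 1) : (s : ℂ) * z ∈ stolz ϑ := by
  rw [mem_stolz_iff hϑ]
  unfold stolzGauge at *
  have h1 : ‖1 - (s : ℂ) * z‖ ≤ (1 - s) + s * ‖1 - z‖ := by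
    calc ‖1 - (s : ℂ) * z‖ = ‖((1 - s : ℝ) : ℂ) + (s : ℂ) * (1 - z)‖ := by
          congr 1; push_cast; ring
      _ ≤ _ := (norm_add_le _ _).trans (by
          rw [norm_mul, Complex.norm_real, Complex.norm_real, Real.norm_of_nonneg hs,
            Real.norm_of_nonneg (by linarith)])
  rw [norm_mul, Complex.norm_real, Real.norm_of_nonneg hs]
  nlinarith

/-- Points outside a Stolz domain stay away from those in a smaller one, relative to the distance
to the vertex. -/
lemma norm_one_sub_le_norm_sub {ϑ ϑ' : ℝ} (hϑ : 0 < ϑ) (h : ϑ < ϑ') {z l : ℂ}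
    (hz : stolzGauge ϑ z ≤ 0) (hl : stolzGauge ϑ' l = 0) :
    ‖1 - l‖ ≤ (1 + ϑ) * ϑ' / (ϑ' - ϑ) * ‖l - z‖ := by
  unfold stolzGauge at *
  have h1 : ‖1 - l‖ ≤ ‖1 - z‖ + ‖l - z‖ := by
    calc ‖1 - l‖ = ‖(1 - z) - (l - z)‖ := by congr 1; ring
      _ ≤ _ := norm_sub_le _ _
  have h2 : ‖l‖ ≤ ‖z‖ + ‖l - z‖ := by
    calc ‖l‖ = ‖z + (l - z)‖ := by congr 1; ring
      _ ≤ _ := norm_add_le _ _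
  -- The gauge of parameter `ϑ` is Lipschitz with constant `1 + ϑ`, and its value at `l` is `(1 - ϑ
  -- / ϑ') ‖1 - l‖` because `‖1 - l‖ = ϑ' (1 - ‖l‖)`.
  have h3 : ‖1 - l‖ - ϑ * (1 - ‖l‖) ≤ (1 + ϑ) * ‖l - z‖ := by nlinarith
  have h4 := mul_le_mul_of_nonneg_left h3 (hϑ.trans h).le
  rw [div_mul_eq_mul_div, le_div_iff₀ (by linarith)]
  nlinarith

/-! ### The boundary curve -/

lemma stolzAngle_pos {ϑ : ℝ} (hϑ : 1 < ϑ) : 0 < stolzAngle ϑ := by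
  rw [stolzAngle, Real.arccos_pos, div_lt_one (by linarith)]
  exact hϑ

lemma stolzAngle_le {ϑ : ℝ} (hϑ : 1 < ϑ) : stolzAngle ϑ ≤ Real.pi / 2 :=
  Real.arccos_le_pi_div_two.2 (by positivity)

lemma cos_stolzAngle {ϑ : ℝ} (hϑ : 1 < ϑ) : Real.cos (stolzAngle ϑ) = 1 / ϑ := by
  have : 1 / ϑ ≤ 1 := by rw [div_le_one (by linarith)]; exact hϑ.le
  exact Real.cos_arccos (by linarith [one_div_pos.2 (by linarith : 0 < ϑ)]) this

lemma stolzRadius_stolzAngle {ϑ : ℝ} (hϑ : 1 < ϑ) : stolzRadius ϑ (stolzAngle ϑ) = 0 := by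
  rw [stolzRadius, cos_stolzAngle hϑ, mul_one_div_cancel (by linarith)]; simp

lemma stolzRadius_neg (ϑ t : ℝ) : stolzRadius ϑ (-t) = stolzRadius ϑ t := by
  simp [stolzRadius]

lemma stolzRadius_zero_pos {ϑ : ℝ} (hϑ : 1 < ϑ) : 0 < stolzRadius ϑ 0 := by
  have : 0 < ϑ ^ 2 - 1 := by nlinarith
  rw [stolzRadius, Real.cos_zero, mul_one]
  exact mul_pos (by positivity) (by linarith)

/-- The cosine is concave on `[0, stolzAngle ϑ]` and so lies above its chord. The linear bound
controls how fast the curve leaves the unit circle near the vertex. -/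
lemma stolzRadius_ge {ϑ : ℝ} (hϑ : 1 < ϑ) {t : ℝ} (ht : |t| ≤ stolzAngle ϑ) :
    stolzRadius ϑ 0 * (1 - |t| / stolzAngle ϑ) ≤ stolzRadius ϑ t := by
  have ha := stolzAngle_pos hϑ
  have hc : (1 - |t| / stolzAngle ϑ) * Real.cos 0 +
      |t| / stolzAngle ϑ * Real.cos (stolzAngle ϑ) ≤ Real.cos t := by
    have h1 : 0 ≤ 1 - |t| / stolzAngle ϑ := by rw [sub_nonneg, div_le_one ha]; exact ht
    have h2 : 0 ≤ |t| / stolzAngle ϑ := by positivity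
    have := strictConcaveOn_cos_Icc.concaveOn.2
      (show (0 : ℝ) ∈ _ from ⟨by linarith [Real.pi_pos], by linarith [Real.pi_pos]⟩)
      (show stolzAngle ϑ ∈ _ from ⟨by linarith [Real.pi_pos], stolzAngle_le hϑ⟩)
      h1 h2 (by ring)
    simp only [smul_eq_mul] at this
    rwa [mul_zero, zero_add, div_mul_cancel₀ _ ha.ne', Real.cos_abs] at this
  rw [Real.cos_zero, cos_stolzAngle hϑ] at hc
  have hpos : 0 < 2 * ϑ / (ϑ ^ 2 - 1) := div_pos (by linarith) (by nlinarith)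
  rw [stolzRadius, stolzRadius, Real.cos_zero, mul_assoc]
  refine mul_le_mul_of_nonneg_left ?_ hpos.le
  have h2 := mul_le_mul_of_nonneg_left hc (by linarith : 0 ≤ ϑ)
  have h3 : ϑ * ((1 - |t| / stolzAngle ϑ) * 1 + |t| / stolzAngle ϑ * (1 / ϑ)) =
      ϑ * (1 - |t| / stolzAngle ϑ) + |t| / stolzAngle ϑ := by
    field_simp
  nlinarith

lemma stolzRadius_nonneg {ϑ : ℝ} (hϑ : 1 < ϑ) {t : ℝ} (ht : |t| ≤ stolzAngle ϑ) :
    0 ≤ stolzRadius ϑ t := by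
  refine le_trans (mul_nonneg (stolzRadius_zero_pos hϑ).le ?_) (stolzRadius_ge hϑ ht)
  rw [sub_nonneg, div_le_one (stolzAngle_pos hϑ)]
  exact ht

lemma stolzRadius_pos {ϑ : ℝ} (hϑ : 1 < ϑ) {t : ℝ} (ht : |t| < stolzAngle ϑ) :
    0 < stolzRadius ϑ t := by
  refine lt_of_lt_of_le (mul_pos (stolzRadius_zero_pos hϑ) ?_) (stolzRadius_ge hϑ ht.le)
  rw [sub_pos, div_lt_one (stolzAngle_pos hϑ)]
  exact ht

lemma norm_one_sub_stolzCurve {ϑ : ℝ} (hϑ : 1 < ϑ) {t : ℝ} (ht : |t| ≤ stolzAngle ϑ) :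
    ‖1 - stolzCurve ϑ t‖ = stolzRadius ϑ t := by
  rw [stolzCurve, sub_sub_cancel, norm_mul, Complex.norm_exp_ofReal_mul_I, mul_one,
    Complex.norm_real, Real.norm_of_nonneg (stolzRadius_nonneg hϑ ht)]

/-- With radius `ρ`, the identity `1 - 2 ρ cos t + ρ² = (1 - ρ / ϑ)²` is the equation that defines
`stolzRadius`, up to a factor `ρ`. -/
lemma norm_stolzCurve {ϑ : ℝ} (hϑ : 1 < ϑ) (t : ℝ) :
    ‖stolzCurve ϑ t‖ = 1 - stolzRadius ϑ t / ϑ := by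
  have h1 : 0 ≤ 1 - stolzRadius ϑ t / ϑ := by
    have h2 : 0 < ϑ ^ 2 - 1 := by nlinarith
    have h3 : stolzRadius ϑ t / ϑ = 2 * (ϑ * Real.cos t - 1) / (ϑ ^ 2 - 1) := by
      unfold stolzRadius; field_simp
    rw [h3, sub_nonneg, div_le_one h2]
    nlinarith [Real.cos_le_one t]
  rw [← sq_eq_sq₀ (norm_nonneg _) h1, ← Complex.normSq_eq_norm_sq, stolzCurve,
    Complex.exp_mul_I, Complex.normSq_apply]
  have h2 : (ϑ ^ 2 - 1) ≠ 0 := by nlinarith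
  have h4 : stolzRadius ϑ t * (ϑ ^ 2 - 1) = 2 * ϑ * (ϑ * Real.cos t - 1) := by
    unfold stolzRadius; field_simp
  simp [← Complex.ofReal_cos, ← Complex.ofReal_sin]
  field_simp
  linear_combination ϑ^2 * stolzRadius ϑ t ^2 * Real.sin_sq_add_cos_sq t + stolzRadius ϑ t * h4

lemma stolzGauge_stolzCurve {ϑ : ℝ} (hϑ : 1 < ϑ) {t : ℝ} (ht : |t| ≤ stolzAngle ϑ) :
    stolzGauge ϑ (stolzCurve ϑ t) = 0 := by
  rw [stolzGauge, norm_one_sub_stolzCurve hϑ ht, norm_stolzCurve hϑ]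
  field_simp
  ring

lemma stolzCurve_ne_one {ϑ : ℝ} (hϑ : 1 < ϑ) {t : ℝ} (ht : |t| < stolzAngle ϑ) :
    stolzCurve ϑ t ≠ 1 := by
  intro h
  have h1 := norm_one_sub_stolzCurve hϑ ht.le
  rw [h, sub_self, norm_zero] at h1
  exact (stolzRadius_pos hϑ ht).ne h1

lemma stolzCurve_stolzAngle {ϑ : ℝ} (hϑ : 1 < ϑ) : stolzCurve ϑ (stolzAngle ϑ) = 1 := by
  simp [stolzCurve, stolzRadius_stolzAngle hϑ]

lemma stolzCurve_neg_stolzAngle {ϑ : ℝ} (hϑ : 1 < ϑ) : stolzCurve ϑ (-stolzAngle ϑ) = 1 := by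
  simp [stolzCurve, stolzRadius_neg, stolzRadius_stolzAngle hϑ]

/-- The curve avoids the origin, so the inversion `z ↦ 1 / z` can be used to treat the exterior
domain. -/
lemma norm_stolzCurve_pos {ϑ : ℝ} (hϑ : 1 < ϑ) (t : ℝ) : 0 < ‖stolzCurve ϑ t‖ := by
  rw [norm_stolzCurve hϑ, sub_pos, div_lt_one (by linarith), stolzRadius,
    div_mul_eq_mul_div, div_lt_iff₀ (by nlinarith)]
  have h : 2 * (ϑ * Real.cos t - 1) < ϑ ^ 2 - 1 := by nlinarith [Real.cos_le_one t]
  nlinarith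

lemma stolzCurve_ne_zero {ϑ : ℝ} (hϑ : 1 < ϑ) (t : ℝ) : stolzCurve ϑ t ≠ 0 :=
  norm_pos_iff.1 (norm_stolzCurve_pos hϑ t)

lemma stolzCurve_mem_stolz {ϑ ν : ℝ} (hϑ : 1 < ϑ) (hν : ϑ < ν) {t : ℝ} (ht : |t| < stolzAngle ϑ) :
    stolzCurve ϑ t ∈ stolz ν := by
  rw [mem_stolz_iff (hϑ.trans hν)]
  have h := stolzGauge_stolzCurve hϑ ht.le
  have h2 := stolzRadius_pos hϑ ht
  unfold stolzGauge at *
  rw [norm_stolzCurve hϑ] at *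
  have : 0 < stolzRadius ϑ t / ϑ := by positivity
  nlinarith

/-- Points of the radial exterior of a boundary curve are outside smaller Stolz domains. -/
lemma stolzCurve_div_notMem_closure {ω ϑ : ℝ} (hω : 1 < ω) (hϑ : ω ≤ ϑ) {t : ℝ}
    (ht : |t| ≤ stolzAngle ϑ) {s : ℝ} (hs : 0 < s) (hs1 : s < 1) :
    stolzCurve ϑ t / s ∉ closure (stolz ω) := by
  intro h
  have h1 := smul_mem_stolz hω (stolzGauge_nonpos_of_mem_closure hω h) hs.le hs1
  rw [mul_div_cancel₀ _ (by exact_mod_cast hs.ne')] at h1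
  have h2 := stolzGauge_stolzCurve (hω.trans_le hϑ) ht
  have h3 := stolzGauge_anti hϑ h1.1.le
  rw [mem_stolz_iff hω] at h1
  linarith

lemma stolzCurve_notMem_closure {ω ϑ : ℝ} (hω : 1 < ω) (hϑ : ω < ϑ) {t : ℝ}
    (ht : |t| < stolzAngle ϑ) : stolzCurve ϑ t ∉ closure (stolz ω) := by
  intro h
  have h1 := stolzGauge_nonpos_of_mem_closure hω h
  have h2 := stolzGauge_stolzCurve (hω.trans hϑ) ht.le
  have h3 := stolzRadius_pos (hω.trans hϑ) ht
  unfold stolzGauge at *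
  rw [norm_stolzCurve (hω.trans hϑ)] at *
  have : 0 < stolzRadius ϑ t / ϑ := div_pos h3 (by linarith)
  nlinarith

lemma contDiff_stolzCurve (ϑ : ℝ) : ContDiff ℝ 1 (stolzCurve ϑ) := by
  unfold stolzCurve stolzRadius
  refine contDiff_const.sub (ContDiff.mul ?_ ?_)
  · exact Complex.ofRealCLM.contDiff.comp
      (contDiff_const.mul ((contDiff_const.mul Real.contDiff_cos).sub contDiff_const))
  · exact (Complex.ofRealCLM.contDiff.mul contDiff_const).cexp

lemma continuous_stolzCurve (ϑ : ℝ) : Continuous (stolzCurve ϑ) := (contDiff_stolzCurve ϑ).continuous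

lemma hasDerivAt_stolzCurve (ϑ t : ℝ) : HasDerivAt (stolzCurve ϑ) (deriv (stolzCurve ϑ) t) t :=
  ((contDiff_stolzCurve ϑ).differentiable (by norm_num) t).hasDerivAt

lemma continuous_deriv_stolzCurve (ϑ : ℝ) : Continuous (deriv (stolzCurve ϑ)) :=
  (contDiff_stolzCurve ϑ).continuous_deriv (by norm_num)

lemma exists_norm_deriv_stolzCurve_le (ϑ : ℝ) :
    ∃ K, 0 < K ∧ ∀ t, |t| ≤ stolzAngle ϑ → ‖deriv (stolzCurve ϑ) t‖ ≤ K := by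
  obtain ⟨K, hK⟩ := (isCompact_Icc (a := -stolzAngle ϑ) (b := stolzAngle ϑ)).exists_bound_of_continuousOn
    (continuous_deriv_stolzCurve ϑ).continuousOn
  exact ⟨max K 1, by positivity, fun t ht => (hK t (abs_le.1 ht)).trans (le_max_left _ _)⟩

/-! ### Cauchy's theorem on star-shaped domains and for Stolz curves -/

lemma intervalIntegrable_of_continuousOn_of_bound {E : Type*} [NormedAddCommGroup E] {F : ℝ → E}
    {a b : ℝ} (hab : a ≤ b) (hF : ContinuousOn F (Set.Ioo a b)) {K : ℝ}
    (hK : ∀ t ∈ Set.Ioo a b, ‖F t‖ ≤ K) : IntervalIntegrable F volume a b := by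
  rw [intervalIntegrable_iff_integrableOn_Ioo_of_le hab]
  exact Integrable.of_bound (hF.aestronglyMeasurable measurableSet_Ioo) K
    ((ae_restrict_iff' measurableSet_Ioo).2 (Eventually.of_forall hK))

/-- Cauchy's theorem for closed curves in a domain containing all segments from `0` to the
curve. -/
theorem integral_closedCurve_eq_zero {E : Type*} [NormedAddCommGroup E] [NormedSpace ℂ E]
    [CompleteSpace E] {U : Set ℂ} (hU : IsOpen U) {g : ℂ → E} (hg : DifferentiableOn ℂ g U)
    {κ κ' : ℝ → ℂ} {a b : ℝ} (hab : a ≤ b) (hκ : ∀ t ∈ Set.Icc a b, HasDerivAt κ (κ' t) t)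
    (hκ' : ContinuousOn κ' (Set.Icc a b)) (hclosed : κ a = κ b)
    (hstar : ∀ t ∈ Set.Icc a b, ∀ s ∈ Set.Icc (0 : ℝ) 1, (s : ℂ) * κ t ∈ U) :
    ∫ t in a..b, κ' t • g (κ t) = 0 := by
  set D : ℂ → E := deriv g
  have hD : ContinuousOn D U := (hg.deriv hU).continuousOn
  have hgD (z : ℂ) (hz : z ∈ U) : HasDerivAt g (D z) z :=
    (hg.differentiableAt (hU.mem_nhds hz)).hasDerivAt
  have hκc : ContinuousOn κ (Set.Icc a b) := fun t ht => (hκ t ht).continuousAt.continuousWithinAt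
  -- This kernel is both `∂/∂s` of `s κ'(t) g(s κ(t))` and `∂/∂t` of `κ(t) g(s κ(t))`. Integrated
  -- over `s` it gives the integrand; integrated over `t` it vanishes because the curve is closed.
  -- Fubini equates the two.
  set K : ℝ → ℝ → E := fun t s => κ' t • (g (s * κ t) + (s * κ t) • D (s * κ t)) with hK
  have hKc : ContinuousOn (Function.uncurry K) (Set.Icc a b ×ˢ Set.Icc 0 1) := by
    have h1 : ContinuousOn (fun p : ℝ × ℝ => (p.2 : ℂ) * κ p.1) (Set.Icc a b ×ˢ Set.Icc 0 1) :=
      (Complex.continuous_ofReal.comp continuous_snd).continuousOn.mul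
        (hκc.comp continuousOn_fst fun p hp => hp.1)
    have hmaps : Set.MapsTo (fun p : ℝ × ℝ => (p.2 : ℂ) * κ p.1) (Set.Icc a b ×ˢ Set.Icc 0 1) U :=
      fun p hp => hstar p.1 hp.1 p.2 hp.2
    exact (hκ'.comp continuousOn_fst fun p hp => hp.1).smul
      ((hg.continuousOn.comp h1 hmaps).add (h1.smul (hD.comp h1 hmaps)))
  have hrow (t : ℝ) (ht : t ∈ Set.Icc a b) : ∫ s in (0 : ℝ)..1, K t s = κ' t • g (κ t) := by
    have hd (s : ℝ) (hs : s ∈ Set.uIcc (0 : ℝ) 1) :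
        HasDerivAt (fun s : ℝ => κ' t • ((s : ℂ) • g (s * κ t))) (K t s) s := by
      rw [Set.uIcc_of_le zero_le_one] at hs
      have h1 : HasDerivAt (fun s : ℝ => (s : ℂ)) 1 s := Complex.ofRealCLM.hasDerivAt
      have h2 : HasDerivAt (fun s : ℝ => (s : ℂ) * κ t) (κ t) s := by
        simpa using h1.mul_const (κ t)
      have h3 := (hgD _ (hstar t ht s hs)).scomp s h2
      have h4 := (h1.smul h3).const_smul (κ' t)
      refine h4.congr_deriv ?_
      simp only [hK, Function.comp_apply, one_smul, mul_smul]
      rw [add_comm]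
    rw [intervalIntegral.integral_eq_sub_of_hasDerivAt hd]
    · simp
    · refine ContinuousOn.intervalIntegrable ?_
      rw [Set.uIcc_of_le zero_le_one]
      exact hKc.comp (f := fun s : ℝ => (t, s)) (by fun_prop) fun s hs => ⟨ht, hs⟩
  have hcol (s : ℝ) (hs : s ∈ Set.Icc (0 : ℝ) 1) : ∫ t in a..b, K t s = 0 := by
    have hd (t : ℝ) (ht : t ∈ Set.uIcc a b) :
        HasDerivAt (fun t : ℝ => κ t • g (s * κ t)) (K t s) t := by
      rw [Set.uIcc_of_le hab] at ht
      have h2 := (hκ t ht).const_mul (s : ℂ)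
      have h3 := (hgD _ (hstar t ht s hs)).scomp t h2
      refine ((hκ t ht).smul h3).congr_deriv ?_
      simp only [hK, Function.comp_apply, smul_add, smul_smul]
      rw [add_comm]
      congr 2
      ring
    rw [intervalIntegral.integral_eq_sub_of_hasDerivAt hd]
    · simp [hclosed]
    · refine ContinuousOn.intervalIntegrable ?_
      rw [Set.uIcc_of_le hab]
      exact hKc.comp (f := fun t : ℝ => (t, s)) (by fun_prop) fun t ht => ⟨ht, hs⟩
  have hint : IntegrableOn (Function.uncurry K) (Set.Icc a b ×ˢ Set.Icc 0 1)
      (volume.prod volume) :=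
    hKc.integrableOn_compact (isCompact_Icc.prod isCompact_Icc)
  rw [IntegrableOn, ← Measure.prod_restrict] at hint
  have hswap := integral_integral_swap hint
  simp only [intervalIntegral.integral_of_le hab, intervalIntegral.integral_of_le zero_le_one,
    ← integral_Icc_eq_integral_Ioc] at *
  rw [← setIntegral_congr_fun measurableSet_Icc hrow, hswap,
    setIntegral_congr_fun measurableSet_Icc hcol]
  simp

/-- The vertex `1` lies on the curve but not in `stolz ν`. Cauchy's theorem is therefore applied to
the curve shrunk by `s < 1`, and `s → 1` by dominated convergence, `f` being bounded. -/
lemma integral_deriv_stolzCurve_mul_eq_zero {ϑ ν : ℝ} (hϑ : 1 < ϑ) (hν : ϑ < ν) {f : ℂ → ℂ}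
    (hf : IsHInfty (stolz ν) f) :
    ∫ t in (-stolzAngle ϑ)..(stolzAngle ϑ),
      deriv (stolzCurve ϑ) t * f (stolzCurve ϑ t) = 0 := by
  obtain ⟨hd, M, hM⟩ := hf
  have ha := stolzAngle_pos hϑ
  obtain ⟨K, hK0, hK⟩ := exists_norm_deriv_stolzCurve_le ϑ
  have hmem (s : ℝ) (hs : s ∈ Set.Ico (0 : ℝ) 1) (t : ℝ)
      (ht : t ∈ Set.Icc (-stolzAngle ϑ) (stolzAngle ϑ)) : (s : ℂ) * stolzCurve ϑ t ∈ stolz ν :=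
    stolz_mono hϑ hν.le
      (smul_mem_stolz hϑ (stolzGauge_stolzCurve hϑ (abs_le.2 ht)).le hs.1 hs.2)
  have hz (s : ℝ) (hs : s ∈ Set.Ioo (0 : ℝ) 1) : ∫ t in (-stolzAngle ϑ)..(stolzAngle ϑ),
      deriv (stolzCurve ϑ) t * f (s * stolzCurve ϑ t) = 0 := by
    have h := integral_closedCurve_eq_zero (isOpen_stolz (hϑ.trans hν)) hd
      (κ := fun t => (s : ℂ) * stolzCurve ϑ t) (κ' := fun t => (s : ℂ) * deriv (stolzCurve ϑ) t)
      (a := -stolzAngle ϑ) (b := stolzAngle ϑ) (by linarith)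
      (fun t _ => (hasDerivAt_stolzCurve ϑ t).const_mul (s : ℂ))
      (continuous_const.mul (continuous_deriv_stolzCurve ϑ)).continuousOn
      (by simp only [stolzCurve_stolzAngle hϑ, stolzCurve_neg_stolzAngle hϑ])
      (fun t ht r hr => by
        rw [← mul_assoc, ← Complex.ofReal_mul]
        exact hmem _ ⟨mul_nonneg hr.1 hs.1.le, by nlinarith [hr.1, hr.2, hs.1, hs.2]⟩ t ht)
    simp only [smul_eq_mul, mul_assoc] at h
    rw [intervalIntegral.integral_const_mul] at h
    exact (mul_eq_zero.1 h).resolve_left (by exact_mod_cast hs.1.ne')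
  have hIoo : Set.uIoc (-stolzAngle ϑ) (stolzAngle ϑ) =
    Set.Ioc (-stolzAngle ϑ) (stolzAngle ϑ) := Set.uIoc_of_le (by linarith)
  have hev : ∀ᶠ s : ℝ in 𝓝[<] 1, s ∈ Set.Ioo (0 : ℝ) 1 :=
    Ioo_mem_nhdsLT zero_lt_one
  have hlim : Tendsto (fun s : ℝ => ∫ t in (-stolzAngle ϑ)..(stolzAngle ϑ),
      deriv (stolzCurve ϑ) t * f (s * stolzCurve ϑ t)) (𝓝[<] 1)
      (𝓝 (∫ t in (-stolzAngle ϑ)..(stolzAngle ϑ),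
        deriv (stolzCurve ϑ) t * f (stolzCurve ϑ t))) := by
    refine intervalIntegral.tendsto_integral_filter_of_dominated_convergence (fun _ => K * M)
      ?_ ?_ intervalIntegrable_const ?_
    · filter_upwards [hev] with s hs
      rw [hIoo]
      refine ContinuousOn.aestronglyMeasurable ?_ measurableSet_Ioc
      refine (continuous_deriv_stolzCurve ϑ).continuousOn.mul ?_
      exact hd.continuousOn.comp (continuous_const.mul (continuous_stolzCurve ϑ)).continuousOn
        fun t ht => hmem s ⟨hs.1.le, hs.2⟩ t (Set.Ioc_subset_Icc_self ht)
    · filter_upwards [hev] with s hs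
      refine Eventually.of_forall fun t ht => ?_
      rw [hIoo] at ht
      rw [norm_mul]
      exact mul_le_mul (hK t (abs_le.2 ⟨ht.1.le, ht.2⟩))
        (hM _ (hmem s ⟨hs.1.le, hs.2⟩ t (Set.Ioc_subset_Icc_self ht))) (norm_nonneg _) hK0.le
    · filter_upwards [Measure.ae_ne volume (stolzAngle ϑ)] with t hne ht
      rw [hIoo] at ht
      have htm := stolzCurve_mem_stolz hϑ hν (abs_lt.2 ⟨ht.1, lt_of_le_of_ne ht.2 hne⟩)
      refine Tendsto.const_mul _ ?_
      have hc : ContinuousAt f (stolzCurve ϑ t) :=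
        hd.continuousOn.continuousAt ((isOpen_stolz (hϑ.trans hν)).mem_nhds htm)
      refine hc.tendsto.comp ?_
      have : Continuous fun s : ℝ => (s : ℂ) * stolzCurve ϑ t := by fun_prop
      simpa using (this.tendsto 1).mono_left nhdsWithin_le_nhds
  refine tendsto_nhds_unique hlim (tendsto_const_nhds.congr' ?_)
  filter_upwards [hev] with s hs
  rw [hz s hs]

/-! ### Winding numbers and Cauchy's integral formula -/

lemma stolzCurve_im (ϑ t : ℝ) : (stolzCurve ϑ t).im = -(stolzRadius ϑ t * Real.sin t) := by
  simp [stolzCurve, Complex.exp_mul_I, ← Complex.ofReal_cos, ← Complex.ofReal_sin]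

lemma stolzCurve_zero_eq {ϑ : ℝ} (hϑ : 1 < ϑ) :
    ∃ r : ℝ, 0 < r ∧ stolzCurve ϑ 0 = -(r : ℂ) := by
  refine ⟨(ϑ - 1) / (ϑ + 1), div_pos (by linarith) (by linarith), ?_⟩
  have h1 : (ϑ ^ 2 - 1) ≠ 0 := by nlinarith
  have h2 : ϑ + 1 ≠ 0 := by linarith
  have : 1 - stolzRadius ϑ 0 = -((ϑ - 1) / (ϑ + 1)) := by
    rw [stolzRadius, Real.cos_zero]
    field_simp
    ring
  rw [← Complex.ofReal_neg, ← this]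
  simp [stolzCurve]

/-- The winding number of a Stolz curve about `0` is one. -/
lemma integral_deriv_stolzCurve_div {ϑ : ℝ} (hϑ : 1 < ϑ) :
    ∫ t in (-stolzAngle ϑ)..(stolzAngle ϑ), deriv (stolzCurve ϑ) t / stolzCurve ϑ t =
      2 * Real.pi * Complex.I := by
  have ha := stolzAngle_pos hϑ
  have hpi := stolzAngle_le hϑ
  have hint (x y : ℝ) : IntervalIntegrable (fun t => deriv (stolzCurve ϑ) t / stolzCurve ϑ t)
      volume x y :=
    ((continuous_deriv_stolzCurve ϑ).div (continuous_stolzCurve ϑ)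
      (stolzCurve_ne_zero hϑ)).intervalIntegrable _ _
  have hslit (z : ℂ) (hz : 0 ≤ z.re) (h0 : z ≠ 0) : z ∈ Complex.slitPlane := by
    rw [Complex.mem_slitPlane_iff]
    rcases hz.lt_or_eq with h | h
    · exact Or.inl h
    · exact Or.inr fun h2 => h0 (Complex.ext h.symm h2)
  have hder (c : ℂ) (hc : c ≠ 0) (t : ℝ) (ht : 0 ≤ (c * stolzCurve ϑ t).re) :
      HasDerivAt (fun t => Complex.log (c * stolzCurve ϑ t))
        (deriv (stolzCurve ϑ) t / stolzCurve ϑ t) t := by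
    have h := ((hasDerivAt_stolzCurve ϑ t).const_mul c).clog_real
      (hslit _ ht (mul_ne_zero hc (stolzCurve_ne_zero hϑ t)))
    rwa [mul_div_mul_left _ _ hc] at h
  -- The curve runs through the closed upper half-plane for `t ≤ 0` and the closed lower one for `t
  -- ≥ 0`. Rotation by `-i`, respectively `i`, moves the half curve into the closed right
  -- half-plane, where the principal logarithm is a primitive. Each half contributes `πi`, up to
  -- logarithms of `r` that cancel.
  rw [← intervalIntegral.integral_add_adjacent_intervals (hint _ 0) (hint 0 _),
    intervalIntegral.integral_eq_sub_of_hasDerivAt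
      (f := fun t => Complex.log (-Complex.I * stolzCurve ϑ t)) ?_ (hint _ _),
    intervalIntegral.integral_eq_sub_of_hasDerivAt
      (f := fun t => Complex.log (Complex.I * stolzCurve ϑ t)) ?_ (hint _ _)]
  · obtain ⟨r, hr, hγ⟩ := stolzCurve_zero_eq hϑ
    rw [stolzCurve_stolzAngle hϑ, stolzCurve_neg_stolzAngle hϑ, hγ,
      show -Complex.I * -(r : ℂ) = (r : ℂ) * Complex.I by ring,
      show Complex.I * -(r : ℂ) = (r : ℂ) * (-Complex.I) by ring,
      Complex.log_ofReal_mul hr Complex.I_ne_zero,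
      Complex.log_ofReal_mul hr (neg_ne_zero.2 Complex.I_ne_zero), mul_one, mul_one,
      Complex.log_I, Complex.log_neg_I]
    ring
  · intro t ht
    rw [Set.uIcc_of_le ha.le] at ht
    refine hder _ Complex.I_ne_zero t ?_
    have h1 := stolzRadius_nonneg hϑ (abs_le.2 ⟨by linarith [ht.1], ht.2⟩)
    have h2 := Real.sin_nonneg_of_nonneg_of_le_pi ht.1 (by linarith [ht.2, Real.pi_pos])
    simp only [Complex.mul_re, Complex.I_re, Complex.I_im, stolzCurve_im]
    nlinarith
  · intro t ht
    rw [Set.uIcc_of_le (by linarith)] at ht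
    refine hder _ (neg_ne_zero.2 Complex.I_ne_zero) t ?_
    have h1 := stolzRadius_nonneg hϑ (abs_le.2 ⟨ht.1, by linarith [ht.2]⟩)
    have h2 := Real.sin_nonpos_of_nonpos_of_neg_pi_le ht.2 (by linarith [ht.1, Real.pi_pos])
    simp only [Complex.mul_re, Complex.neg_re, Complex.neg_im, Complex.I_re, Complex.I_im,
      stolzCurve_im]
    nlinarith

lemma hasDerivAt_inv_stolzCurve {ϑ : ℝ} (hϑ : 1 < ϑ) (t : ℝ) :
    HasDerivAt (fun t => (stolzCurve ϑ t)⁻¹)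
      (-deriv (stolzCurve ϑ) t / stolzCurve ϑ t ^ 2) t :=
  (hasDerivAt_stolzCurve ϑ t).fun_inv (stolzCurve_ne_zero hϑ t)

lemma continuous_deriv_inv_stolzCurve {ϑ : ℝ} (hϑ : 1 < ϑ) :
    Continuous fun t => -deriv (stolzCurve ϑ) t / stolzCurve ϑ t ^ 2 :=
  (continuous_deriv_stolzCurve ϑ).neg.div ((continuous_stolzCurve ϑ).pow 2)
    fun t => pow_ne_zero 2 (stolzCurve_ne_zero hϑ t)

lemma stolzCurve_sub_ne_zero {ϑ : ℝ} (hϑ : 1 < ϑ) {z : ℂ} (hz : z ∈ stolz ϑ) {t : ℝ}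
    (ht : |t| ≤ stolzAngle ϑ) : stolzCurve ϑ t - z ≠ 0 := by
  intro h
  have h1 := stolzGauge_stolzCurve hϑ ht
  rw [sub_eq_zero.1 h] at h1
  exact ((mem_stolz_iff hϑ).1 hz).ne h1

/-- The winding number of a Stolz curve about any point of the Stolz domain is one. -/
lemma integral_deriv_stolzCurve_div_sub {ϑ : ℝ} (hϑ : 1 < ϑ) {z : ℂ} (hz : z ∈ stolz ϑ) :
    ∫ t in (-stolzAngle ϑ)..(stolzAngle ϑ), deriv (stolzCurve ϑ) t / (stolzCurve ϑ t - z) =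
      2 * Real.pi * Complex.I := by
  have ha := stolzAngle_pos hϑ
  -- The difference from the winding number about `0` is, up to sign, the integral of `z / (1 - z
  -- w)` along the inverted curve `w = 1 / stolzCurve ϑ t`. A zero of `1 - z w` on a segment from
  -- `0` to that curve would put a curve point at `s z` with `0 ≤ s ≤ 1`, inside the open Stolz
  -- domain.
  have h := integral_closedCurve_eq_zero (U := {w | 1 - z * w ≠ 0}) (g := fun w => z / (1 - z * w))
    (isOpen_ne_fun (by fun_prop) (by fun_prop))
    (fun w hw => by
      refine DifferentiableAt.differentiableWithinAt ?_
      exact (differentiableAt_const z).div (by fun_prop) hw)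
    (a := -stolzAngle ϑ) (b := stolzAngle ϑ) (by linarith)
    (fun t _ => hasDerivAt_inv_stolzCurve hϑ t) (continuous_deriv_inv_stolzCurve hϑ).continuousOn
    (by simp only [stolzCurve_stolzAngle hϑ, stolzCurve_neg_stolzAngle hϑ]) ?_
  · rw [← integral_deriv_stolzCurve_div hϑ, ← sub_eq_zero, ← intervalIntegral.integral_sub,
      ← neg_eq_zero, ← intervalIntegral.integral_neg]
    · rw [← h]
      refine intervalIntegral.integral_congr fun t ht => ?_
      rw [Set.uIcc_of_le (by linarith)] at ht
      have h1 := stolzCurve_sub_ne_zero hϑ hz (abs_le.2 ht)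
      have h2 := stolzCurve_ne_zero hϑ t
      have h3 : 1 - z * (stolzCurve ϑ t)⁻¹ ≠ 0 := by
        intro h3
        field_simp at h3
        exact h1 (by simpa using h3)
      have h4 : 1 - z * (stolzCurve ϑ t)⁻¹ = (stolzCurve ϑ t - z) / stolzCurve ϑ t := by
        field_simp
      simp only [smul_eq_mul, h4]
      field_simp
      ring
    · refine ContinuousOn.intervalIntegrable ?_
      rw [Set.uIcc_of_le (by linarith)]
      exact (continuous_deriv_stolzCurve ϑ).continuousOn.div
        ((continuous_stolzCurve ϑ).sub continuous_const).continuousOn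
        fun t ht => stolzCurve_sub_ne_zero hϑ hz (abs_le.2 ht)
    · exact ((continuous_deriv_stolzCurve ϑ).div (continuous_stolzCurve ϑ)
        (stolzCurve_ne_zero hϑ)).intervalIntegrable _ _
  · intro t ht s hs h3
    have h2 := stolzCurve_ne_zero hϑ t
    have h4 : stolzCurve ϑ t = s * z := by
      field_simp at h3
      linear_combination h3
    have h5 : (s : ℂ) * z ∈ stolz ϑ := by
      rcases hs.2.lt_or_eq with h | h
      · exact smul_mem_stolz hϑ ((mem_stolz_iff hϑ).1 hz).le hs.1 h
      · simpa [h] using hz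
    exact stolzCurve_sub_ne_zero hϑ h5 (abs_le.2 ht) (by rw [h4, sub_self])

/-- Cauchy's integral formula for bounded holomorphic functions and Stolz curves. -/
lemma integral_deriv_stolzCurve_mul_div_sub {ϑ ν : ℝ} (hϑ : 1 < ϑ) (hν : ϑ < ν) {f : ℂ → ℂ}
    (hf : IsHInfty (stolz ν) f) {z : ℂ} (hz : z ∈ stolz ϑ) :
    ∫ t in (-stolzAngle ϑ)..(stolzAngle ϑ),
      deriv (stolzCurve ϑ) t * (f (stolzCurve ϑ t) / (stolzCurve ϑ t - z)) =
      2 * Real.pi * Complex.I * f z := by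
  have ha := stolzAngle_pos hϑ
  have hopen := isOpen_stolz (hϑ.trans hν)
  have hzν := stolz_mono hϑ hν.le hz
  -- The difference quotient is again bounded holomorphic, by compactness near `z` and by `2 M / r`
  -- away from it, so its integral along the curve vanishes.
  have hds : IsHInfty (stolz ν) (dslope f z) := by
    have hd := (Complex.differentiableOn_dslope (hopen.mem_nhds hzν)).2 hf.1
    refine ⟨hd, ?_⟩
    obtain ⟨M, hM⟩ := hf.2
    obtain ⟨r, hr, hball⟩ := Metric.nhds_basis_closedBall.mem_iff.1 (hopen.mem_nhds hzν)
    obtain ⟨K, hK⟩ := (isCompact_closedBall z r).exists_bound_of_continuousOn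
      (hd.continuousOn.mono hball)
    refine ⟨max K (2 * M / r), fun w hw => ?_⟩
    by_cases hwr : w ∈ Metric.closedBall z r
    · exact (hK w hwr).trans (le_max_left _ _)
    · refine le_trans ?_ (le_max_right _ _)
      rw [Metric.mem_closedBall, not_le, dist_eq_norm] at hwr
      have hne : w ≠ z := by
        rintro rfl
        simp at hwr
        linarith
      rw [dslope_of_ne _ hne, slope_def_field, norm_div]
      have h1 : ‖f w - f z‖ ≤ 2 * M := (norm_sub_le _ _).trans (by linarith [hM w hw, hM z hzν])
      exact div_le_div₀ ((norm_nonneg _).trans h1) h1 hr hwr.le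
  have h0 := integral_deriv_stolzCurve_mul_eq_zero hϑ hν hds
  have h1 := integral_deriv_stolzCurve_div_sub hϑ hz
  have hint1 : IntervalIntegrable (fun t => deriv (stolzCurve ϑ) t * dslope f z (stolzCurve ϑ t))
      volume (-stolzAngle ϑ) (stolzAngle ϑ) := by
    obtain ⟨M, hM⟩ := hds.2
    obtain ⟨K, hK0, hK⟩ := exists_norm_deriv_stolzCurve_le ϑ
    refine intervalIntegrable_of_continuousOn_of_bound (K := K * M) (by linarith) ?_ ?_
    · exact (continuous_deriv_stolzCurve ϑ).continuousOn.mul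
        (hds.1.continuousOn.comp (continuous_stolzCurve ϑ).continuousOn
          fun t ht => stolzCurve_mem_stolz hϑ hν (abs_lt.2 ht))
    · intro t ht
      rw [norm_mul]
      exact mul_le_mul (hK t (abs_lt.2 ht).le) (hM _ (stolzCurve_mem_stolz hϑ hν (abs_lt.2 ht)))
        (norm_nonneg _) hK0.le
  have hint2 : IntervalIntegrable (fun t => deriv (stolzCurve ϑ) t / (stolzCurve ϑ t - z))
      volume (-stolzAngle ϑ) (stolzAngle ϑ) := by
    refine ContinuousOn.intervalIntegrable ?_
    rw [Set.uIcc_of_le (by linarith)]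
    exact (continuous_deriv_stolzCurve ϑ).continuousOn.div
      ((continuous_stolzCurve ϑ).sub continuous_const).continuousOn
      fun t ht => stolzCurve_sub_ne_zero hϑ hz (abs_le.2 ht)
  rw [← h1, ← intervalIntegral.integral_mul_const, ← add_zero (∫ t in _.._, _ * f z), ← h0,
    ← intervalIntegral.integral_add (hint2.mul_const _) hint1]
  refine intervalIntegral.integral_congr fun t ht => ?_
  rw [Set.uIcc_of_le (by linarith)] at ht
  have h2 := stolzCurve_sub_ne_zero hϑ hz (abs_le.2 ht)
  rw [dslope_of_ne _ (sub_ne_zero.1 h2), slope_def_field]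
  field_simp
  ring

/-! ### The elementary functional calculus -/

lemma intervalIntegral_congr_Ioo {E : Type*} [NormedAddCommGroup E] [NormedSpace ℝ E]
    {f g : ℝ → E} {a b : ℝ} (hab : a ≤ b) (h : ∀ t ∈ Set.Ioo a b, f t = g t) :
    ∫ t in a..b, f t = ∫ t in a..b, g t := by
  simp only [intervalIntegral.integral_of_le hab, integral_Ioc_eq_integral_Ioo]
  exact setIntegral_congr_fun measurableSet_Ioo h

section HInfty

lemma IsHInfty.mono {Ω Ω' : Set ℂ} (h : Ω' ⊆ Ω) {f : ℂ → ℂ} (hf : IsHInfty Ω f) :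
    IsHInfty Ω' f :=
  ⟨hf.1.mono h, hf.2.imp fun _ hM z hz => hM z (h hz)⟩

lemma IsHInfty.mul {Ω : Set ℂ} {f g : ℂ → ℂ} (hf : IsHInfty Ω f) (hg : IsHInfty Ω g) :
    IsHInfty Ω fun z => f z * g z := by
  obtain ⟨hfd, M, hM⟩ := hf
  obtain ⟨hgd, K, hK⟩ := hg
  refine ⟨hfd.mul hgd, M * K, fun z hz => ?_⟩
  rw [norm_mul]
  exact mul_le_mul (hM z hz) (hK z hz) (norm_nonneg _) ((norm_nonneg _).trans (hM z hz))

lemma isHInfty_stolz_of_differentiable {ν : ℝ} {f : ℂ → ℂ} (hf : Differentiable ℂ f) :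
    IsHInfty (stolz ν) f := by
  obtain ⟨M, hM⟩ := (isCompact_closedBall (0 : ℂ) 1).exists_bound_of_continuousOn
    hf.continuous.continuousOn
  refine ⟨hf.differentiableOn, M, fun z hz => hM z ?_⟩
  simpa using hz.1.le

lemma IsHInfty.norm_le {Ω : Set ℂ} {f : ℂ → ℂ} (hf : IsHInfty Ω f) {z : ℂ} (hz : z ∈ Ω) :
    ‖f z‖ ≤ hInftyNorm Ω f := by
  obtain ⟨-, M, hM⟩ := hf
  exact le_ciSup (f := fun z : Ω => ‖f z‖) ⟨M, by rintro _ ⟨w, rfl⟩; exact hM w w.2⟩ ⟨z, hz⟩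

variable {ω ν ϑ : ℝ} {f g : ℂ → ℂ}

lemma IsHInfty.continuousOn_comp_stolzCurve (hϑ : 1 < ϑ) (hν : ϑ < ν) (hf : IsHInfty (stolz ν) f) :
    ContinuousOn (fun t => f (stolzCurve ϑ t)) (Set.Ioo (-stolzAngle ϑ) (stolzAngle ϑ)) :=
  hf.1.continuousOn.comp (continuous_stolzCurve ϑ).continuousOn
    fun _ ht => stolzCurve_mem_stolz hϑ hν (abs_lt.2 ht)

lemma IsElementaryVia.mul (hω : 1 < ω) (hf : IsElementaryVia ω ν ϑ f)
    (hg : IsHInfty (stolz ν) g) : IsElementaryVia ω ν ϑ fun z => g z * f z := by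
  obtain ⟨hf, h1, h2, hint⟩ := hf
  have hϑ := hω.trans h1
  refine ⟨hg.mul hf, h1, h2, ?_⟩
  have ha := stolzAngle_pos hϑ
  obtain ⟨M, hM⟩ := hg.2
  rw [intervalIntegrable_iff_integrableOn_Ioo_of_le (by linarith)] at hint ⊢
  have := hint.bdd_mul (hg.continuousOn_comp_stolzCurve hϑ h2 |>.aestronglyMeasurable
    measurableSet_Ioo) (c := M) ((ae_restrict_iff' measurableSet_Ioo).2
      (Eventually.of_forall fun t ht => hM _ (stolzCurve_mem_stolz hϑ h2 (abs_lt.2 ht))))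
  refine this.congr (Eventually.of_forall fun t => ?_)
  ring

/-- The factor `1 - z` cancels the singular weight at the vertex, so `1 - z` turns every bounded
holomorphic function into an elementary one, along any admissible path. -/
lemma IsHInfty.isElementaryVia_one_sub_mul (hω : 1 < ω) (h1 : ω < ϑ) (h2 : ϑ < ν)
    (hf : IsHInfty (stolz ν) f) : IsElementaryVia ω ν ϑ fun z => (1 - z) * f z := by
  have hϑ := hω.trans h1
  have ha := stolzAngle_pos hϑ
  refine ⟨(isHInfty_stolz_of_differentiable (by fun_prop)).mul hf, h1, h2, ?_⟩
  obtain ⟨M, hM⟩ := hf.2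
  obtain ⟨K, hK0, hK⟩ := exists_norm_deriv_stolzCurve_le ϑ
  have : IntervalIntegrable (fun t => f (stolzCurve ϑ t) * deriv (stolzCurve ϑ) t) volume
      (-stolzAngle ϑ) (stolzAngle ϑ) := by
    refine intervalIntegrable_of_continuousOn_of_bound (K := M * K) (by linarith)
      ((hf.continuousOn_comp_stolzCurve hϑ h2).mul (continuous_deriv_stolzCurve ϑ).continuousOn)
      fun t ht => ?_
    have h3 := hM _ (stolzCurve_mem_stolz hϑ h2 (abs_lt.2 ht))
    rw [norm_mul]
    exact mul_le_mul h3 (hK t (abs_lt.2 ht).le) (norm_nonneg _) ((norm_nonneg _).trans h3)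
  rw [intervalIntegrable_iff_integrableOn_Ioo_of_le (by linarith)] at this ⊢
  refine this.congr_fun (fun t ht => ?_) measurableSet_Ioo
  have h3 : 1 - stolzCurve ϑ t ≠ 0 := sub_ne_zero.2 (stolzCurve_ne_one hϑ (abs_lt.2 ht)).symm
  simp only
  rw [mul_div_cancel_left₀ _ h3]

lemma isElementaryVia_one_sub (hω : 1 < ω) (h1 : ω < ϑ) (h2 : ϑ < ν) :
    IsElementaryVia ω ν ϑ fun z => 1 - z := by
  simpa using IsHInfty.isElementaryVia_one_sub_mul hω h1 h2 (f := fun _ => 1)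
    (isHInfty_stolz_of_differentiable (by fun_prop))

lemma IsElementaryVia.mono {ν' : ℝ} (hω : 1 < ω) (h : IsElementaryVia ω ν ϑ f) (h1 : ϑ < ν')
    (h2 : ν' ≤ ν) : IsElementaryVia ω ν' ϑ f :=
  ⟨h.1.mono (stolz_mono (hω.trans (h.2.1.trans h1)) h2), h.2.1, h1, h.2.2.2⟩

end HInfty

/-! ### Contour integrals of the resolvent and multiplication by polynomials -/

section Space

variable {X : Type*} [NormedAddCommGroup X] [NormedSpace ℂ X]

/-- `T` is a Ritt operator of type `ω`. -/
def IsRittOfType (T : X →L[ℂ] X) (ω : ℝ) : Prop :=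
  spectrum ℂ T ⊆ closure (stolz ω) ∧
    ∀ θ : ℝ, ω < θ → ∃ C, 0 ≤ C ∧ ∀ l ∉ closure (stolz θ), ‖(l - 1) • resolvent T l‖ ≤ C

lemma IsRRittOfType.isRittOfType {T : X →L[ℂ] X} {ω : ℝ} (h : IsRRittOfType T ω) :
    IsRittOfType T ω := by
  refine ⟨h.2.1, fun θ hθ => ?_⟩
  obtain ⟨C, hC, hb⟩ := (h.2.2 θ hθ).exists_isRBoundedBy
  exact ⟨C, hC, fun l hl => hb.norm_le hC ⟨l, hl, rfl⟩⟩

lemma mul_resolvent {T : X →L[ℂ] X} {z : ℂ} (hz : z ∈ resolventSet ℂ T) :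
    T * resolvent T z = z • resolvent T z - 1 := by
  have h := Ring.mul_inverse_cancel _ hz
  rw [sub_mul, Algebra.algebraMap_eq_smul_one, smul_mul_assoc, one_mul] at h
  rw [← h]
  simp [resolvent, Algebra.algebraMap_eq_smul_one]

lemma resolvent_mul {T : X →L[ℂ] X} {z : ℂ} (hz : z ∈ resolventSet ℂ T) :
    resolvent T z * T = z • resolvent T z - 1 := by
  have h := Ring.inverse_mul_cancel _ hz
  rw [mul_sub, Algebra.algebraMap_eq_smul_one, mul_smul_comm, mul_one] at h
  rw [← h]
  simp [resolvent, Algebra.algebraMap_eq_smul_one]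

variable {T : X →L[ℂ] X} {ω ν ϑ : ℝ} {f : ℂ → ℂ}

lemma IsRittOfType.mem_resolventSet (h : IsRittOfType T ω) {z : ℂ}
    (hz : z ∉ closure (stolz ω)) : z ∈ resolventSet ℂ T := by
  by_contra hn
  exact hz (h.1 hn)

lemma IsRittOfType.stolzCurve_mem (h : IsRittOfType T ω) (hω : 1 < ω) (hϑ : ω < ϑ) {t : ℝ}
    (ht : |t| < stolzAngle ϑ) : stolzCurve ϑ t ∈ resolventSet ℂ T :=
  h.mem_resolventSet (stolzCurve_notMem_closure hω hϑ ht)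

lemma IsRittOfType.exists_bound (h : IsRittOfType T ω) (hω : 1 < ω) (hϑ : ω < ϑ) :
    ∃ C, 0 ≤ C ∧ ∀ t, |t| < stolzAngle ϑ →
      ‖(1 - stolzCurve ϑ t) • resolvent T (stolzCurve ϑ t)‖ ≤ C := by
  -- The resolvent bound of type `θ` holds off the closure of `stolz θ`, so a parameter strictly
  -- between `ω` and `ϑ` is needed to cover the curve of parameter `ϑ`.
  obtain ⟨C, hC, hb⟩ := h.2 ((ω + ϑ) / 2) (by linarith)
  refine ⟨C, hC, fun t ht => ?_⟩
  have := hb _ (stolzCurve_notMem_closure (by linarith) (by linarith : (ω + ϑ) / 2 < ϑ) ht)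
  rwa [← neg_sub, neg_smul, norm_neg] at this

variable [CompleteSpace X]

lemma IsRittOfType.continuousOn_resolvent (h : IsRittOfType T ω) (hω : 1 < ω) (hϑ : ω < ϑ) :
    ContinuousOn (fun t => resolvent T (stolzCurve ϑ t))
      (Set.Ioo (-stolzAngle ϑ) (stolzAngle ϑ)) := fun _ ht =>
  ((spectrum.hasDerivAt_resolvent_const_left
    (h.stolzCurve_mem hω hϑ (abs_lt.2 ht))).continuousAt.comp
      (continuous_stolzCurve ϑ).continuousAt).continuousWithinAt

lemma IsRittOfType.intervalIntegrable (h : IsRittOfType T ω) (hω : 1 < ω)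
    (hf : IsElementaryVia ω ν ϑ f) :
    IntervalIntegrable (fun t => (f (stolzCurve ϑ t) * deriv (stolzCurve ϑ) t) •
      resolvent T (stolzCurve ϑ t)) volume (-stolzAngle ϑ) (stolzAngle ϑ) := by
  obtain ⟨-, h1, -, hint⟩ := hf
  have hϑ := hω.trans h1
  have ha := stolzAngle_pos hϑ
  obtain ⟨C, hC, hb⟩ := h.exists_bound hω h1
  rw [intervalIntegrable_iff_integrableOn_Ioo_of_le (by linarith)] at hint ⊢
  have := hint.smul_bdd C (f := fun t => (1 - stolzCurve ϑ t) • resolvent T (stolzCurve ϑ t))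
    (((continuous_const.sub (continuous_stolzCurve ϑ)).continuousOn.smul
      (h.continuousOn_resolvent hω h1)).aestronglyMeasurable measurableSet_Ioo)
    ((ae_restrict_iff' measurableSet_Ioo).2 (Eventually.of_forall fun t ht => hb t (abs_lt.2 ht)))
  refine IntegrableOn.congr_fun this (fun t ht => ?_) measurableSet_Ioo
  have h3 : 1 - stolzCurve ϑ t ≠ 0 := sub_ne_zero.2 (stolzCurve_ne_one hϑ (abs_lt.2 ht)).symm
  simp only [Pi.smul_apply', smul_smul]
  congr 1
  field_simp

lemma IsRittOfType.mul_elementaryIntegral (h : IsRittOfType T ω) (hω : 1 < ω)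
    (hf : IsElementaryVia ω ν ϑ f) (B : X →L[ℂ] X) :
    B * elementaryIntegral T ϑ f = (2 * Real.pi * Complex.I : ℂ)⁻¹ •
      ∫ t in (-stolzAngle ϑ)..(stolzAngle ϑ), (f (stolzCurve ϑ t) * deriv (stolzCurve ϑ) t) •
        (B * resolvent T (stolzCurve ϑ t)) := by
  have := (ContinuousLinearMap.mul ℂ (X →L[ℂ] X) B).intervalIntegral_comp_comm
    (h.intervalIntegrable hω hf)
  simp only [ContinuousLinearMap.mul_apply', mul_smul_comm] at this
  rw [this, elementaryIntegral, mul_smul_comm]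

lemma IsRittOfType.elementaryIntegral_mul (h : IsRittOfType T ω) (hω : 1 < ω)
    (hf : IsElementaryVia ω ν ϑ f) (B : X →L[ℂ] X) :
    elementaryIntegral T ϑ f * B = (2 * Real.pi * Complex.I : ℂ)⁻¹ •
      ∫ t in (-stolzAngle ϑ)..(stolzAngle ϑ), (f (stolzCurve ϑ t) * deriv (stolzCurve ϑ) t) •
        (resolvent T (stolzCurve ϑ t) * B) := by
  have := ((ContinuousLinearMap.mul ℂ (X →L[ℂ] X)).flip B).intervalIntegral_comp_comm
    (h.intervalIntegrable hω hf)
  simp only [ContinuousLinearMap.flip_apply, ContinuousLinearMap.mul_apply',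
    smul_mul_assoc] at this
  rw [this, elementaryIntegral, smul_mul_assoc]

lemma IsRittOfType.commute_elementaryIntegral (h : IsRittOfType T ω) (hω : 1 < ω)
    (hf : IsElementaryVia ω ν ϑ f) : Commute T (elementaryIntegral T ϑ f) := by
  have ha := stolzAngle_pos (hω.trans hf.2.1)
  rw [commute_iff_eq, h.mul_elementaryIntegral hω hf, h.elementaryIntegral_mul hω hf]
  congr 1
  refine intervalIntegral_congr_Ioo (by linarith) fun t ht => ?_
  have := h.stolzCurve_mem hω hf.2.1 (abs_lt.2 ht)
  rw [mul_resolvent this, resolvent_mul this]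

/-- Since `T R(z, T) = z R(z, T) - 1`, the two sides differ by a multiple of the integral of `f`
along the curve, which is zero by Cauchy's theorem. -/
lemma IsRittOfType.T_mul_elementaryIntegral (h : IsRittOfType T ω) (hω : 1 < ω)
    (hf : IsElementaryVia ω ν ϑ f) :
    T * elementaryIntegral T ϑ f = elementaryIntegral T ϑ fun z => z * f z := by
  have h1 := hf.2.1
  have ha := stolzAngle_pos (hω.trans h1)
  have hz : IsHInfty (stolz ν) fun z => z := isHInfty_stolz_of_differentiable (by fun_prop)
  have hint := h.intervalIntegrable hω (hf.mul hω hz)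
  have hint2 : IntervalIntegrable (fun t => deriv (stolzCurve ϑ) t * f (stolzCurve ϑ t)) volume
      (-stolzAngle ϑ) (stolzAngle ϑ) := by
    obtain ⟨M, hM⟩ := hf.1.2
    obtain ⟨K, hK0, hK⟩ := exists_norm_deriv_stolzCurve_le ϑ
    have hϑ := hω.trans h1
    refine intervalIntegrable_of_continuousOn_of_bound (K := K * M) (by linarith)
      ((continuous_deriv_stolzCurve ϑ).continuousOn.mul
        (hf.1.continuousOn_comp_stolzCurve hϑ hf.2.2.1)) fun t ht => ?_
    rw [norm_mul]
    exact mul_le_mul (hK t (abs_lt.2 ht).le)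
      (hM _ (stolzCurve_mem_stolz hϑ hf.2.2.1 (abs_lt.2 ht))) (norm_nonneg _) hK0.le
  rw [h.mul_elementaryIntegral hω hf, elementaryIntegral]
  congr 1
  have h0 := integral_deriv_stolzCurve_mul_eq_zero (hω.trans h1) hf.2.2.1 hf.1
  have h2 : ∫ t in (-stolzAngle ϑ)..(stolzAngle ϑ),
      (deriv (stolzCurve ϑ) t * f (stolzCurve ϑ t)) • (1 : X →L[ℂ] X) = 0 := by
    rw [intervalIntegral.integral_smul_const, h0, zero_smul]
  rw [← sub_zero (∫ t in _.._, ((stolzCurve ϑ t) * f (stolzCurve ϑ t) * _) • _), ← h2,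
    ← intervalIntegral.integral_sub hint (hint2.smul_continuousOn continuousOn_const)]
  refine intervalIntegral_congr_Ioo (by linarith) fun t ht => ?_
  rw [mul_resolvent (h.stolzCurve_mem hω h1 (abs_lt.2 ht)), smul_sub, smul_smul]
  congr 2 <;> ring

lemma IsRittOfType.aeval_mul_elementaryIntegral (h : IsRittOfType T ω) (hω : 1 < ω)
    (hf : IsElementaryVia ω ν ϑ f) (p : Polynomial ℂ) :
    Polynomial.aeval T p * elementaryIntegral T ϑ f =
      elementaryIntegral T ϑ fun z => p.eval z * f z := by
  have hH (p : Polynomial ℂ) : IsHInfty (stolz ν) fun z => p.eval z :=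
    isHInfty_stolz_of_differentiable p.differentiable
  induction p using Polynomial.induction_on' with
  | add p q hp hq =>
    rw [map_add, add_mul, hp, hq]
    simp only [elementaryIntegral, ← smul_add, Polynomial.eval_add]
    rw [← intervalIntegral.integral_add (h.intervalIntegrable hω (hf.mul hω (hH p)))
      (h.intervalIntegrable hω (hf.mul hω (hH q)))]
    simp only [← add_smul, add_mul]
  | monomial n a =>
    have hn : T ^ n * elementaryIntegral T ϑ f =
        elementaryIntegral T ϑ fun z => z ^ n * f z := by
      induction n with
      | zero => simp
      | succ n ih =>
        have := h.T_mul_elementaryIntegral hω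
          (hf.mul hω (g := fun z => z ^ n) (isHInfty_stolz_of_differentiable (by fun_prop)))
        rw [pow_succ', mul_assoc, ih, this]
        simp only [pow_succ', mul_assoc]
    rw [Polynomial.aeval_monomial, mul_assoc, hn, Algebra.algebraMap_eq_smul_one, smul_mul_assoc,
      one_mul]
    simp only [elementaryIntegral, Polynomial.eval_monomial]
    rw [smul_comm, ← intervalIntegral.integral_smul]
    simp only [smul_smul, mul_assoc]

end Space

/-! ### The operator of the function `1 - z` -/

section Space

variable {X : Type*} [NormedAddCommGroup X] [NormedSpace ℂ X]
variable {T : X →L[ℂ] X} {ω ν ϑ : ℝ} {f : ℂ → ℂ}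

/-- In the coordinate `w = 1 / z` the resolvent becomes a function regular at `w = 0`, which stands
for infinity. -/
lemma isUnit_one_sub_smul {z : ℂ} (hz0 : z ≠ 0) (hz : z ∈ resolventSet ℂ T) :
    IsUnit (1 - z⁻¹ • T) ∧ Ring.inverse (1 - z⁻¹ • T) = z • resolvent T z := by
  have h1 : (1 - z⁻¹ • T) * (z • resolvent T z) = 1 := by
    rw [sub_mul, one_mul, smul_mul_smul_comm, inv_mul_cancel₀ hz0, one_smul, mul_resolvent hz,
      sub_sub_cancel]
  have h2 : (z • resolvent T z) * (1 - z⁻¹ • T) = 1 := by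
    rw [mul_sub, mul_one, smul_mul_smul_comm, mul_inv_cancel₀ hz0, one_smul, resolvent_mul hz,
      sub_sub_cancel]
  have hu : IsUnit (1 - z⁻¹ • T) := ⟨⟨_, _, h1, h2⟩, rfl⟩
  exact ⟨hu, left_inv_eq_right_inv (Ring.inverse_mul_cancel _ hu) h1⟩

variable [CompleteSpace X]

/-- The resolvent against the part `(1 - z) / z²` of the integrand has no singularities outside
the Stolz domain, including at infinity. -/
lemma IsRittOfType.integral_exterior_eq_zero (h : IsRittOfType T ω) (hω : 1 < ω) (hϑ : ω < ϑ) :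
    ∫ t in (-stolzAngle ϑ)..(stolzAngle ϑ),
      ((1 - stolzCurve ϑ t) * deriv (stolzCurve ϑ) t / stolzCurve ϑ t ^ 2) •
        resolvent T (stolzCurve ϑ t) = 0 := by
  have hϑ1 := hω.trans hϑ
  have ha := stolzAngle_pos hϑ1
  have hγ0 := stolzCurve_ne_zero hϑ1
  obtain ⟨C, hC, hb⟩ := h.2 ((ω + ϑ) / 2) (by linarith)
  set θ := (ω + ϑ) / 2 with hθ
  have hωθ : ω < θ := by rw [hθ]; linarith
  have hθϑ : θ < ϑ := by rw [hθ]; linarith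
  set κ' : ℝ → ℂ := fun t => -deriv (stolzCurve ϑ) t / stolzCurve ϑ t ^ 2 with hκ'
  have hκ'c : Continuous κ' := continuous_deriv_inv_stolzCurve hϑ1
  set U : Set ℂ := {w | IsUnit (1 - w • T)} with hU
  have hUo : IsOpen U := Units.isOpen.preimage (by fun_prop)
  -- At `w = 1 / z` this is `(z - 1) R(z, T)`, bounded by the Ritt condition. The segments from `0`
  -- to the inverted curve correspond to the radial exterior of the Stolz curve. As before, Cauchy's
  -- theorem is used for `s < 1`, and the bound permits `s → 1`.
  set g : ℂ → X →L[ℂ] X := fun w => (1 - w) • Ring.inverse (1 - w • T) with hg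
  have hgd : DifferentiableOn ℂ g U := by
    have h1 : DifferentiableOn ℂ (fun w : ℂ => 1 - w • T) U := by fun_prop
    have h2 : DifferentiableOn ℂ (fun w : ℂ => 1 - w) U := by fun_prop
    exact h2.smul (h1.inverse fun w hw => hw)
  have hout (t : ℝ) (ht : |t| ≤ stolzAngle ϑ) (s : ℝ) (hs : s ∈ Set.Ioo (0 : ℝ) 1) :
      (s : ℂ) * (stolzCurve ϑ t)⁻¹ ∈ U ∧ ‖g ((s : ℂ) * (stolzCurve ϑ t)⁻¹)‖ ≤ C := by
    have hs0 : (s : ℂ) ≠ 0 := by exact_mod_cast hs.1.ne'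
    set z : ℂ := stolzCurve ϑ t / s with hz
    have hz0 : z ≠ 0 := div_ne_zero (hγ0 t) hs0
    have hzinv : (s : ℂ) * (stolzCurve ϑ t)⁻¹ = z⁻¹ := by rw [hz, inv_div]; rfl
    have hzn : z ∉ closure (stolz θ) :=
      stolzCurve_div_notMem_closure (hω.trans hωθ) hθϑ.le ht hs.1 hs.2
    have hzr : z ∈ resolventSet ℂ T :=
      h.mem_resolventSet (stolzCurve_div_notMem_closure hω hϑ.le ht hs.1 hs.2)
    obtain ⟨hu, hinv⟩ := isUnit_one_sub_smul hz0 hzr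
    rw [hzinv]
    refine ⟨hu, ?_⟩
    have h1 := hb z hzn
    rw [hg]
    simp only [hinv, smul_smul]
    rwa [sub_mul, inv_mul_cancel₀ hz0, one_mul]
  have hat (t : ℝ) (ht : |t| < stolzAngle ϑ) : (stolzCurve ϑ t)⁻¹ ∈ U ∧
      κ' t • g (stolzCurve ϑ t)⁻¹ =
      ((1 - stolzCurve ϑ t) * deriv (stolzCurve ϑ) t / stolzCurve ϑ t ^ 2) •
        resolvent T (stolzCurve ϑ t) := by
    obtain ⟨hu, hinv⟩ := isUnit_one_sub_smul (hγ0 t) (h.stolzCurve_mem hω hϑ ht)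
    refine ⟨hu, ?_⟩
    simp only [hg, hinv, smul_smul, hκ']
    congr 1
    have := hγ0 t
    field_simp
    ring
  have hz (s : ℝ) (hs : s ∈ Set.Ioo (0 : ℝ) 1) : ∫ t in (-stolzAngle ϑ)..(stolzAngle ϑ),
      κ' t • g (s * (stolzCurve ϑ t)⁻¹) = 0 := by
    have h1 := integral_closedCurve_eq_zero hUo hgd
      (κ := fun t => (s : ℂ) * (stolzCurve ϑ t)⁻¹) (κ' := fun t => (s : ℂ) * κ' t)
      (a := -stolzAngle ϑ) (b := stolzAngle ϑ) (by linarith)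
      (fun t _ => (hasDerivAt_inv_stolzCurve hϑ1 t).const_mul (s : ℂ))
      (continuous_const.mul hκ'c).continuousOn
      (by simp only [stolzCurve_stolzAngle hϑ1, stolzCurve_neg_stolzAngle hϑ1])
      (fun t ht r hr => by
        rcases hr.1.eq_or_lt with h0 | h0
        · simp [← h0, hU]
        · rw [← mul_assoc, ← Complex.ofReal_mul]
          exact (hout t (abs_le.2 ht) _
            ⟨mul_pos h0 hs.1, by nlinarith [hr.1, hr.2, hs.1, hs.2]⟩).1)
    simp only [mul_smul] at h1
    rw [intervalIntegral.integral_smul] at h1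
    exact (smul_eq_zero.1 h1).resolve_left (by exact_mod_cast hs.1.ne')
  have hIoc : Set.uIoc (-stolzAngle ϑ) (stolzAngle ϑ) =
    Set.Ioc (-stolzAngle ϑ) (stolzAngle ϑ) := Set.uIoc_of_le (by linarith)
  have hev : ∀ᶠ s : ℝ in 𝓝[<] 1, s ∈ Set.Ioo (0 : ℝ) 1 :=
    Ioo_mem_nhdsLT zero_lt_one
  have hlim : Tendsto (fun s : ℝ => ∫ t in (-stolzAngle ϑ)..(stolzAngle ϑ),
      κ' t • g (s * (stolzCurve ϑ t)⁻¹)) (𝓝[<] 1)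
      (𝓝 (∫ t in (-stolzAngle ϑ)..(stolzAngle ϑ), κ' t • g (stolzCurve ϑ t)⁻¹)) := by
    refine intervalIntegral.tendsto_integral_filter_of_dominated_convergence
      (fun t => ‖κ' t‖ * C) ?_ ?_ ((hκ'c.norm.mul continuous_const).intervalIntegrable _ _) ?_
    · filter_upwards [hev] with s hs
      rw [hIoc]
      refine ContinuousOn.aestronglyMeasurable ?_ measurableSet_Ioc
      refine hκ'c.continuousOn.smul ?_
      exact hgd.continuousOn.comp (continuous_const.mul
        ((continuous_stolzCurve ϑ).inv₀ hγ0)).continuousOn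
        fun t ht => (hout t (abs_le.2 (Set.Ioc_subset_Icc_self ht)) s hs).1
    · filter_upwards [hev] with s hs
      refine Eventually.of_forall fun t ht => ?_
      rw [hIoc] at ht
      rw [norm_smul]
      exact mul_le_mul_of_nonneg_left (hout t (abs_le.2 (Set.Ioc_subset_Icc_self ht)) s hs).2
        (norm_nonneg _)
    · filter_upwards [Measure.ae_ne volume (stolzAngle ϑ)] with t hne ht
      rw [hIoc] at ht
      have htm := (hat t (abs_lt.2 ⟨ht.1, lt_of_le_of_ne ht.2 hne⟩)).1
      refine Tendsto.const_smul ?_ _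
      have hc : ContinuousAt g (stolzCurve ϑ t)⁻¹ :=
        hgd.continuousOn.continuousAt (hUo.mem_nhds htm)
      refine hc.tendsto.comp ?_
      have : Continuous fun s : ℝ => (s : ℂ) * (stolzCurve ϑ t)⁻¹ := by fun_prop
      simpa using (this.tendsto 1).mono_left nhdsWithin_le_nhds
  rw [← intervalIntegral_congr_Ioo (by linarith) fun t ht => (hat t (abs_lt.2 ht)).2]
  refine tendsto_nhds_unique hlim (tendsto_const_nhds.congr' ?_)
  filter_upwards [hev] with s hs
  rw [hz s hs]

lemma integral_deriv_stolzCurve (ϑ : ℝ) (hϑ : 1 < ϑ) :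
    ∫ t in (-stolzAngle ϑ)..(stolzAngle ϑ), deriv (stolzCurve ϑ) t = 0 := by
  rw [intervalIntegral.integral_eq_sub_of_hasDerivAt (fun t _ => hasDerivAt_stolzCurve ϑ t)
    ((continuous_deriv_stolzCurve ϑ).intervalIntegrable _ _), stolzCurve_stolzAngle hϑ,
    stolzCurve_neg_stolzAngle hϑ, sub_self]

lemma integral_deriv_inv_stolzCurve (ϑ : ℝ) (hϑ : 1 < ϑ) :
    ∫ t in (-stolzAngle ϑ)..(stolzAngle ϑ),
      -deriv (stolzCurve ϑ) t / stolzCurve ϑ t ^ 2 = 0 := by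
  rw [intervalIntegral.integral_eq_sub_of_hasDerivAt (fun t _ => hasDerivAt_inv_stolzCurve hϑ t)
    ((continuous_deriv_inv_stolzCurve hϑ).intervalIntegrable _ _), stolzCurve_stolzAngle hϑ,
    stolzCurve_neg_stolzAngle hϑ, sub_self]

/-- The elementary calculus maps `1 - z` to `1 - T`. -/
lemma IsRittOfType.elementaryIntegral_one_sub (h : IsRittOfType T ω) (hω : 1 < ω) (hϑ : ω < ϑ) :
    elementaryIntegral T ϑ (fun z => 1 - z) = 1 - T := by
  have hϑ1 := hω.trans hϑ
  have ha := stolzAngle_pos hϑ1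
  have hγ0 := stolzCurve_ne_zero hϑ1
  have hint1 : IntervalIntegrable (fun t => deriv (stolzCurve ϑ) t / stolzCurve ϑ t)
      volume (-stolzAngle ϑ) (stolzAngle ϑ) :=
    ((continuous_deriv_stolzCurve ϑ).div (continuous_stolzCurve ϑ) hγ0).intervalIntegrable _ _
  have hint2 : IntervalIntegrable (fun t => deriv (stolzCurve ϑ) t)
      volume (-stolzAngle ϑ) (stolzAngle ϑ) :=
    (continuous_deriv_stolzCurve ϑ).intervalIntegrable _ _
  have hint3 : IntervalIntegrable (fun t => -deriv (stolzCurve ϑ) t / stolzCurve ϑ t ^ 2)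
      volume (-stolzAngle ϑ) (stolzAngle ϑ) :=
    (continuous_deriv_inv_stolzCurve hϑ1).intervalIntegrable _ _
  have hint3' : IntervalIntegrable (fun t => -(-deriv (stolzCurve ϑ) t / stolzCurve ϑ t ^ 2))
      volume (-stolzAngle ϑ) (stolzAngle ϑ) := hint3.neg
  have hint4 : IntervalIntegrable (fun t =>
      ((1 - stolzCurve ϑ t) * deriv (stolzCurve ϑ) t / stolzCurve ϑ t ^ 2) •
        resolvent T (stolzCurve ϑ t)) volume (-stolzAngle ϑ) (stolzAngle ϑ) := by
    have h1 := h.intervalIntegrable hω (isElementaryVia_one_sub hω hϑ (lt_add_one ϑ))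
    have h2 : Continuous fun t => (stolzCurve ϑ t ^ 2)⁻¹ :=
      ((continuous_stolzCurve ϑ).pow 2).inv₀ fun t => pow_ne_zero 2 (hγ0 t)
    refine (h1.continuousOn_smul h2.continuousOn).congr fun t _ => ?_
    simp only [smul_smul]
    rw [div_eq_inv_mul]
  -- The expansion `R(z, T) = 1 / z + T / z² + T² R(z, T) / z²` is multiplied by `1 - z`. Only the
  -- terms in `1 / z` survive, with coefficients `1` and `-T`; the resolvent term vanishes by the
  -- exterior Cauchy theorem.
  have key : ∫ t in (-stolzAngle ϑ)..(stolzAngle ϑ),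
      ((1 - stolzCurve ϑ t) * deriv (stolzCurve ϑ) t) • resolvent T (stolzCurve ϑ t) =
      (∫ t in (-stolzAngle ϑ)..(stolzAngle ϑ), (deriv (stolzCurve ϑ) t / stolzCurve ϑ t -
          deriv (stolzCurve ϑ) t) • (1 : X →L[ℂ] X)) +
      (∫ t in (-stolzAngle ϑ)..(stolzAngle ϑ), (-(-deriv (stolzCurve ϑ) t / stolzCurve ϑ t ^ 2) -
          deriv (stolzCurve ϑ) t / stolzCurve ϑ t) • T) +
      ∫ t in (-stolzAngle ϑ)..(stolzAngle ϑ), ContinuousLinearMap.mul ℂ (X →L[ℂ] X) (T * T)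
        (((1 - stolzCurve ϑ t) * deriv (stolzCurve ϑ) t / stolzCurve ϑ t ^ 2) •
          resolvent T (stolzCurve ϑ t)) := by
    have i1 := (hint1.sub hint2).smul_continuousOn
      (continuousOn_const (c := (1 : X →L[ℂ] X)))
    have i2 := (hint3'.sub hint1).smul_continuousOn (continuousOn_const (c := T))
    have i3 : IntervalIntegrable (fun t => ContinuousLinearMap.mul ℂ (X →L[ℂ] X) (T * T)
        (((1 - stolzCurve ϑ t) * deriv (stolzCurve ϑ) t / stolzCurve ϑ t ^ 2) •
          resolvent T (stolzCurve ϑ t))) volume (-stolzAngle ϑ) (stolzAngle ϑ) :=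
      hint4.const_mul (T * T)
    rw [← intervalIntegral.integral_add i1 i2, ← intervalIntegral.integral_add (i1.add i2) i3]
    refine intervalIntegral_congr_Ioo (by linarith) fun t ht => ?_
    have hr := mul_resolvent (h.stolzCurve_mem hω hϑ (abs_lt.2 ht))
    have hγ := hγ0 t
    set z := stolzCurve ϑ t
    set R := resolvent T z
    simp only [ContinuousLinearMap.mul_apply', mul_smul_comm]
    rw [mul_assoc, hr, mul_sub, mul_smul_comm, hr, mul_one]
    simp only [smul_sub, sub_smul, smul_smul]
    match_scalars <;> field_simp <;> ring
  rw [elementaryIntegral, key, intervalIntegral.integral_smul_const,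
    intervalIntegral.integral_smul_const, ContinuousLinearMap.intervalIntegral_comp_comm _ hint4,
    h.integral_exterior_eq_zero hω hϑ, intervalIntegral.integral_sub hint1 hint2,
    intervalIntegral.integral_sub hint3' hint1, intervalIntegral.integral_neg,
    integral_deriv_stolzCurve ϑ hϑ1, integral_deriv_inv_stolzCurve ϑ hϑ1,
    integral_deriv_stolzCurve_div hϑ1]
  have hpi : (2 * Real.pi * Complex.I : ℂ) ≠ 0 := Complex.two_pi_I_ne_zero
  rw [map_zero, add_zero, sub_zero, neg_zero, zero_sub, neg_smul, ← sub_eq_add_neg, ← smul_sub,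
    smul_smul, inv_mul_cancel₀ hpi, one_smul]

end Space

/-! ### Multiplicativity and independence of the path -/

section Space

variable {X : Type*} [NormedAddCommGroup X] [NormedSpace ℂ X]
variable {T : X →L[ℂ] X} {ω ν ϑ ϑ' : ℝ} {f e : ℂ → ℂ}

lemma elementaryIntegral_congr (hϑ : 1 < ϑ) {g : ℂ → ℂ}
    (h : ∀ t, |t| < stolzAngle ϑ → f (stolzCurve ϑ t) = g (stolzCurve ϑ t)) :
    elementaryIntegral T ϑ f = elementaryIntegral T ϑ g := by
  have ha := stolzAngle_pos hϑ
  unfold elementaryIntegral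
  congr 1
  refine intervalIntegral_congr_Ioo (by linarith) fun t ht => ?_
  rw [h t (abs_lt.2 ht)]

variable [CompleteSpace X]

/-- Multiplication by the resolvent at a point of a larger Stolz curve. -/
lemma IsRittOfType.elementaryIntegral_mul_resolvent (h : IsRittOfType T ω) (hω : 1 < ω)
    (hf : IsElementaryVia ω ν ϑ f) (hϑ' : ϑ < ϑ') (hν : ϑ' < ν) {t : ℝ}
    (ht : |t| < stolzAngle ϑ') :
    elementaryIntegral T ϑ f * resolvent T (stolzCurve ϑ' t) =
      elementaryIntegral T ϑ fun z => (stolzCurve ϑ' t - z)⁻¹ * f z := by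
  have h1 := hf.2.1
  have hϑ1 := hω.trans h1
  set l := stolzCurve ϑ' t with hl
  -- The point `l` lies in `stolz ν`, so `(l - z)⁻¹` is bounded holomorphic only on a smaller domain
  -- `stolz ν'` that still contains the curve of parameter `ϑ`, except for its vertex.
  set ν' := (ϑ + ϑ') / 2 with hν'
  have hν1 : ϑ < ν' := by rw [hν']; linarith
  have hν2 : ν' < ϑ' := by rw [hν']; linarith
  have hl0 : stolzGauge ϑ' l = 0 := stolzGauge_stolzCurve (hϑ1.trans hϑ') ht.le
  have hl1 : 0 < ‖1 - l‖ := norm_pos_iff.2 (sub_ne_zero.2 (stolzCurve_ne_one (hϑ1.trans hϑ') ht).symm)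
  have hsep (z : ℂ) (hz : z ∈ stolz ν') : ‖1 - l‖ ≤ (1 + ν') * ϑ' / (ϑ' - ν') * ‖l - z‖ :=
    norm_one_sub_le_norm_sub (by linarith) hν2
      ((mem_stolz_iff (hϑ1.trans hν1)).1 hz).le hl0
  set c := (1 + ν') * ϑ' / (ϑ' - ν') with hc
  have hc0 : 0 < c := div_pos (mul_pos (by linarith) (by linarith)) (by linarith)
  have hne (z : ℂ) (hz : z ∈ stolz ν') : l - z ≠ 0 := by
    intro h0
    have := hsep z hz
    rw [h0, norm_zero, mul_zero] at this
    linarith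
  have hg : IsHInfty (stolz ν') fun z => (l - z)⁻¹ := by
    refine ⟨DifferentiableOn.inv (by fun_prop) hne, c / ‖1 - l‖, fun z hz => ?_⟩
    rw [norm_inv, inv_le_comm₀ (norm_pos_iff.2 (hne z hz)) (by positivity), inv_div,
      div_le_iff₀ hc0, mul_comm]
    exact hsep z hz
  have hfν := hf.mono hω hν1 (hν2.le.trans hν.le)
  have hgf := hfν.mul hω hg
  -- Multiplying by the polynomial `l - z` recovers `f`; the factor `l - T` is then cancelled by the
  -- resolvent.
  have hp := h.aeval_mul_elementaryIntegral hω hgf (Polynomial.C l - Polynomial.X)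
  have hcongr : elementaryIntegral T ϑ (fun z => (Polynomial.C l - Polynomial.X).eval z *
      ((l - z)⁻¹ * f z)) = elementaryIntegral T ϑ f := by
    refine elementaryIntegral_congr hϑ1 fun s hs => ?_
    have := hne _ (stolzCurve_mem_stolz hϑ1 hν1 hs)
    simp only [Polynomial.eval_sub, Polynomial.eval_C, Polynomial.eval_X]
    rw [mul_inv_cancel_left₀ this]
  rw [hcongr, map_sub, Polynomial.aeval_C, Polynomial.aeval_X] at hp
  have hcomm := h.commute_elementaryIntegral hω hgf
  have hmem : l ∈ resolventSet ℂ T := h.stolzCurve_mem hω (h1.trans hϑ') ht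
  have hcomm2 : Commute (algebraMap ℂ (X →L[ℂ] X) l - T)
      (elementaryIntegral T ϑ fun z => (l - z)⁻¹ * f z) :=
    (Algebra.commute_algebraMap_left l _).sub_left hcomm
  rw [← hp, hcomm2.eq, mul_assoc, resolvent, Ring.mul_inverse_cancel _ hmem, mul_one]

/-- The elementary calculus is multiplicative. -/
theorem IsRittOfType.elementaryIntegral_mul_elementaryIntegral (h : IsRittOfType T ω) (hω : 1 < ω)
    (hf : IsElementaryVia ω ν ϑ f) (he : IsElementaryVia ω ν ϑ' e) (hϑ' : ϑ < ϑ') :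
    elementaryIntegral T ϑ f * elementaryIntegral T ϑ' e =
      elementaryIntegral T ϑ fun z => f z * e z := by
  have h1 := hf.2.1
  have h2 := he.2.2.1
  have hϑ1 := hω.trans h1
  have hϑ1' := hϑ1.trans hϑ'
  have ha := stolzAngle_pos hϑ1
  have ha' := stolzAngle_pos hϑ1'
  set c : ℂ := (2 * Real.pi * Complex.I : ℂ)⁻¹ with hc
  set μ := (volume : Measure ℝ).restrict (Set.Ioo (-stolzAngle ϑ) (stolzAngle ϑ)) with hμ
  set μ' := (volume : Measure ℝ).restrict (Set.Ioo (-stolzAngle ϑ') (stolzAngle ϑ')) with hμ'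
  set F : ℝ → X →L[ℂ] X := fun t => (f (stolzCurve ϑ t) * deriv (stolzCurve ϑ) t) •
    resolvent T (stolzCurve ϑ t) with hF
  set G : ℝ → ℂ := fun t => e (stolzCurve ϑ' t) / (1 - stolzCurve ϑ' t) * deriv (stolzCurve ϑ') t
    with hG
  set q : ℝ → ℝ → ℂ := fun t s =>
    deriv (stolzCurve ϑ') t * (e (stolzCurve ϑ' t) / (stolzCurve ϑ' t - stolzCurve ϑ s)) with hq
  have hFint : Integrable F μ := by
    have := h.intervalIntegrable hω hf
    rwa [intervalIntegrable_iff_integrableOn_Ioo_of_le (by linarith)] at this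
  have hGint : Integrable G μ' := by
    have := he.2.2.2
    rwa [intervalIntegrable_iff_integrableOn_Ioo_of_le (by linarith)] at this
  have hne (t : ℝ) (ht : t ∈ Set.Ioo (-stolzAngle ϑ') (stolzAngle ϑ')) (s : ℝ)
      (hs : s ∈ Set.Ioo (-stolzAngle ϑ) (stolzAngle ϑ)) :
      stolzCurve ϑ' t - stolzCurve ϑ s ≠ 0 ∧ ‖(1 - stolzCurve ϑ' t) /
        (stolzCurve ϑ' t - stolzCurve ϑ s)‖ ≤ (1 + ϑ) * ϑ' / (ϑ' - ϑ) := by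
    have h3 := norm_one_sub_le_norm_sub (by linarith) hϑ'
      (stolzGauge_stolzCurve hϑ1 (abs_lt.2 hs).le).le
      (stolzGauge_stolzCurve hϑ1' (abs_lt.2 ht).le)
    have h4 : stolzCurve ϑ' t - stolzCurve ϑ s ≠ 0 :=
      stolzCurve_sub_ne_zero hϑ1' (stolzCurve_mem_stolz hϑ1 hϑ' (abs_lt.2 hs)) (abs_lt.2 ht).le
    refine ⟨h4, ?_⟩
    rw [norm_div, div_le_iff₀ (norm_pos_iff.2 h4)]
    exact h3
  -- The Cauchy kernel is unbounded where both curves meet at the vertex. Written as `(1 - l)⁻¹`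
  -- times `(1 - l) / (l - z)`, it has a second factor bounded by the separation of the two curves,
  -- and the first is absorbed by elementarity of `e`.
  have hK : Integrable (Function.uncurry fun t s => q t s • F s) (μ'.prod μ) := by
    have h3 := hGint.smul_prod hFint
    have h4 := h3.bdd_smul (φ := fun p : ℝ × ℝ => (1 - stolzCurve ϑ' p.1) /
        (stolzCurve ϑ' p.1 - stolzCurve ϑ p.2)) ((1 + ϑ) * ϑ' / (ϑ' - ϑ)) ?_ ?_
    · refine h4.congr ?_
      rw [hμ, hμ', Measure.prod_restrict]
      refine (ae_restrict_iff' (measurableSet_Ioo.prod measurableSet_Ioo)).2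
        (Eventually.of_forall fun p hp => ?_)
      have h5 := (hne p.1 hp.1 p.2 hp.2).1
      have h6 : 1 - stolzCurve ϑ' p.1 ≠ 0 :=
        sub_ne_zero.2 (stolzCurve_ne_one hϑ1' (abs_lt.2 hp.1)).symm
      simp only [Pi.smul_apply', Function.uncurry, smul_smul, hG, hq]
      congr 1
      field_simp
    · rw [hμ, hμ', Measure.prod_restrict]
      refine ContinuousOn.aestronglyMeasurable ?_ (measurableSet_Ioo.prod measurableSet_Ioo)
      refine ContinuousOn.div ?_ ?_ fun p hp => (hne p.1 hp.1 p.2 hp.2).1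
      · exact (continuous_const.sub ((continuous_stolzCurve ϑ').comp continuous_fst)).continuousOn
      · exact (((continuous_stolzCurve ϑ').comp continuous_fst).sub
          ((continuous_stolzCurve ϑ).comp continuous_snd)).continuousOn
    · rw [hμ, hμ', Measure.prod_restrict]
      exact (ae_restrict_iff' (measurableSet_Ioo.prod measurableSet_Ioo)).2
        (Eventually.of_forall fun p hp => (hne p.1 hp.1 p.2 hp.2).2)
  have hswap := integral_integral_swap hK
  have hleft : elementaryIntegral T ϑ f * elementaryIntegral T ϑ' e =
      c • c • ∫ t, ∫ s, q t s • F s ∂μ ∂μ' := by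
    rw [h.mul_elementaryIntegral hω he, ← hc]
    congr 1
    rw [← integral_smul, intervalIntegral.integral_of_le (by linarith), integral_Ioc_eq_integral_Ioo]
    refine setIntegral_congr_fun measurableSet_Ioo fun t ht => ?_
    rw [h.elementaryIntegral_mul_resolvent hω hf hϑ' h2 (abs_lt.2 ht), elementaryIntegral,
      smul_comm, ← hc]
    congr 1
    rw [intervalIntegral.integral_of_le (by linarith), integral_Ioc_eq_integral_Ioo,
      ← integral_smul]
    refine setIntegral_congr_fun measurableSet_Ioo fun s hs => ?_
    simp only [hq, hF, smul_smul]
    congr 1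
    have := (hne t ht s hs).1
    field_simp
  have hright : elementaryIntegral T ϑ (fun z => f z * e z) =
      c • c • ∫ s, ∫ t, q t s • F s ∂μ' ∂μ := by
    rw [elementaryIntegral, ← hc]
    congr 1
    rw [← integral_smul, intervalIntegral.integral_of_le (by linarith), integral_Ioc_eq_integral_Ioo]
    refine setIntegral_congr_fun measurableSet_Ioo fun s hs => ?_
    have h3 := integral_deriv_stolzCurve_mul_div_sub hϑ1' h2 he.1
      (stolzCurve_mem_stolz hϑ1 hϑ' (abs_lt.2 hs))
    rw [intervalIntegral.integral_of_le (by linarith), integral_Ioc_eq_integral_Ioo] at h3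
    rw [integral_smul_const, h3, smul_smul, hc, inv_mul_cancel_left₀ Complex.two_pi_I_ne_zero,
      hF, smul_smul]
    congr 1
    ring
  rw [hleft, hright, hswap]

lemma IsRittOfType.one_sub_mul_elementaryIntegral (h : IsRittOfType T ω) (hω : 1 < ω)
    (hf : IsElementaryVia ω ν ϑ f) :
    (1 - T) * elementaryIntegral T ϑ f = elementaryIntegral T ϑ fun z => (1 - z) * f z := by
  have := h.aeval_mul_elementaryIntegral hω hf (1 - Polynomial.X)
  rw [map_sub, map_one, Polynomial.aeval_X] at this
  simpa only [Polynomial.eval_sub, Polynomial.eval_one, Polynomial.eval_X] using this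

/-- Both sides represent `((1 - z)² f)(T)` on the inner path: on the left by multiplication with a
polynomial, on the right by writing `1 - T` as an integral over the inner path and using
multiplicativity. No contour has to be deformed near the vertex. -/
lemma IsRittOfType.one_sub_mul_eq_of_lt (h : IsRittOfType T ω) (hω : 1 < ω)
    (hf : IsHInfty (stolz ν) f) (h1 : ω < ϑ) (h2 : ϑ < ϑ') (h3 : ϑ' < ν) :
    (1 - T) * elementaryIntegral T ϑ (fun z => (1 - z) * f z) =
      (1 - T) * elementaryIntegral T ϑ' (fun z => (1 - z) * f z) := by
  have he := isElementaryVia_one_sub hω h1 (h2.trans h3)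
  have hfe := hf.isElementaryVia_one_sub_mul hω h1 (h2.trans h3)
  have hfe' := hf.isElementaryVia_one_sub_mul hω (h1.trans h2) h3
  rw [h.one_sub_mul_elementaryIntegral hω hfe, ← h.elementaryIntegral_one_sub hω h1,
    h.elementaryIntegral_mul_elementaryIntegral hω he hfe' h2]

/-- Path independence of the elementary calculus. -/
lemma IsRittOfType.one_sub_mul_eq (h : IsRittOfType T ω) (hω : 1 < ω)
    (hf : IsHInfty (stolz ν) f) (h1 : ω < ϑ) (h2 : ϑ < ν) (h1' : ω < ϑ') (h2' : ϑ' < ν) :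
    (1 - T) * elementaryIntegral T ϑ (fun z => (1 - z) * f z) =
      (1 - T) * elementaryIntegral T ϑ' (fun z => (1 - z) * f z) := by
  rcases lt_trichotomy ϑ ϑ' with hlt | rfl | hlt
  · exact h.one_sub_mul_eq_of_lt hω hf h1 hlt h2'
  · rfl
  · exact (h.one_sub_mul_eq_of_lt hω hf h1' hlt h2).symm

/-- Boundedly pointwise convergent polynomials give convergence of the elementary calculus. -/
lemma IsRittOfType.tendsto_aeval_mul_elementaryIntegral (h : IsRittOfType T ω) (hω : 1 < ω)
    (hf : IsElementaryVia ω ν ϑ f) {p : ℕ → Polynomial ℂ} {K : ℝ}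
    (hK : ∀ n t, |t| < stolzAngle ϑ → ‖(p n).eval (stolzCurve ϑ t)‖ ≤ K)
    (hlim : ∀ t, |t| < stolzAngle ϑ →
      Tendsto (fun n => (p n).eval (stolzCurve ϑ t)) atTop (𝓝 1)) :
    Tendsto (fun n => Polynomial.aeval T (p n) * elementaryIntegral T ϑ f) atTop
      (𝓝 (elementaryIntegral T ϑ f)) := by
  have h1 := hf.2.1
  have hϑ1 := hω.trans h1
  have ha := stolzAngle_pos hϑ1
  simp only [h.aeval_mul_elementaryIntegral hω hf]
  unfold elementaryIntegral
  refine Tendsto.const_smul ?_ _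
  have hint := h.intervalIntegrable hω hf
  simp only [intervalIntegral.integral_of_le (by linarith : -stolzAngle ϑ ≤ stolzAngle ϑ),
    integral_Ioc_eq_integral_Ioo]
  rw [intervalIntegrable_iff_integrableOn_Ioo_of_le (by linarith)] at hint
  refine tendsto_integral_of_dominated_convergence (fun t => K *
    ‖(f (stolzCurve ϑ t) * deriv (stolzCurve ϑ) t) • resolvent T (stolzCurve ϑ t)‖)
    (fun n => ?_) (hint.norm.const_mul K) (fun n => ?_) ?_
  · have := h.intervalIntegrable hω (hf.mul hω
      (isHInfty_stolz_of_differentiable (p n).differentiable))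
    rw [intervalIntegrable_iff_integrableOn_Ioo_of_le (by linarith)] at this
    exact this.1
  · refine (ae_restrict_iff' measurableSet_Ioo).2 (Eventually.of_forall fun t ht => ?_)
    rw [mul_assoc, mul_smul, norm_smul]
    exact mul_le_mul_of_nonneg_right (hK n t (abs_lt.2 ht)) (norm_nonneg _)
  · refine (ae_restrict_iff' measurableSet_Ioo).2 (Eventually.of_forall fun t ht => ?_)
    have := (hlim t (abs_lt.2 ht)).smul_const
      ((f (stolzCurve ϑ t) * deriv (stolzCurve ϑ) t) • resolvent T (stolzCurve ϑ t))
    simpa only [one_smul, smul_smul, one_mul, mul_assoc] using this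

end Space

/-! ### R-boundedness of the middle factor -/

lemma exists_integral_norm_stolzCurve_pow_le {ϑ : ℝ} (hϑ : 1 < ϑ) :
    ∃ L, 0 < L ∧ ∀ k : ℕ,
      ∫ t in (-stolzAngle ϑ)..(stolzAngle ϑ), ((k : ℝ) + 1) * ‖stolzCurve ϑ t‖ ^ k ≤ L := by
  set a := stolzAngle ϑ with ha_def
  have ha := stolzAngle_pos hϑ
  rw [← ha_def] at ha
  set c := stolzRadius ϑ 0 / ϑ with hc
  have hc0 : 0 < c := div_pos (stolzRadius_zero_pos hϑ) (by linarith)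
  have hc1 : c < 1 := by
    have := norm_stolzCurve_pos hϑ 0
    rw [norm_stolzCurve hϑ] at this
    linarith
  have hle (t : ℝ) (ht : |t| ≤ a) : ‖stolzCurve ϑ t‖ ≤ 1 - c * (1 - |t| / a) := by
    rw [norm_stolzCurve hϑ, hc]
    have h1 := div_le_div_of_nonneg_right (stolzRadius_ge hϑ ht) (by linarith : 0 ≤ ϑ)
    rw [mul_div_right_comm] at h1
    linarith
  refine ⟨2 * (a / c), by positivity, fun k => ?_⟩
  have hcont : Continuous fun t => ((k : ℝ) + 1) * ‖stolzCurve ϑ t‖ ^ k :=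
    continuous_const.mul ((continuous_stolzCurve ϑ).norm.pow k)
  -- The modulus of the curve is at most `1 - c (1 - |t| / a)`, whose powers have explicit
  -- primitives; `σ = a` and `σ = -a` serve the two halves. Each half contributes at most `a / c`,
  -- independently of `k`.
  have hside (σ : ℝ) (hσ : σ ≠ 0) (x y : ℝ) :
      ∫ t in x..y, ((k : ℝ) + 1) * (1 - c * (1 - t / σ)) ^ k =
        σ / c * (1 - c * (1 - y / σ)) ^ (k + 1) - σ / c * (1 - c * (1 - x / σ)) ^ (k + 1) := by
    have hc : Continuous fun t : ℝ => ((k : ℝ) + 1) * (1 - c * (1 - t / σ)) ^ k := by fun_prop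
    refine intervalIntegral.integral_eq_sub_of_hasDerivAt
      (f := fun t => σ / c * (1 - c * (1 - t / σ)) ^ (k + 1)) (fun t _ => ?_)
      (hc.intervalIntegrable _ _)
    have h1 : HasDerivAt (fun t : ℝ => 1 - c * (1 - t / σ)) (c / σ) t := by
      have := ((((hasDerivAt_id t).div_const σ).const_sub 1).const_mul c).const_sub 1
      refine this.congr_deriv ?_
      field_simp
    refine ((h1.pow (k + 1)).const_mul (σ / c)).congr_deriv ?_
    push_cast
    field_simp
  have hpow : (1 - c) ^ (k + 1) ≥ 0 := pow_nonneg (by linarith) _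
  rw [← intervalIntegral.integral_add_adjacent_intervals (b := 0)
    (hcont.intervalIntegrable _ _) (hcont.intervalIntegrable _ _)]
  have hr : ∫ t in (0 : ℝ)..a, ((k : ℝ) + 1) * ‖stolzCurve ϑ t‖ ^ k ≤ a / c := by
    calc _ ≤ ∫ t in (0 : ℝ)..a, ((k : ℝ) + 1) * (1 - c * (1 - t / a)) ^ k := by
          refine intervalIntegral.integral_mono_on ha.le (hcont.intervalIntegrable _ _)
            (Continuous.intervalIntegrable (by fun_prop) _ _) fun t ht => ?_
          have := hle t (abs_le.2 ⟨by linarith [ht.1], ht.2⟩)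
          rw [abs_of_nonneg ht.1] at this
          gcongr
      _ ≤ _ := by
          rw [hside a ha.ne', div_self ha.ne']
          simp only [zero_div, sub_zero, mul_one, sub_self, mul_zero, one_pow]
          have : 0 ≤ a / c * (1 - c) ^ (k + 1) := by positivity
          linarith
  have hl : ∫ t in (-a)..0, ((k : ℝ) + 1) * ‖stolzCurve ϑ t‖ ^ k ≤ a / c := by
    calc _ ≤ ∫ t in (-a)..0, ((k : ℝ) + 1) * (1 - c * (1 - t / (-a))) ^ k := by
          refine intervalIntegral.integral_mono_on (by linarith) (hcont.intervalIntegrable _ _)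
            (Continuous.intervalIntegrable (by fun_prop) _ _) fun t ht => ?_
          have := hle t (abs_le.2 ⟨ht.1, by linarith [ht.2]⟩)
          rw [abs_of_nonpos ht.2, neg_div] at this
          rw [div_neg]
          gcongr
      _ ≤ _ := by
          rw [hside (-a) (neg_ne_zero.2 ha.ne'), div_self (neg_ne_zero.2 ha.ne')]
          simp only [zero_div, sub_zero, mul_one, sub_self, mul_zero, one_pow, neg_div]
          have : 0 ≤ a / c * (1 - c) ^ (k + 1) := by positivity
          linarith
  linarith

section Space

variable {X : Type*} [NormedAddCommGroup X] [NormedSpace ℂ X] [CompleteSpace X]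
variable {T : X →L[ℂ] X} {ω ν ϑ : ℝ} {f : ℂ → ℂ}

/-- The operators `(k + 1) T^k (1 - T) f(T)` are R-bounded, with constant controlled by the
supremum norm of `f`. -/
lemma IsRRittOfType.exists_isRBoundedBy (h : IsRRittOfType T ω) (hω : 1 < ω) (h1 : ω < ϑ)
    (h2 : ϑ < ν) : ∃ C, 0 ≤ C ∧ ∀ (f : ℂ → ℂ) (M : ℝ), IsHInfty (stolz ν) f → 0 < M →
      (∀ z ∈ stolz ν, ‖f z‖ ≤ M) →
      IsRBoundedBy (C * M) {S | ∃ (k : ℕ) (b : ℝ), |b| ≤ 1 ∧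
        S = ((b * ((k : ℝ) + 1) : ℝ) : ℂ) • (T ^ k *
          elementaryIntegral T ϑ fun z => (1 - z) * f z)} := by
  have hR := h.isRittOfType
  have hϑ := hω.trans h1
  have ha := stolzAngle_pos hϑ
  set θ := (ω + ϑ) / 2 with hθ
  have hωθ : ω < θ := by rw [hθ]; linarith
  have hθϑ : θ < ϑ := by rw [hθ]; linarith
  obtain ⟨C, hC, hb⟩ := (h.2.2 θ hωθ).exists_isRBoundedBy
  obtain ⟨K, hK0, hK⟩ := exists_norm_deriv_stolzCurve_le ϑ
  obtain ⟨L, hL0, hL⟩ := exists_integral_norm_stolzCurve_pow_le hϑ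
  set c : ℂ := (2 * Real.pi * Complex.I : ℂ)⁻¹ with hc
  have hc0 : 0 < ‖c‖ := norm_pos_iff.2 (inv_ne_zero Complex.two_pi_I_ne_zero)
  refine ⟨2 * (‖c‖ * K * L) * C, by positivity, fun f M hf hM hfM => ?_⟩
  set A : ℝ → X →L[ℂ] X := fun t => (stolzCurve ϑ t - 1) • resolvent T (stolzCurve ϑ t) with hA
  have hmem (t : ℝ) (ht : |t| < stolzAngle ϑ) :
      A t ∈ {A : X →L[ℂ] X | ∃ l : ℂ, l ∉ closure (stolz θ) ∧ A = (l - 1) • resolvent T l} :=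
    ⟨_, stolzCurve_notMem_closure (hω.trans hωθ) hθϑ ht, rfl⟩
  have hbd := hb.integral (μ := volume.restrict (Set.Ioo (-stolzAngle ϑ) (stolzAngle ϑ)))
    (A := A) (K := C) (L := ‖c‖ * K * L * M)
    ((ae_restrict_iff' measurableSet_Ioo).2
      (Eventually.of_forall fun t ht => hmem t (abs_lt.2 ht)))
    ((((continuous_stolzCurve ϑ).sub continuous_const).continuousOn.smul
      (hR.continuousOn_resolvent hω h1)).aestronglyMeasurable measurableSet_Ioo)
    ((ae_restrict_iff' measurableSet_Ioo).2
      (Eventually.of_forall fun t ht => hb.norm_le hC (hmem t (abs_lt.2 ht))))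
    ⟨_, hmem 0 (by simpa using ha)⟩ (by positivity)
  have hsub : {S | ∃ (k : ℕ) (b : ℝ), |b| ≤ 1 ∧
        S = ((b * ((k : ℝ) + 1) : ℝ) : ℂ) • (T ^ k *
          elementaryIntegral T ϑ fun z => (1 - z) * f z)} ⊆
      {S | ∃ h : ℝ → ℂ,
        Integrable h (volume.restrict (Set.Ioo (-stolzAngle ϑ) (stolzAngle ϑ))) ∧
        ∫ t, ‖h t‖ ∂(volume.restrict (Set.Ioo (-stolzAngle ϑ) (stolzAngle ϑ))) ≤ ‖c‖ * K * L * M ∧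
        S = ∫ t, h t • A t ∂(volume.restrict (Set.Ioo (-stolzAngle ϑ) (stolzAngle ϑ)))} := by
    rintro S ⟨k, b, hb1, rfl⟩
    -- The factor `1 - z` of the integrand goes into the R-bounded family, which carries `z - 1`;
    -- hence the sign. The rest has `L¹`-norm bounded uniformly in `k`.
    set w : ℝ → ℂ := fun t => -(c * ((b * ((k : ℝ) + 1) : ℝ) : ℂ) * stolzCurve ϑ t ^ k *
      f (stolzCurve ϑ t) * deriv (stolzCurve ϑ) t) with hw
    have hwn (t : ℝ) (ht : t ∈ Set.Ioo (-stolzAngle ϑ) (stolzAngle ϑ)) :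
        ‖w t‖ ≤ ‖c‖ * K * M * (((k : ℝ) + 1) * ‖stolzCurve ϑ t‖ ^ k) := by
      have h3 := hfM _ (stolzCurve_mem_stolz hϑ h2 (abs_lt.2 ht))
      have h4 := hK t (abs_lt.2 ht).le
      rw [hw]
      simp only [norm_neg, norm_mul, norm_pow, Complex.norm_real, Real.norm_eq_abs]
      rw [abs_of_nonneg (by positivity : (0 : ℝ) ≤ (k : ℝ) + 1)]
      calc ‖c‖ * (|b| * ((k : ℝ) + 1)) * ‖stolzCurve ϑ t‖ ^ k * ‖f (stolzCurve ϑ t)‖ *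
            ‖deriv (stolzCurve ϑ) t‖
          ≤ ‖c‖ * (1 * ((k : ℝ) + 1)) * ‖stolzCurve ϑ t‖ ^ k * M * K := by gcongr
        _ = _ := by ring
    have hwc : ContinuousOn w (Set.Ioo (-stolzAngle ϑ) (stolzAngle ϑ)) :=
      ((((continuous_const.mul ((continuous_stolzCurve ϑ).pow k)).continuousOn.mul
        (hf.continuousOn_comp_stolzCurve hϑ h2)).mul
        (continuous_deriv_stolzCurve ϑ).continuousOn)).neg
    have hbi : IntegrableOn (fun t => ‖c‖ * K * M * (((k : ℝ) + 1) * ‖stolzCurve ϑ t‖ ^ k))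
        (Set.Ioo (-stolzAngle ϑ) (stolzAngle ϑ)) := by
      rw [← intervalIntegrable_iff_integrableOn_Ioo_of_le (by linarith)]
      exact (continuous_const.mul (continuous_const.mul
        ((continuous_stolzCurve ϑ).norm.pow k))).intervalIntegrable _ _
    have hwi : IntegrableOn w (Set.Ioo (-stolzAngle ϑ) (stolzAngle ϑ)) :=
      hbi.mono' (hwc.aestronglyMeasurable measurableSet_Ioo)
        ((ae_restrict_iff' measurableSet_Ioo).2 (Eventually.of_forall hwn))
    refine ⟨w, hwi, ?_, ?_⟩
    · calc _ ≤ ∫ t in Set.Ioo (-stolzAngle ϑ) (stolzAngle ϑ),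
            ‖c‖ * K * M * (((k : ℝ) + 1) * ‖stolzCurve ϑ t‖ ^ k) :=
          setIntegral_mono_on hwi.norm hbi measurableSet_Ioo hwn
        _ ≤ ‖c‖ * K * M * L := by
          rw [integral_const_mul, ← integral_Ioc_eq_integral_Ioo,
            ← intervalIntegral.integral_of_le (by linarith)]
          exact mul_le_mul_of_nonneg_left (hL k) (by positivity)
        _ = _ := by ring
    · have hel := hf.isElementaryVia_one_sub_mul hω h1 h2
      have h3 := hR.aeval_mul_elementaryIntegral hω hel (Polynomial.X ^ k)
      rw [map_pow, Polynomial.aeval_X] at h3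
      rw [h3, elementaryIntegral, ← hc, smul_smul,
        intervalIntegral.integral_of_le (by linarith), integral_Ioc_eq_integral_Ioo,
        ← integral_smul]
      congr 1
      ext1 t
      simp only [hw, hA, smul_smul, Polynomial.eval_pow, Polynomial.eval_X]
      congr 1
      ring
  have h5 : 2 * (‖c‖ * K * L * M) * C = 2 * (‖c‖ * K * L) * C * M := by ring
  rw [h5] at hbd
  exact fun N S x hS => hbd N S x fun n => hsub (hS n)

/-! ### The reproducing formula -/

omit [CompleteSpace X] in
lemma commute_aeval {F : X →L[ℂ] X} (h : Commute T F) (p : Polynomial ℂ) :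
    Commute (Polynomial.aeval T p) F := by
  induction p using Polynomial.induction_on' with
  | add p q hp hq => rw [map_add]; exact hp.add_left hq
  | monomial n a =>
    rw [Polynomial.aeval_monomial]
    exact (Algebra.commute_algebraMap_left a F).mul_left (h.pow_left n)

/-- The polynomials `binom(k + M, M) z^(3k) (1 - z)^M (1 + z + z²)^(M + 1)`. -/
def blockPoly (M k : ℕ) : Polynomial ℂ :=
  Polynomial.C (((k + M).choose M : ℕ) : ℂ) * (Polynomial.X ^ (3 * k) * (1 - Polynomial.X) ^ M *
    (1 + Polynomial.X + Polynomial.X ^ 2) ^ (M + 1))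

/-- The partial sums of the reproducing formula. -/
def reproPoly (M n : ℕ) : Polynomial ℂ :=
  ∑ k ∈ Finset.range n, blockPoly M k * (1 - Polynomial.X)

/-- These are partial sums of the negative binomial series for `(1 - z ^ 3) ^ (-(M + 1))`,
multiplied by `(1 - z ^ 3) ^ (M + 1)`, which is why they tend to one in the disc. -/
lemma eval_reproPoly (M n : ℕ) (z : ℂ) : (reproPoly M n).eval z =
    (∑ k ∈ Finset.range n, (((k + M).choose M : ℕ) : ℂ) * (z ^ 3) ^ k) * (1 - z ^ 3) ^ (M + 1) := by
  rw [reproPoly, Polynomial.eval_finsetSum, Finset.sum_mul]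
  refine Finset.sum_congr rfl fun k _ => ?_
  simp only [blockPoly, Polynomial.eval_mul, Polynomial.eval_C, Polynomial.eval_pow,
    Polynomial.eval_X, Polynomial.eval_sub, Polynomial.eval_one, Polynomial.eval_add]
  rw [show 1 - z ^ 3 = (1 - z) * (1 + z + z ^ 2) by ring, mul_pow, pow_succ (1 - z), ← pow_mul]
  ring

lemma tendsto_eval_reproPoly (M : ℕ) {z : ℂ} (hz : ‖z‖ < 1) :
    Tendsto (fun n => (reproPoly M n).eval z) atTop (𝓝 1) := by
  have hz3 : ‖z ^ 3‖ < 1 := by rw [norm_pow]; exact pow_lt_one₀ (norm_nonneg _) hz (by norm_num)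
  have h := (hasSum_choose_mul_geometric_of_norm_lt_one M hz3).tendsto_sum_nat.mul_const
    ((1 - z ^ 3) ^ (M + 1))
  have hne : (1 - z ^ 3) ^ (M + 1) ≠ 0 := by
    refine pow_ne_zero _ (sub_ne_zero.2 fun h1 => ?_)
    rw [← h1, norm_one] at hz3
    exact lt_irrefl _ hz3
  rw [one_div_mul_cancel hne] at h
  simpa only [eval_reproPoly] using h

/-- The coefficients are positive, so the partial sums are at most `(1 - ‖z‖ ^ 3) ^ (-(M + 1))`, and
`‖1 - z ^ 3‖` is comparable to `1 - ‖z‖ ^ 3` in a Stolz domain. The bound is uniform in `n`, as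
dominated convergence requires. -/
lemma norm_eval_reproPoly_le {ϑ : ℝ} (M n : ℕ) {z : ℂ} (hz : ‖z‖ < 1)
    (hzϑ : stolzGauge ϑ z ≤ 0) : ‖(reproPoly M n).eval z‖ ≤ (3 * ϑ) ^ (M + 1) := by
  have hz3 : ‖z‖ ^ 3 < 1 := pow_lt_one₀ (norm_nonneg _) hz (by norm_num)
  have h0 := norm_nonneg z
  have h1 : ‖∑ k ∈ Finset.range n, (((k + M).choose M : ℕ) : ℂ) * (z ^ 3) ^ k‖ ≤
      1 / (1 - ‖z‖ ^ 3) ^ (M + 1) := by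
    have hs := hasSum_choose_mul_geometric_of_norm_lt_one M (r := ‖z‖ ^ 3)
      (by rwa [Real.norm_of_nonneg (by positivity)])
    refine (norm_sum_le _ _).trans ?_
    rw [← hs.tsum_eq]
    refine le_trans (le_of_eq ?_)
      (hs.summable.sum_le_tsum (Finset.range n) fun k _ => by positivity)
    refine Finset.sum_congr rfl fun k _ => ?_
    simp
  have h2 : ‖1 - z ^ 3‖ ≤ 3 * ϑ * (1 - ‖z‖ ^ 3) := by
    have h3 : ‖1 - z‖ ≤ ϑ * (1 - ‖z‖) := by unfold stolzGauge at hzϑ; linarith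
    have h4 : ‖1 + z + z ^ 2‖ ≤ 3 := by
      refine (norm_add_le _ _).trans ?_
      have := norm_add_le 1 z
      rw [norm_one] at this
      rw [norm_pow]
      nlinarith
    have h5 : 0 ≤ ϑ * (1 - ‖z‖) := (norm_nonneg _).trans h3
    have hϑ : 0 ≤ ϑ := nonneg_of_mul_nonneg_left h5 (by linarith)
    calc ‖1 - z ^ 3‖ = ‖1 - z‖ * ‖1 + z + z ^ 2‖ := by rw [← norm_mul]; congr 1; ring
      _ ≤ ϑ * (1 - ‖z‖) * 3 := mul_le_mul h3 h4 (norm_nonneg _) h5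
      _ ≤ _ := by
        have : 1 - ‖z‖ ≤ 1 - ‖z‖ ^ 3 := by
          have := pow_le_of_le_one h0 hz.le (n := 3) (by norm_num)
          linarith
        nlinarith
  rw [eval_reproPoly, norm_mul, norm_pow]
  have h6 : 0 < 1 - ‖z‖ ^ 3 := by linarith
  calc _ ≤ 1 / (1 - ‖z‖ ^ 3) ^ (M + 1) * (3 * ϑ * (1 - ‖z‖ ^ 3)) ^ (M + 1) := by gcongr
    _ = (3 * ϑ) ^ (M + 1) := by
      rw [mul_pow (3 * ϑ)]
      field_simp

omit [CompleteSpace X] in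
/-- The block operators sum up to the reproducing polynomials. -/
lemma sum_aeval_blockPoly_mul {M : ℕ} (hM : 1 ≤ M) {F A : X →L[ℂ] X}
    (h : (1 - T) * F = (1 - T) * ((1 - T) * A)) (n : ℕ) :
    ∑ k ∈ Finset.range n, Polynomial.aeval T (blockPoly M k) * F =
      Polynomial.aeval T (reproPoly M n) * A := by
  rw [reproPoly, map_sum, Finset.sum_mul]
  refine Finset.sum_congr rfl fun k _ => ?_
  -- As `M ≥ 1`, a factor `1 - T` can be split off each block, and the hypothesis is needed only
  -- after multiplication by it.
  obtain ⟨j, rfl⟩ := Nat.exists_eq_add_of_le hM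
  obtain ⟨q, h1⟩ : ∃ q, blockPoly (1 + j) k = q * (1 - Polynomial.X) :=
    ⟨Polynomial.C (((k + (1 + j)).choose (1 + j) : ℕ) : ℂ) *
      (Polynomial.X ^ (3 * k) * (1 - Polynomial.X) ^ j *
        (1 + Polynomial.X + Polynomial.X ^ 2) ^ (1 + j + 1)), by rw [blockPoly]; ring⟩
  have h2 : Polynomial.aeval T (1 - Polynomial.X : Polynomial ℂ) = 1 - T := by
    rw [map_sub, map_one, Polynomial.aeval_X]
  rw [h1, map_mul, map_mul, map_mul, h2, mul_assoc, h, mul_assoc, mul_assoc]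

lemma IsRittOfType.tendsto_sum_aeval_blockPoly (h : IsRittOfType T ω) (hω : 1 < ω)
    (hf : IsElementaryVia ω ν ϑ f) {M : ℕ} (hM : 1 ≤ M) {F : X →L[ℂ] X}
    (hF : (1 - T) * F = (1 - T) * ((1 - T) * elementaryIntegral T ϑ f)) (x : X) :
    Tendsto (fun n => ∑ k ∈ Finset.range n, Polynomial.aeval T (blockPoly M k) (F x)) atTop
      (𝓝 (elementaryIntegral T ϑ f x)) := by
  have hϑ := hω.trans hf.2.1
  have h1 := h.tendsto_aeval_mul_elementaryIntegral hω hf (p := reproPoly M)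
    (K := (3 * ν) ^ (M + 1))
    (fun n t ht => by
      have hm := stolzCurve_mem_stolz hϑ hf.2.2.1 ht
      exact norm_eval_reproPoly_le M n hm.1 ((mem_stolz_iff (hϑ.trans hf.2.2.1)).1 hm).le)
    (fun t ht => tendsto_eval_reproPoly M (stolzCurve_mem_stolz hϑ hf.2.2.1 ht).1)
  have h2 := ((ContinuousLinearMap.apply ℂ X x).continuous.tendsto _).comp h1
  refine h2.congr fun n => ?_
  simp only [Function.comp_apply]
  rw [← sum_aeval_blockPoly_mul hM hF]
  simp

/-- The binomial coefficient grows no faster than the product of the weights in the two square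
functions and the middle factor. -/
lemma choose_add_le_pow (k M : ℕ) : (k + M).choose M ≤ (k + 1) ^ M := by
  induction M with
  | zero => simp
  | succ M ih =>
    have h1 := Nat.add_one_mul_choose_eq (k + M) M
    have h2 : (k + M + 1) ≤ (k + 1) * (M + 1) := by nlinarith
    refine Nat.le_of_mul_le_mul_right ?_ (Nat.succ_pos M)
    calc (k + (M + 1)).choose (M + 1) * (M + 1) = (k + M + 1) * (k + M).choose M := h1.symm
      _ ≤ (k + 1) * (M + 1) * (k + 1) ^ M := Nat.mul_le_mul h2 ih
      _ = (k + 1) ^ (M + 1) * (M + 1) := by ring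

omit [CompleteSpace X] in
/-- The block operators factor through the operators of the two square functions. -/
lemma exists_blockPoly_factorization {F : X →L[ℂ] X} (hF : Commute T F) (m₁ m₂ k : ℕ) :
    ∃ b : ℝ, |b| ≤ 1 ∧ Polynomial.aeval T (blockPoly (m₁ + m₂) k) * F =
      sqfOp T m₂ k * ((((b * ((k : ℝ) + 1) : ℝ) : ℂ) • (T ^ k * F)) *
        (sqfOp T m₁ k * (1 + T + T ^ 2) ^ (m₁ + m₂ + 1))) := by
  have hk : (0 : ℝ) < (k : ℝ) + 1 := by positivity
  -- The exponents of `k + 1` in the three factors are `m₂ - 1/2`, `1` and `m₁ - 1/2`, with sum `m₁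
  -- + m₂`; the scalar `b` restores the binomial coefficient.
  set b : ℝ := ((k + (m₁ + m₂)).choose (m₁ + m₂) : ℕ) / ((k : ℝ) + 1) ^ (m₁ + m₂) with hb
  refine ⟨b, ?_, ?_⟩
  · rw [abs_of_nonneg (by positivity), hb, div_le_one (by positivity)]
    exact_mod_cast choose_add_le_pow k (m₁ + m₂)
  · obtain ⟨p₁, hp₁⟩ : ∃ p : Polynomial ℂ, p = Polynomial.X ^ k * (1 - Polynomial.X) ^ m₁ *
      (1 + Polynomial.X + Polynomial.X ^ 2) ^ (m₁ + m₂ + 1) := ⟨_, rfl⟩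
    obtain ⟨p₂, hp₂⟩ : ∃ p : Polynomial ℂ, p = Polynomial.X ^ k * (1 - Polynomial.X) ^ m₂ :=
      ⟨_, rfl⟩
    have e1 : Polynomial.aeval T p₁ =
        T ^ k * (1 - T) ^ m₁ * (1 + T + T ^ 2) ^ (m₁ + m₂ + 1) := by
      simp only [hp₁, map_mul, map_pow, map_sub, map_add, map_one, Polynomial.aeval_X]
    have e2 : Polynomial.aeval T p₂ = T ^ k * (1 - T) ^ m₂ := by
      simp only [hp₂, map_mul, map_pow, map_sub, map_one, Polynomial.aeval_X]
    have e3 : Polynomial.aeval T (Polynomial.X ^ k : Polynomial ℂ) = T ^ k := by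
      simp only [map_pow, Polynomial.aeval_X]
    have hs : ((((k : ℝ) + 1) ^ ((m₂ : ℝ) - 1 / 2) : ℝ) : ℂ) *
        (((b * ((k : ℝ) + 1) : ℝ) : ℂ) * ((((k : ℝ) + 1) ^ ((m₁ : ℝ) - 1 / 2) : ℝ) : ℂ)) =
        (((k + (m₁ + m₂)).choose (m₁ + m₂) : ℕ) : ℂ) := by
      rw [← Complex.ofReal_mul, ← Complex.ofReal_mul, ← Complex.ofReal_natCast]
      congr 1
      have h1 : ((k : ℝ) + 1) ^ ((m₂ : ℝ) - 1 / 2) * (((k : ℝ) + 1) *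
          ((k : ℝ) + 1) ^ ((m₁ : ℝ) - 1 / 2)) = ((k : ℝ) + 1) ^ (m₁ + m₂) := by
        nth_rw 2 [← Real.rpow_one ((k : ℝ) + 1)]
        rw [← Real.rpow_add hk, ← Real.rpow_add hk, ← Real.rpow_natCast]
        congr 1
        push_cast
        ring
      rw [show ((k : ℝ) + 1) ^ ((m₂ : ℝ) - 1 / 2) * (b * ((k : ℝ) + 1) *
        ((k : ℝ) + 1) ^ ((m₁ : ℝ) - 1 / 2)) = b * (((k : ℝ) + 1) ^ ((m₂ : ℝ) - 1 / 2) *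
          (((k : ℝ) + 1) * ((k : ℝ) + 1) ^ ((m₁ : ℝ) - 1 / 2))) by ring, h1, hb,
        div_mul_cancel₀ _ (by positivity)]
    have hpoly : blockPoly (m₁ + m₂) k =
        Polynomial.C (((k + (m₁ + m₂)).choose (m₁ + m₂) : ℕ) : ℂ) *
          (p₂ * (Polynomial.X ^ k * p₁)) := by
      simp only [blockPoly, hp₁, hp₂]
      ring
    simp only [sqfOp, smul_mul_assoc, mul_smul_comm, smul_smul]
    rw [mul_comm, mul_comm (Complex.ofReal _) (Complex.ofReal (b * _)), hs, ← e1, ← e2, ← e3,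
      hpoly, map_mul, map_mul, map_mul, Polynomial.aeval_C,
      Algebra.algebraMap_eq_smul_one, smul_mul_assoc, one_mul, smul_mul_assoc, mul_assoc _ F,
      ← (commute_aeval hF p₁).eq]
    simp only [mul_assoc]

end Space

/-! ### Convergence and identification of the block series -/

section Space

variable {X : Type*} [NormedAddCommGroup X] [NormedSpace ℂ X] [CompleteSpace X]
variable {T : X →L[ℂ] X} {ω ν ϑ : ℝ} {f : ℂ → ℂ}

/-- Both square function estimates control the blocks of the reproducing formula. -/
lemma IsRRittOfType.exists_block_estimate (h : IsRRittOfType T ω) (hω : 1 < ω) (h1 : ω < ϑ)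
    (h2 : ϑ < ν) {m₁ m₂ : ℕ} (hsq : SquareFunctionEstimate T m₁)
    (hdual : DualSquareFunctionEstimate T m₂) :
    ∃ C, 0 ≤ C ∧ ∀ (f : ℂ → ℂ) (M : ℝ), IsHInfty (stolz ν) f → 0 < M →
      (∀ z ∈ stolz ν, ‖f z‖ ≤ M) → ∀ x : X,
      (∃ y, Tendsto (fun n => ∑ k ∈ Finset.range n, Polynomial.aeval T (blockPoly (m₁ + m₂) k)
        (elementaryIntegral T ϑ (fun z => (1 - z) * f z) x)) atTop (𝓝 y)) ∧
      ∀ y, Tendsto (fun n => ∑ k ∈ Finset.range n, Polynomial.aeval T (blockPoly (m₁ + m₂) k)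
        (elementaryIntegral T ϑ (fun z => (1 - z) * f z) x)) atTop (𝓝 y) → ‖y‖ ≤ C * M * ‖x‖ := by
  obtain ⟨C₁, hC₁⟩ := hsq
  obtain ⟨C₂, hC₂, hd⟩ := hdual.exists_norm_sum_le
  obtain ⟨C₃, hC₃, hR⟩ := h.exists_isRBoundedBy hω h1 h2
  set P : X →L[ℂ] X := (1 + T + T ^ 2) ^ (m₁ + m₂ + 1) with hP
  refine ⟨C₂ * (2 * C₃) * (max C₁ 0 * ‖P‖), by positivity, fun f M hf hM hfM x => ?_⟩
  have hel := hf.isElementaryVia_one_sub_mul hω h1 h2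
  set F := elementaryIntegral T ϑ (fun z => (1 - z) * f z) with hF
  have hcomm : Commute T F := h.isRittOfType.commute_elementaryIntegral hω hel
  choose b hb hfac using exists_blockPoly_factorization hcomm m₁ m₂
  set D := C₂ * (2 * (C₃ * M)) with hD
  have hD0 : 0 ≤ D := by positivity
  set S : ℕ → X →L[ℂ] X := fun k => ((b k * ((k : ℝ) + 1) : ℝ) : ℂ) • (T ^ k * F) with hS
  -- Tested against a functional, the left factors are controlled by the dual square function
  -- estimate, and the R-bounded middle factors are then removed from the Gaussian norm.
  have hblock (n m : ℕ) :
      ‖∑ k ∈ Finset.Ico n m, Polynomial.aeval T (blockPoly (m₁ + m₂) k) (F x)‖ ≤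
        D * gaussianNorm n m fun k => sqfOp T m₁ k (P x) := by
    refine NormedSpace.norm_le_dual_bound ℂ _
      (mul_nonneg hD0 (gaussianNorm_nonneg _ _ _)) fun x' => ?_
    have e1 : x' (∑ k ∈ Finset.Ico n m, Polynomial.aeval T (blockPoly (m₁ + m₂) k) (F x)) =
        ∑ k ∈ Finset.Ico n m, x' (sqfOp T m₂ k (S k (sqfOp T m₁ k (P x)))) := by
      rw [map_sum]
      refine Finset.sum_congr rfl fun k _ => ?_
      have := congrArg (fun A : X →L[ℂ] X => x' (A x)) (hfac k)
      simpa only [mul_apply_eq_comp] using this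
    have e2 := (hR f M hf hM hfM).gaussianNorm_le (by positivity) S
      (fun k => ⟨k, b k, hb k, rfl⟩) (fun k => sqfOp T m₁ k (P x)) n m
    rw [e1]
    calc _ ≤ C₂ * ‖x'‖ * gaussianNorm n m fun k => S k (sqfOp T m₁ k (P x)) := hd _ _ _ _
      _ ≤ C₂ * ‖x'‖ * (2 * (C₃ * M) * gaussianNorm n m fun k => sqfOp T m₁ k (P x)) := by gcongr
      _ = _ := by rw [hD]; ring
  obtain ⟨Γ, hΓ, hΓn⟩ := hC₁ (P x)
  refine ⟨?_, fun y hy => ?_⟩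
  · refine cauchySeq_tendsto_of_complete (Metric.cauchySeq_iff'.2 fun δ hδ => ?_)
    obtain ⟨n₀, hn₀⟩ := hΓ.exists_gaussianNorm_lt (δ := δ / (D + 1) / 2) (by positivity)
    refine ⟨n₀, fun n hn => ?_⟩
    rw [dist_eq_norm, ← Finset.sum_Ico_eq_sub _ hn]
    calc _ ≤ D * gaussianNorm n₀ n fun k => sqfOp T m₁ k (P x) := hblock n₀ n
      _ ≤ D * (δ / (D + 1) / 2) := mul_le_mul_of_nonneg_left (hn₀ n₀ n le_rfl hn) hD0
      _ ≤ (D + 1) * (δ / (D + 1) / 2) := by gcongr; linarith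
      _ = δ / 2 := by field_simp
      _ < δ := half_lt_self hδ
  · have hK : eLpNorm Γ 2 gaussianSeq ≤ ENNReal.ofReal (max C₁ 0 * ‖P x‖) :=
      hΓn.trans (ENNReal.ofReal_le_ofReal
        (mul_le_mul_of_nonneg_right (le_max_left _ _) (norm_nonneg _)))
    have h3 : ‖y‖ ≤ D * (max C₁ 0 * ‖P x‖) := by
      refine le_of_forall_pos_le_add fun δ hδ => ?_
      refine le_of_tendsto hy.norm ?_
      filter_upwards [hΓ.eventually_gaussianNorm_le hK (by positivity)
        (δ := δ / (D + 1)) (by positivity)] with n hn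
      rw [Finset.range_eq_Ico]
      calc _ ≤ D * gaussianNorm 0 n fun k => sqfOp T m₁ k (P x) := hblock 0 n
        _ ≤ D * (max C₁ 0 * ‖P x‖ + δ / (D + 1)) := mul_le_mul_of_nonneg_left hn hD0
        _ = D * (max C₁ 0 * ‖P x‖) + D / (D + 1) * δ := by ring
        _ ≤ D * (max C₁ 0 * ‖P x‖) + 1 * δ := by
          gcongr
          rw [div_le_one (by positivity)]
          linarith
        _ = _ := by rw [one_mul]
    calc ‖y‖ ≤ D * (max C₁ 0 * ‖P x‖) := h3
      _ ≤ D * (max C₁ 0 * (‖P‖ * ‖x‖)) := by gcongr; exact P.le_opNorm x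
      _ = _ := by rw [hD]; ring

lemma hInftyNorm_nonneg (Ω : Set ℂ) (f : ℂ → ℂ) : 0 ≤ hInftyNorm Ω f :=
  Real.iSup_nonneg fun _ => norm_nonneg _

/-- The regularised operator `f(T)`, for every regulariser, is the sum of the blocks. -/
lemma IsRittOfType.extendedCalculus (h : IsRittOfType T ω) (hω : 1 < ω) (h1 : ω < ϑ)
    (h2 : ϑ < ν) (hinj : Function.Injective (1 - T : X →L[ℂ] X)) (hf : IsHInfty (stolz ν) f)
    {M : ℕ} (hM : 1 ≤ M) {S : X →L[ℂ] X}
    (hS : ∀ x, Tendsto (fun n => ∑ k ∈ Finset.range n, Polynomial.aeval T (blockPoly M k)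
        (elementaryIntegral T ϑ (fun z => (1 - z) * f z) x)) atTop (𝓝 (S x))) :
    ExtendedCalculus T ω ν f S := by
  refine ⟨⟨fun z => 1 - z, _, _, ⟨ϑ, isElementaryVia_one_sub hω h1 h2, rfl⟩, ?_,
    ϑ, hf.isElementaryVia_one_sub_mul hω h1 h2, rfl⟩, ?_⟩
  · rwa [h.elementaryIntegral_one_sub hω h1]
  · rintro e E G ⟨⟨ϑ₁, he, rfl⟩, -, ϑ₂, hef, rfl⟩
    -- Multiplicativity needs nested curves, so `(1 - z) f` is moved to a curve outside that of the
    -- regulariser.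
    obtain ⟨ϑ₃, h3, h3'⟩ := exists_between he.2.2.1
    have hf3 := hf.isElementaryVia_one_sub_mul hω (he.2.1.trans h3) h3'
    set E := elementaryIntegral T ϑ₁ e
    have hE : Commute T E := h.commute_elementaryIntegral hω he
    have hE1 : Commute (1 - T) E := (Commute.one_left E).sub_left hE
    -- After multiplication by `1 - T` all paths are interchangeable, and `e(T) ((1 - z) f)(T)`
    -- agrees with `(1 - T) (e f)(T)`. The block series formed with `e(T) ((1 - z) f)(T)` therefore
    -- tends to `(e f)(T)`, and `e(T)` commutes with the blocks.
    have key : (1 - T) * (E * elementaryIntegral T ϑ fun z => (1 - z) * f z) =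
        (1 - T) * ((1 - T) * elementaryIntegral T ϑ₂ fun z => e z * f z) := by
      have e1 : (fun z => e z * ((1 - z) * f z)) = fun z => (1 - z) * (e z * f z) := by
        ext z; ring
      rw [← mul_assoc, hE1.eq, mul_assoc,
        h.one_sub_mul_eq hω hf h1 h2 (he.2.1.trans h3) h3', ← mul_assoc, ← hE1.eq, mul_assoc,
        h.elementaryIntegral_mul_elementaryIntegral hω he hf3 h3, e1,
        h.one_sub_mul_eq hω (he.1.mul hf) he.2.1 he.2.2.1 hef.2.1 hef.2.2.1,
        h.one_sub_mul_elementaryIntegral hω hef]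
    ext x
    refine tendsto_nhds_unique ?_ (h.tendsto_sum_aeval_blockPoly hω hef hM key x)
    refine ((E.continuous.tendsto _).comp (hS x)).congr fun n => ?_
    simp only [Function.comp_apply, map_sum]
    refine Finset.sum_congr rfl fun k _ => ?_
    have := congrArg (fun A : X →L[ℂ] X => A
      (elementaryIntegral T ϑ (fun z => (1 - z) * f z) x)) (commute_aeval hE (blockPoly M k)).eq
    simpa only [mul_apply_eq_comp] using this.symm

end Space

end Ritt

end

theorem theorem6p1 {X : Type*} [NormedAddCommGroup X] [NormedSpace ℂ X] [CompleteSpace X]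
    (T : X →L[ℂ] X) (ω : ℝ) (hω : 1 < ω) (hT : Ritt.IsRRittOfType T ω)
    (m₁ m₂ : ℕ) (hm₁ : 1 ≤ m₁) (hm₂ : 1 ≤ m₂)
    (hsq : Ritt.SquareFunctionEstimate T m₁)
    (hdual : Ritt.DualSquareFunctionEstimate T m₂) :
    ∀ θ : ℝ, ω < θ → Ritt.HasBoundedHInftyCalculus T ω θ := by
  intro ν hν
  obtain ⟨ϑ, h1, h2⟩ := exists_between hν
  have hR := hT.isRittOfType
  have hM : 1 ≤ m₁ + m₂ := by omega
  obtain ⟨C, hC, hb⟩ := hT.exists_block_estimate hω h1 h2 hsq hdual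
  have hopnorm (f : ℂ → ℂ) (hf : Ritt.IsHInfty (Ritt.stolz ν) f) (A : X →L[ℂ] X)
      (hA : ∀ x, Tendsto (fun n => ∑ k ∈ Finset.range n,
        Polynomial.aeval T (Ritt.blockPoly (m₁ + m₂) k)
          (Ritt.elementaryIntegral T ϑ (fun z => (1 - z) * f z) x)) atTop (𝓝 (A x))) :
      ‖A‖ ≤ C * Ritt.hInftyNorm (Ritt.stolz ν) f := by
    have h0 := Ritt.hInftyNorm_nonneg (Ritt.stolz ν) f
    refine le_of_forall_pos_le_add fun δ hδ => ?_
    -- The block estimate requires a strictly positive bound for `f`, so the supremum norm is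
    -- enlarged slightly and the excess sent to zero.
    have hpos : 0 < Ritt.hInftyNorm (Ritt.stolz ν) f + δ / (C + 1) := by positivity
    have h3 : ‖A‖ ≤ C * (Ritt.hInftyNorm (Ritt.stolz ν) f + δ / (C + 1)) := by
      refine A.opNorm_le_bound (by positivity) fun x => ?_
      exact (hb f _ hf hpos (fun z hz => (hf.norm_le hz).trans
        (le_add_of_nonneg_right (by positivity))) x).2 _ (hA x)
    refine h3.trans ?_
    have h4 : C / (C + 1) ≤ 1 := by rw [div_le_one (by positivity)]; linarith
    calc _ = C * Ritt.hInftyNorm (Ritt.stolz ν) f + C / (C + 1) * δ := by ring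
      _ ≤ _ := by nlinarith
  refine ⟨C, ?_, ?_⟩
  · rintro f A ⟨ϑ', hf, rfl⟩
    -- The blocks are formed along the fixed path `ϑ`, while `f(T)` uses the arbitrary path `ϑ'`;
    -- thus `C` does not depend on `ϑ'`.
    refine hopnorm f hf.1 _ fun x => hR.tendsto_sum_aeval_blockPoly hω hf hM ?_ x
    rw [hR.one_sub_mul_eq hω hf.1 h1 h2 hf.2.1 hf.2.2.1, hR.one_sub_mul_elementaryIntegral hω hf]
  · intro hinj f hf
    have hpos : 0 < Ritt.hInftyNorm (Ritt.stolz ν) f + 1 := by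
      have := Ritt.hInftyNorm_nonneg (Ritt.stolz ν) f
      positivity
    choose S hS using fun x => (hb f _ hf hpos (fun z hz => (hf.norm_le hz).trans
      (le_add_of_nonneg_right zero_le_one)) x).1
    -- The strong limit of the partial sums is bounded by Banach–Steinhaus; its quantitative norm
    -- bound comes from `hopnorm`.
    let A : X →L[ℂ] X := continuousLinearMapOfTendsto
      (fun n => ∑ k ∈ Finset.range n, (Polynomial.aeval T (Ritt.blockPoly (m₁ + m₂) k)) *
        (Ritt.elementaryIntegral T ϑ (fun z => (1 - z) * f z))) (f := S)
      (tendsto_pi_nhds.2 fun x => by simpa using hS x)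
    have hA : ∀ x, Tendsto (fun n => ∑ k ∈ Finset.range n,
        Polynomial.aeval T (Ritt.blockPoly (m₁ + m₂) k)
          (Ritt.elementaryIntegral T ϑ (fun z => (1 - z) * f z) x)) atTop (𝓝 (A x)) := hS
    exact ⟨A, hR.extendedCalculus hω h1 h2 hinj hf hM hA, hopnorm f hf A hA⟩
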